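/- Let $B\subset\mathbb R^3$ be the closed unit ball, with coordinates $(x,y,z)$ and the orientation $dx\wedge dy\wedge dz$. All objects are $C^\infty$ up to the boundary. A plane field $\xi$ on $B$ (a smooth rank-2 subbundle of $TB$) is a positive (respectively negative) confoliation if there is a 1-form $\alpha$ on $B$ with $\xi=\ker\alpha$ and $\alpha\wedge d\alpha\ge 0$ (respectively $\alpha\wedge d\alpha\le 0$), and it is a foliation if there is a 1-form $\alpha$ on $B$ with $\xi=\ker\alpha$ and $\alpha\wedge d\alpha=0$. It is contact at a point $p$ if $(\alpha\wedge d\alpha)_p\neq 0$ for some 1-form $\alpha$ defined near $p$ in $B$ with $\xi=\ker\alpha$ near $p$. Theorem. Let $\xi$ be a (positive or negative) confoliation on $B$ which is standard near $\partial B$, i.e. $\xi=\ker dz$ at all points of $B$ in some neighbourhood of $\partial B$. Then $\xi$ is a foliation, and $(B,\xi)$ is diffeomorphic to the standard foliation $(B,\ker dz)$: there is a diffeomorphism $\varphi\colon B\to B$ with $d\varphi_p(\xi_p)=\ker dz$ for every $p\in B$. In particular $\xi$ is not contact at any point of $B$; that is, a confoliation obtained from the standard foliation $\ker dz$ of $B$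 by a modification away from a neighbourhood of $\partial B$ has no contact point, so a foliation cannot be perturbed into a contact structure locally in this way. -/

import Mathlib

open Set Metric Topology
open scoped ContDiff

/-- Euclidean 3-space, with coordinates `x = p 0`, `y = p 1`, `z = p 2`. -/
abbrev R3 : Type := EuclideanSpace ℝ (Fin 3)

/-- The closed unit ball in Euclidean 3-space. -/
def ball3 : Set R3 := closedBall 0 1

/-- The standard basis vectors `∂/∂x`, `∂/∂y`, `∂/∂z`. -/
noncomputable def stdVec (i : Fin 3) : R3 := EuclideanSpace.single i 1

/-- The constant 1-form `dz`. -/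
noncomputable def dz : R3 →L[ℝ] ℝ := EuclideanSpace.proj 2

/-- A field of linear subspaces: `ξ p` is a subspace of the tangent space at `p`. Only its values
on the set under consideration matter. -/
abbrev SubspaceField : Type := R3 → Submodule ℝ R3

/-- The standard horizontal plane field `ker dz`, tangent to the planes of constant `z`. -/
noncomputable def stdField : SubspaceField := fun _ => LinearMap.ker dz.toLinearMap

/-- `ξ` is a smooth plane field on `s`: near each point of `s` it is spanned by two smooth, pointwise
linearly independent vector fields. -/
def IsPlaneFieldOn (ξ : SubspaceField) (s : Set R3) : Prop :=
  ∀ p ∈ s, ∃ (U : Set R3) (v w : R3 → R3), IsOpen U ∧ p ∈ U ∧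
    ContDiffOn ℝ ∞ v (U ∩ s) ∧ ContDiffOn ℝ ∞ w (U ∩ s) ∧
    ∀ q ∈ U ∩ s, LinearIndependent ℝ ![v q, w q] ∧ ξ q = Submodule.span ℝ {v q, w q}

/-- The exterior derivative along `s` of the 1-form `α`. -/
noncomputable def dForm (α : R3 → R3 →L[ℝ] ℝ) (s : Set R3) (p : R3) : R3 [⋀^Fin 2]→L[ℝ] ℝ :=
  extDerivWithin (fun q => ContinuousAlternatingMap.ofSubsingleton ℝ R3 ℝ (0 : Fin 1) (α q)) s p

/-- The coefficient of `α ∧ dα` at `p` with respect to the volume form `dx ∧ dy ∧ dz`, that is, the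
value of `α ∧ dα` on `(∂/∂x, ∂/∂y, ∂/∂z)`. -/
noncomputable def wedgeD (α : R3 → R3 →L[ℝ] ℝ) (s : Set R3) (p : R3) : ℝ :=
  α p (stdVec 0) * dForm α s p ![stdVec 1, stdVec 2]
    + α p (stdVec 1) * dForm α s p ![stdVec 2, stdVec 0]
    + α p (stdVec 2) * dForm α s p ![stdVec 0, stdVec 1]

/-- `α` is a smooth 1-form on `s` with `ξ = ker α`. -/
def DefinesOn (α : R3 → R3 →L[ℝ] ℝ) (ξ : SubspaceField) (s : Set R3) : Prop :=
  ContDiffOn ℝ ∞ α s ∧ ∀ p ∈ s, ξ p = LinearMap.ker (α p).toLinearMap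

/-- A positive confoliation on `s`: a plane field `ξ = ker α` with `α ∧ dα ≥ 0`. -/
def IsPositiveConfoliationOn (ξ : SubspaceField) (s : Set R3) : Prop :=
  IsPlaneFieldOn ξ s ∧ ∃ α, DefinesOn α ξ s ∧ ∀ p ∈ s, 0 ≤ wedgeD α s p

/-- A negative confoliation on `s`: a plane field `ξ = ker α` with `α ∧ dα ≤ 0`. -/
def IsNegativeConfoliationOn (ξ : SubspaceField) (s : Set R3) : Prop :=
  IsPlaneFieldOn ξ s ∧ ∃ α, DefinesOn α ξ s ∧ ∀ p ∈ s, wedgeD α s p ≤ 0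

/-- A confoliation on `s`, of either sign. -/
def IsConfoliationOn (ξ : SubspaceField) (s : Set R3) : Prop :=
  IsPositiveConfoliationOn ξ s ∨ IsNegativeConfoliationOn ξ s

/-- A foliation on `s`: a plane field `ξ = ker α` with `α ∧ dα = 0`. -/
def IsFoliationOn (ξ : SubspaceField) (s : Set R3) : Prop :=
  IsPlaneFieldOn ξ s ∧ ∃ α, DefinesOn α ξ s ∧ ∀ p ∈ s, wedgeD α s p = 0

/-- `ξ` is contact (of either sign) at the point `p` of `s`: some 1-form that defines `ξ` near `p`
satisfies `(α ∧ dα)_p ≠ 0`. -/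
def IsContactAt (ξ : SubspaceField) (s : Set R3) (p : R3) : Prop :=
  ∃ (U : Set R3) (α : R3 → R3 →L[ℝ] ℝ), IsOpen U ∧ p ∈ U ∧ DefinesOn α ξ (U ∩ s) ∧
    wedgeD α s p ≠ 0

/-- `ξ` is standard near the boundary of the ball: it equals `ker dz` at all points of the ball in
some neighbourhood of the unit sphere. -/
def IsStandardNearBoundary (ξ : SubspaceField) : Prop :=
  ∃ U : Set R3, IsOpen U ∧ sphere 0 1 ⊆ U ∧ ∀ p ∈ U ∩ ball3, ξ p = stdField p

/-- `φ` restricts to a smooth diffeomorphism of `s` onto itself. -/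
def IsDiffeoOf (φ : R3 → R3) (s : Set R3) : Prop :=
  ContDiffOn ℝ ∞ φ s ∧ MapsTo φ s s ∧
    ∃ ψ : R3 → R3, ContDiffOn ℝ ∞ ψ s ∧ MapsTo ψ s s ∧ InvOn ψ φ s s

/-- `(s, ξ)` and `(s, η)` are diffeomorphic: the differential of some diffeomorphism of `s` carries
`ξ` to `η`. -/
def AreDiffeomorphicOn (ξ η : SubspaceField) (s : Set R3) : Prop :=
  ∃ φ : R3 → R3, IsDiffeoOf φ s ∧
    ∀ p ∈ s, (ξ p).map (fderivWithin ℝ φ s p).toLinearMap = η (φ p)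

/-! The unit normal of `ξ`, suitably cooriented, extends by `∂/∂z` to all of space
(`exists_unit_normal`). Inside the extended plane field one finds a unit field `X` that is `∂/∂x`
outside a ball (`exists_frame`). Flowing along `X` from a plane to the left of the ball gives an
injective chart `Φ` in which `ξ` is the kernel of `A dy + C dz`. In these terms the confoliation
condition says that the line `ker (A dy + C dz)` turns in one direction as `x` grows
(`pullCoeff_wronskian`).

Suppose first that all orbits above some height cross the ball. Moving down in `z`, as long as `C >
0`, the slope `σ A / C` starts at `0` and is nondecreasing in `x`, so `σ A ≥ 0` at the exit. There
the form is `dz`, so `A` is the `y`-derivative of the exit height. That height is `z` for both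
extreme values of `y`, hence it is constant. So `A` vanishes at the exit, and by monotonicity on the
whole orbit (`flat_step`, `flat_of_exits`): the crossing region is foliated by the surfaces of
constant chart height.

An orbit might instead be trapped, and `exits_of_frame` excludes this. Take a trapped orbit of
maximal height and, at that height, of maximal `y`. It accumulates at some `q` outside the image of
`Φ`. Near `q` the flows of `X`, `Y`, `N` are local coordinates. Lying on the frontier of the
foliated region above forces the `N`-coordinate to be zero, and lying on the edge of the sheet of
crossing orbits at the same height forces the `Y`-coordinate to be zero. So the orbit passes through
`q`, a contradiction.

Hence `Φ` is a diffeomorphism and `A = 0` everywhere: `ξ` is a foliation, straightened by the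
inverse of `Φ`. On the far right `Φ` differs from the identity by a map that preserves the height,
which is interpolated away by shears (`exists_straightening`). Conjugation by a stretch of the
`x`-axis then brings the support into the ball (`exists_compression`). Contact points are excluded
because another defining form changes `α ∧ dα` only by the square of a function
(`wedgeD_of_ker_eq`). -/

/-! ### Smoothness of composition operators on spaces of continuous curves -/

section Superposition

variable {K : Type} [TopologicalSpace K] [CompactSpace K]
variable {E F G : Type} [NormedAddCommGroup E] [NormedSpace ℝ E]
  [NormedAddCommGroup F] [NormedSpace ℝ F]

/-- Pointwise application of a continuous field of continuous linear maps. -/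
noncomputable def pointwiseApply (K E F : Type) [TopologicalSpace K] [CompactSpace K]
    [NormedAddCommGroup E] [NormedSpace ℝ E] [NormedAddCommGroup F] [NormedSpace ℝ F] :
    C(K, E →L[ℝ] F) →L[ℝ] C(K, E) →L[ℝ] C(K, F) :=
  LinearMap.mkContinuous₂
    (LinearMap.mk₂ ℝ (fun (A : C(K, E →L[ℝ] F)) (h : C(K, E)) =>
        (⟨fun t => A t (h t), by fun_prop⟩ : C(K, F)))
      (by intros; ext; simp) (by intros; ext; simp) (by intros; ext; simp)
      (by intros; ext; simp)) 1
    (by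
      intro A h
      rw [one_mul, ContinuousMap.norm_le _ (by positivity)]
      intro t
      exact (A t).le_opNorm_of_le (h.norm_coe_le_norm t) |>.trans
        (mul_le_mul_of_nonneg_right (A.norm_coe_le_norm t) (norm_nonneg _)))

@[simp] lemma pointwiseApply_apply (A : C(K, E →L[ℝ] F)) (h : C(K, E)) (t : K) :
    pointwiseApply K E F A h t = A t (h t) := rfl

lemma norm_pointwiseApply_le {A : C(K, E →L[ℝ] F)} {c : ℝ} (hc : 0 ≤ c) (hA : ∀ t, ‖A t‖ ≤ c) :
    ‖pointwiseApply K E F A‖ ≤ c := by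
  refine ContinuousLinearMap.opNorm_le_bound _ hc fun h => ?_
  rw [ContinuousMap.norm_le _ (by positivity)]
  intro t
  exact ((A t).le_opNorm_of_le (h.norm_coe_le_norm t)).trans
    (mul_le_mul_of_nonneg_right (hA t) (norm_nonneg _))

/-- The superposition operator `γ ↦ V ∘ γ`. -/
def superposition (K : Type) [TopologicalSpace K] {E F : Type} [TopologicalSpace E]
    [TopologicalSpace F] (V : C(E, F)) (γ : C(K, E)) : C(K, F) := V.comp γ

/-- The derivative of `V` is uniformly continuous near the compact range of `γ`, so the pointwise
mean value estimate is uniform in `t`. -/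
lemma hasFDerivAt_superposition {V : E → F} (hV : ContDiff ℝ 1 V) (γ : C(K, E)) :
    HasFDerivAt (superposition K ⟨V, hV.continuous⟩)
      (pointwiseApply K E F (superposition K ⟨fderiv ℝ V, hV.continuous_fderiv one_ne_zero⟩ γ))
      γ := by
  rw [hasFDerivAt_iff_isLittleO_nhds_zero, Asymptotics.isLittleO_iff]
  intro ε hε
  have hcomp : IsCompact (range γ) := isCompact_range γ.continuous
  have hunif := hcomp.uniformContinuousAt_of_continuousAt (fderiv ℝ V)
    (fun a _ => (hV.continuous_fderiv one_ne_zero).continuousAt) (Metric.dist_mem_uniformity hε)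
  obtain ⟨δ, hδ, hunif⟩ := Metric.mem_uniformity_dist.1 hunif
  filter_upwards [Metric.ball_mem_nhds (0 : C(K, E)) hδ] with h hh
  rw [mem_ball_zero_iff] at hh
  rw [ContinuousMap.norm_le _ (by positivity)]
  intro t
  have hht : ‖h t‖ < δ := (h.norm_coe_le_norm t).trans_lt hh
  have key := (convex_ball (γ t) δ).norm_image_sub_le_of_norm_fderiv_le' (𝕜 := ℝ) (f := V)
    (φ := fderiv ℝ V (γ t)) (C := ε) (x := γ t) (y := γ t + h t)
    (fun x _ => (hV.differentiable one_ne_zero) x)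
    (fun x hx => by
      have := hunif (a := γ t) (b := x) (by rw [dist_comm]; exact hx) (mem_range_self t)
      rw [← dist_eq_norm, dist_comm]; exact this.le)
    (mem_ball_self hδ) (by simpa [mem_ball, dist_eq_norm] using hht)
  simp only [add_sub_cancel_left] at key
  exact key.trans (mul_le_mul_of_nonneg_left (h.norm_coe_le_norm t) hε.le)

/-- The derivative is again a superposition operator, with `fderiv ℝ V` in place of `V`, followed by
a fixed continuous linear map. The target space changes at each differentiation, so `F` is
quantified inside the induction. -/
lemma contDiff_superposition_nat (n : ℕ) : ∀ (F : Type) [NormedAddCommGroup F] [NormedSpace ℝ F]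
    (V : E → F) (hV : ContDiff ℝ ∞ V),
    ContDiff ℝ n (superposition K (⟨V, hV.continuous⟩ : C(E, F))) := by
  induction n with
  | zero =>
    intro F _ _ V hV
    rw [Nat.cast_zero, contDiff_zero]
    exact ContinuousMap.continuous_postcomp _
  | succ n ih =>
    intro F _ _ V hV
    rw [Nat.cast_succ, contDiff_succ_iff_hasFDerivAt]
    have hV1 : ContDiff ℝ 1 V := hV.of_le (by exact_mod_cast le_top)
    refine ⟨_, ?_, fun γ => hasFDerivAt_superposition hV1 γ⟩
    exact (pointwiseApply K E F).contDiff.comp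
      (ih (E →L[ℝ] F) (fderiv ℝ V) (hV.fderiv_right (m := ∞) (by simp)))

lemma contDiff_superposition {V : E → F} (hV : ContDiff ℝ ∞ V) :
    ContDiff ℝ ∞ (superposition K (⟨V, hV.continuous⟩ : C(E, F))) :=
  contDiff_infty.2 fun n => contDiff_superposition_nat n F V hV

end Superposition

/-! ### Global flows and their joint smoothness -/

section Flow

open unitInterval intervalIntegral MeasureTheory
open scoped NNReal

variable {E : Type} [NormedAddCommGroup E] [NormedSpace ℝ E] [CompleteSpace E]

/-- The primitive vanishing at `0` of a continuous curve on the unit interval. -/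
noncomputable def primitiveCLM (E : Type) [NormedAddCommGroup E] [NormedSpace ℝ E]
    [CompleteSpace E] : C(I, E) →L[ℝ] C(I, E) :=
  LinearMap.mkContinuous
    { toFun := fun γ => ⟨fun t => ∫ s in (0 : ℝ)..t, γ (projIcc 0 1 zero_le_one s), by
          have : Continuous fun s : ℝ => γ (projIcc 0 1 zero_le_one s) := by fun_prop
          exact (continuous_primitive (fun a b => this.intervalIntegrable a b) 0).comp
            continuous_subtype_val⟩
      map_add' := by
        intro γ δ
        ext t
        have h1 : Continuous fun s : ℝ => γ (projIcc 0 1 zero_le_one s) := by fun_prop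
        have h2 : Continuous fun s : ℝ => δ (projIcc 0 1 zero_le_one s) := by fun_prop
        simpa using integral_add (h1.intervalIntegrable _ _) (h2.intervalIntegrable _ _)
      map_smul' := by intro c γ; ext t; simp }
    1 (by
      intro γ
      rw [one_mul, ContinuousMap.norm_le _ (norm_nonneg _)]
      intro t
      refine (norm_integral_le_of_norm_le_const (C := ‖γ‖)
        fun s _ => γ.norm_coe_le_norm _).trans ?_
      rw [sub_zero, abs_of_nonneg t.2.1]
      exact mul_le_of_le_one_right (norm_nonneg _) t.2.2)

lemma primitiveCLM_apply (γ : C(I, E)) (t : I) :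
    primitiveCLM E γ t = ∫ s in (0 : ℝ)..t, γ (projIcc 0 1 zero_le_one s) := rfl

lemma norm_primitiveCLM_le : ‖primitiveCLM E‖ ≤ 1 :=
  LinearMap.mkContinuous_norm_le _ zero_le_one _

/-- `Θ` is the global flow of the vector field `V`. -/
structure IsFlow (V : E → E) (Θ : ℝ → E → E) : Prop where
  zero : ∀ x, Θ 0 x = x
  hasDerivAt : ∀ x t, HasDerivAt (fun s => Θ s x) (V (Θ t x)) t

/-- A bound `L` on the speed lets Picard–Lindelöf run on every interval `[-T, T]`, with radius `L *
T`; uniqueness makes the solutions agree. -/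
lemma exists_integralCurve {V : E → E} {K L : ℝ≥0} (hK : LipschitzWith K V)
    (hL : ∀ x, ‖V x‖ ≤ L) (x : E) :
    ∃ c : ℝ → E, c 0 = x ∧ ∀ t, HasDerivAt c (V (c t)) t := by
  have hloc : ∀ T : ℝ≥0, ∃ c : ℝ → E, c 0 = x ∧
      ∀ t ∈ Ioo (-(T : ℝ)) T, HasDerivAt c (V (c t)) t := by
    intro T
    have h0 : (0 : ℝ) ∈ Icc (-(T : ℝ)) T := by simp
    have hPL : IsPicardLindelof (fun _ : ℝ => V) (⟨0, h0⟩ : Icc (-(T : ℝ)) T) x (L * T) 0 L K :=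
      { lipschitzOnWith := fun _ _ => hK.lipschitzOnWith
        continuousOn := fun _ _ => continuousOn_const
        norm_le := fun _ _ y _ => hL y
        mul_max_le := by simp }
    obtain ⟨c, hc0, hc⟩ := hPL.exists_eq_forall_mem_Icc_hasDerivWithinAt₀
    exact ⟨c, hc0, fun t ht => (hc t (Ioo_subset_Icc_self ht)).hasDerivAt
      (Icc_mem_nhds ht.1 ht.2)⟩
  choose c hc0 hc using hloc
  have hagree : ∀ (T S : ℝ≥0) (t : ℝ), |t| < T → T ≤ S → c T t = c S t := by
    intro T S t ht hTS
    have hTS' : (T : ℝ) ≤ S := hTS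
    have hT0 : 0 < (T : ℝ) := (abs_nonneg t).trans_lt ht
    refine ODE_solution_unique_of_mem_Ioo (v := fun _ => V) (s := fun _ => univ) (K := K)
      (t₀ := 0) (a := -(T : ℝ)) (b := T)
      (fun _ _ => hK.lipschitzOnWith) ⟨by linarith, hT0⟩ (fun s hs => ⟨hc T s hs, mem_univ _⟩)
      (fun s hs => ⟨hc S s ⟨by linarith [hs.1], by linarith [hs.2]⟩, mem_univ _⟩)
      (by rw [hc0, hc0]) (abs_lt.1 ht)
  refine ⟨fun t => c (‖t‖₊ + 1) t, hc0 _, fun t => ?_⟩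
  have hmem : t ∈ Ioo (-((‖t‖₊ + 2 : ℝ≥0) : ℝ)) (‖t‖₊ + 2 : ℝ≥0) := by
    simp only [NNReal.coe_add, coe_nnnorm, Real.norm_eq_abs, NNReal.coe_ofNat]
    constructor <;> linarith [neg_abs_le t, le_abs_self t]
  have hd := hc (‖t‖₊ + 2) t hmem
  have e1 : ∀ s, |s| < |t| + 1 → c (‖s‖₊ + 1) s = c (‖t‖₊ + 2) s := fun s hs =>
    hagree _ _ s (by simp) (by
      rw [← NNReal.coe_le_coe]
      simp only [NNReal.coe_add, coe_nnnorm, Real.norm_eq_abs, NNReal.coe_ofNat, NNReal.coe_one]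
      linarith)
  dsimp only
  rw [e1 t (by linarith)]
  refine hd.congr_of_eventuallyEq ?_
  have : ∀ᶠ s in 𝓝 t, |s| < |t| + 1 :=
    (continuous_abs.tendsto t).eventually (gt_mem_nhds (by linarith))
  filter_upwards [this] with s hs using e1 s hs

lemma exists_isFlow {V : E → E} {K L : ℝ≥0} (hK : LipschitzWith K V) (hL : ∀ x, ‖V x‖ ≤ L) :
    ∃ Θ, IsFlow V Θ := by
  choose c hc0 hc using exists_integralCurve hK hL
  exact ⟨fun t x => c x t, hc0, hc⟩

namespace IsFlow

variable {V : E → E} {Θ : ℝ → E → E} {K : ℝ≥0}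

omit [CompleteSpace E] in
lemma eq_of_hasDerivAt (hΘ : IsFlow V Θ) (hK : LipschitzWith K V) {c : ℝ → E}
    (hc : ∀ t, HasDerivAt c (V (c t)) t) (t : ℝ) : c t = Θ t (c 0) :=
  congr_fun (ODE_solution_unique_univ (v := fun _ => V) (s := fun _ => univ) (K := K) (t₀ := 0)
    (fun _ => hK.lipschitzOnWith) (fun t => ⟨hc t, mem_univ _⟩)
    (fun t => ⟨hΘ.hasDerivAt _ t, mem_univ _⟩) (hΘ.zero _).symm) t

omit [CompleteSpace E] in
lemma add (hΘ : IsFlow V Θ) (hK : LipschitzWith K V) (s t : ℝ) (x : E) :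
    Θ (s + t) x = Θ s (Θ t x) := by
  have := hΘ.eq_of_hasDerivAt hK (c := fun u => Θ (u + t) x)
    (fun u => (hΘ.hasDerivAt x (u + t)).comp_add_const u t) s
  simpa using this

omit [CompleteSpace E] in
lemma neg_apply (hΘ : IsFlow V Θ) (hK : LipschitzWith K V) (t : ℝ) (x : E) :
    Θ (-t) (Θ t x) = x := by
  rw [← hΘ.add hK, neg_add_cancel, hΘ.zero]

omit [CompleteSpace E] in
lemma apply_neg (hΘ : IsFlow V Θ) (hK : LipschitzWith K V) (t : ℝ) (x : E) :
    Θ t (Θ (-t) x) = x := by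
  rw [← hΘ.add hK, add_neg_cancel, hΘ.zero]

omit [CompleteSpace E] in
lemma eq_of_hasDerivAt_of_nonneg (hΘ : IsFlow V Θ) (hK : LipschitzWith K V) {c : ℝ → E} {T : ℝ}
    (hT : 0 ≤ T) (hc : ∀ t ∈ Icc 0 T, HasDerivAt c (V (c t)) t) : c T = Θ T (c 0) :=
  ODE_solution_unique (v := fun _ => V) (K := K) (a := 0) (b := T) (fun _ => hK)
    (fun t ht => (hc t ht).continuousAt.continuousWithinAt)
    (fun t ht => (hc t ⟨ht.1, ht.2.le⟩).hasDerivWithinAt)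
    (fun t _ => (hΘ.hasDerivAt _ t).continuousAt.continuousWithinAt)
    (fun t _ => (hΘ.hasDerivAt _ t).hasDerivWithinAt) (hΘ.zero _).symm ⟨hT, le_rfl⟩

/-- An orbit rescaled to the unit interval. -/
noncomputable def rescaledOrbit (hΘ : IsFlow V Θ) (τ : ℝ) (x : E) : C(I, E) :=
  ⟨fun t => Θ (τ * t) x, by
    have : Continuous fun s => Θ s x :=
      continuous_iff_continuousAt.2 fun s => (hΘ.hasDerivAt x s).continuousAt
    fun_prop⟩

/-- The integral equation of the rescaled orbits. -/
noncomputable def integralEquation (V : C(E, E)) (u : (ℝ × E) × C(I, E)) : C(I, E) :=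
  u.2 - ContinuousMap.const I u.1.2 - u.1.1 • primitiveCLM E (superposition I V u.2)

lemma integralEquation_rescaledOrbit (hΘ : IsFlow V Θ) (hV : Continuous V) (τ : ℝ) (x : E) :
    integralEquation ⟨V, hV⟩ ((τ, x), hΘ.rescaledOrbit τ x) = 0 := by
  ext t
  have hd : ∀ s ∈ uIcc (0 : ℝ) t,
      HasDerivAt (fun s => Θ (τ * s) x) (τ • V (Θ (τ * s) x)) s := by
    intro s _
    have h := (hΘ.hasDerivAt x (τ * s)).scomp s ((hasDerivAt_id s).const_mul τ)
    simpa [Function.comp_def] using h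
  have hcont : Continuous fun s => Θ s x :=
    continuous_iff_continuousAt.2 fun s => (hΘ.hasDerivAt x s).continuousAt
  have hint := integral_eq_sub_of_hasDerivAt hd
    (Continuous.intervalIntegrable (by fun_prop) _ _)
  rw [intervalIntegral.integral_smul] at hint
  have hcongr : ∫ s in (0 : ℝ)..t,
      (superposition I ⟨V, hV⟩ (hΘ.rescaledOrbit τ x)) (projIcc 0 1 zero_le_one s)
      = ∫ s in (0 : ℝ)..t, V (Θ (τ * s) x) := by
    refine integral_congr fun s hs => ?_
    rw [uIcc_of_le t.2.1] at hs
    have : s ∈ Icc (0 : ℝ) 1 := ⟨hs.1, hs.2.trans t.2.2⟩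
    simp [superposition, rescaledOrbit, projIcc_of_mem zero_le_one this]
  simp only [integralEquation, ContinuousMap.sub_apply, ContinuousMap.smul_apply,
    primitiveCLM_apply, ContinuousMap.const_apply, ContinuousMap.zero_apply]
  rw [hcongr, hint]
  simp [rescaledOrbit, hΘ.zero]

lemma norm_primitive_superposition_sub_le (hK : LipschitzWith K V) (γ δ : C(I, E)) :
    ‖primitiveCLM E (superposition I ⟨V, hK.continuous⟩ γ)
      - primitiveCLM E (superposition I ⟨V, hK.continuous⟩ δ)‖ ≤ K * ‖γ - δ‖ := by
  rw [← map_sub]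
  refine ((primitiveCLM E).le_of_opNorm_le norm_primitiveCLM_le _).trans ?_
  rw [one_mul, ContinuousMap.norm_le _ (by positivity)]
  intro t
  exact (hK.norm_sub_le _ _).trans
    (mul_le_mul_of_nonneg_left ((γ - δ).norm_coe_le_norm t) K.2)

/-- For small `τ` the integral operator is a contraction with constant `|τ| * K`. -/
lemma integralEquation_unique (hK : LipschitzWith K V) {τ : ℝ} (hτ : |τ| * K < 1) {x : E}
    {γ δ : C(I, E)} (hγ : integralEquation ⟨V, hK.continuous⟩ ((τ, x), γ) = 0)
    (hδ : integralEquation ⟨V, hK.continuous⟩ ((τ, x), δ) = 0) : γ = δ := by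
  have h : γ - δ = τ • (primitiveCLM E (superposition I ⟨V, hK.continuous⟩ γ)
      - primitiveCLM E (superposition I ⟨V, hK.continuous⟩ δ)) := by
    simp only [integralEquation] at hγ hδ
    rw [smul_sub, ← sub_eq_zero]
    have := congr_arg₂ (· - ·) hγ hδ
    simp only [sub_zero] at this
    rw [← this]; abel
  have h2 : ‖γ - δ‖ ≤ |τ| * K * ‖γ - δ‖ := by
    conv_lhs => rw [h]
    rw [norm_smul, Real.norm_eq_abs, mul_assoc]
    exact mul_le_mul_of_nonneg_left (norm_primitive_superposition_sub_le hK γ δ) (abs_nonneg _)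
  rw [← sub_eq_zero, ← norm_le_zero_iff]
  nlinarith [norm_nonneg (γ - δ)]

/-- Implicit function theorem for the integral equation in the Banach space of curves. The partial
derivative in the curve is `1 - τ • B` with `‖τ • B‖ < 1`, invertible by a Neumann series.
Uniqueness identifies the implicit function with the rescaled orbit, and evaluation at `1` gives the
flow. -/
lemma contDiffAt_of_small (hΘ : IsFlow V Θ) (hV : ContDiff ℝ ∞ V) (hK : LipschitzWith K V)
    {τ : ℝ} (hτ : |τ| * K < 1) (x : E) :
    ContDiffAt ℝ ∞ (fun q : ℝ × E => Θ q.1 q.2) (τ, x) := by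
  set Vc : C(E, E) := ⟨V, hK.continuous⟩ with hVc
  set f := integralEquation Vc with hf
  have hfs : ContDiff ℝ ∞ f := by
    have h1 : ContDiff ℝ ∞ (superposition I Vc) := contDiff_superposition hV
    have h2 : ContDiff ℝ ∞ fun u : (ℝ × E) × C(I, E) => ContinuousMap.const I u.1.2 :=
      (ContinuousLinearMap.const ℝ I : E →L[ℝ] C(I, E)).contDiff.comp
        (contDiff_snd.comp contDiff_fst)
    refine (contDiff_snd.sub h2).sub ((contDiff_fst.comp contDiff_fst).smul ?_)
    exact (primitiveCLM E).contDiff.comp (h1.comp contDiff_snd)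
  set u : (ℝ × E) × C(I, E) := ((τ, x), hΘ.rescaledOrbit τ x) with hu
  have hne : (∞ : WithTop ℕ∞) ≠ 0 := by simp
  have hV1 : ContDiff ℝ 1 V := hV.of_le (by exact_mod_cast le_top)
  set B : C(I, E) →L[ℝ] C(I, E) := (primitiveCLM E).comp (pointwiseApply I E E
    (superposition I ⟨fderiv ℝ V, hV1.continuous_fderiv one_ne_zero⟩ (hΘ.rescaledOrbit τ x)))
    with hB
  have hBn : ‖τ • B‖ < 1 := by
    refine (ContinuousLinearMap.opNorm_smul_le τ B).trans_lt ?_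
    rw [Real.norm_eq_abs]
    refine lt_of_le_of_lt (mul_le_mul_of_nonneg_left ?_ (abs_nonneg _)) hτ
    refine (ContinuousLinearMap.opNorm_comp_le _ _).trans ?_
    refine (mul_le_mul norm_primitiveCLM_le (norm_pointwiseApply_le (c := K) K.2 fun t => ?_)
      (by positivity) zero_le_one).trans (one_mul _).le
    exact norm_fderiv_le_of_lipschitz ℝ hK
  have hpart : fderiv ℝ f u ∘L .inr ℝ (ℝ × E) C(I, E) = 1 - τ • B := by
    have h1 : HasFDerivAt (fun γ => f ((τ, x), γ))
        (fderiv ℝ f u ∘L .inr ℝ (ℝ × E) C(I, E)) (hΘ.rescaledOrbit τ x) := by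
      have := (hfs.differentiable hne u).hasFDerivAt
      exact this.comp (hΘ.rescaledOrbit τ x)
        (hasFDerivAt_prodMk_right (τ, x) (hΘ.rescaledOrbit τ x))
    have h2 : HasFDerivAt (fun γ => f ((τ, x), γ)) (1 - τ • B) (hΘ.rescaledOrbit τ x) := by
      have h3 := ((primitiveCLM E).hasFDerivAt.comp _
        (hasFDerivAt_superposition hV1 (hΘ.rescaledOrbit τ x))).const_smul τ
      exact ((hasFDerivAt_id _).sub_const (ContinuousMap.const I x)).sub h3
    exact h1.unique h2
  have hinv : (fderiv ℝ f u ∘L .inr ℝ (ℝ × E) C(I, E)).IsInvertible := by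
    rw [hpart]
    refine ⟨ContinuousLinearEquiv.unitsEquiv ℝ _ (Units.oneSub (τ • B) hBn), ?_⟩
    ext1 γ
    simp
  have cdf : ContDiffAt ℝ ∞ f u := hfs.contDiffAt
  have hψ := cdf.contDiffAt_implicitFunction hne hinv
  have hfu : f u = 0 := hΘ.integralEquation_rescaledOrbit hK.continuous τ x
  have hev := cdf.eventually_apply_implicitFunction hne hinv
  have hsmall : ∀ᶠ q : ℝ × E in 𝓝 (τ, x), |q.1| * K < 1 :=
    ContinuousAt.eventually_lt (f := fun q : ℝ × E => |q.1| * (K : ℝ)) (g := fun _ => (1 : ℝ))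
      (by fun_prop) continuousAt_const hτ
  have hev2 : (fun q : ℝ × E => Θ q.1 q.2) =ᶠ[𝓝 (τ, x)]
      fun q => cdf.implicitFunction hne hinv q (1 : I) := by
    filter_upwards [hev, hsmall] with q hq hqs
    rw [hfu] at hq
    have := integralEquation_unique hK hqs hq
      (hΘ.integralEquation_rescaledOrbit hK.continuous q.1 q.2)
    rw [this]
    simp [rescaledOrbit]
  refine ContDiffAt.congr_of_eventuallyEq ?_ hev2
  exact (ContinuousMap.evalCLM ℝ (1 : I)).contDiff.contDiffAt.comp (τ, x) hψ

/-- The time-`t` map is an `n`-fold composition of time-`t / n` maps, which are smooth once `n`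
exceeds `|t| * K`. -/
lemma contDiff_apply (hΘ : IsFlow V Θ) (hV : ContDiff ℝ ∞ V) (hK : LipschitzWith K V) (t : ℝ) :
    ContDiff ℝ ∞ (Θ t) := by
  obtain ⟨n, hn⟩ := exists_nat_gt (|t| * K)
  have hn0 : 0 < (n : ℝ) := lt_of_le_of_lt (by positivity) hn
  have hstep : ContDiff ℝ ∞ (Θ (t / n)) := contDiff_iff_contDiffAt.2 fun x =>
    (hΘ.contDiffAt_of_small hV hK (by
      rw [abs_div, abs_of_pos hn0, div_mul_eq_mul_div, div_lt_one hn0]; exact hn) x).comp x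
      (contDiffAt_const.prodMk contDiffAt_id)
  have hit : ∀ m : ℕ, ContDiff ℝ ∞ (Θ (m * (t / n))) := by
    intro m
    induction m with
    | zero => simpa [funext hΘ.zero] using contDiff_fun_id
    | succ m ih =>
      have : Θ ((m + 1 : ℕ) * (t / n)) = Θ (t / n) ∘ Θ (m * (t / n)) := by
        ext x
        rw [Function.comp, ← hΘ.add hK]; congr 1; push_cast; ring
      rw [this]; exact hstep.comp ih
  have := hit n
  rwa [mul_div_cancel₀ _ hn0.ne'] at this

/-- The flow of a smooth, globally Lipschitz vector field is jointly smooth. -/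
theorem contDiff (hΘ : IsFlow V Θ) (hV : ContDiff ℝ ∞ V) (hK : LipschitzWith K V) :
    ContDiff ℝ ∞ (fun q : ℝ × E => Θ q.1 q.2) := by
  rw [contDiff_iff_contDiffAt]
  rintro ⟨t, x⟩
  have h : (fun q : ℝ × E => Θ q.1 q.2) =
      (fun q : ℝ × E => Θ q.1 q.2) ∘ fun q : ℝ × E => (q.1 - t, Θ t q.2) := by
    ext q
    simp only [Function.comp]
    rw [← hΘ.add hK, sub_add_cancel]
  rw [h]
  refine ContDiffAt.comp (t, x) (hΘ.contDiffAt_of_small hV hK (by simp) _) ?_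
  exact (contDiffAt_fst.sub contDiffAt_const).prodMk
    ((hΘ.contDiff_apply hV hK t).contDiffAt.comp _ contDiffAt_snd)

end IsFlow

end Flow

/-! ### Coordinates, determinants and the algebra of `α ∧ dα` -/

section LinearAlgebra

/-- The vector with coordinates `a`, `b`, `c`. -/
noncomputable def vec3 (a b c : ℝ) : R3 := !₂[a, b, c]

@[simp] lemma vec3_zero (a b c : ℝ) : vec3 a b c 0 = a := rfl
@[simp] lemma vec3_one (a b c : ℝ) : vec3 a b c 1 = b := rfl
@[simp] lemma vec3_two (a b c : ℝ) : vec3 a b c 2 = c := rfl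

lemma ext3 {p q : R3} (h0 : p 0 = q 0) (h1 : p 1 = q 1) (h2 : p 2 = q 2) : p = q := by
  ext i; fin_cases i <;> assumption

@[simp] lemma stdVec_apply (i j : Fin 3) : stdVec i j = if j = i then 1 else 0 := by
  simp [stdVec]

lemma eq_sum_stdVec (p : R3) : p = p 0 • stdVec 0 + p 1 • stdVec 1 + p 2 • stdVec 2 := by
  apply ext3 <;> simp

@[simp] lemma dz_apply (p : R3) : dz p = p 2 := rfl

lemma sq_norm_eq (p : R3) : ‖p‖ ^ 2 = p 0 ^ 2 + p 1 ^ 2 + p 2 ^ 2 := by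
  simp [EuclideanSpace.norm_sq_eq, Fin.sum_univ_three]

lemma inner_eq (p q : R3) : inner ℝ p q = p 0 * q 0 + p 1 * q 1 + p 2 * q 2 := by
  simp [PiLp.inner_apply, Fin.sum_univ_three, mul_comm]

lemma abs_coord_le_norm (p : R3) (i : Fin 3) : |p i| ≤ ‖p‖ := PiLp.norm_apply_le p i

@[fun_prop] lemma contDiff_coord {n : WithTop ℕ∞} (i : Fin 3) :
    ContDiff ℝ n (fun p : R3 => p i) :=
  (EuclideanSpace.proj i : R3 →L[ℝ] ℝ).contDiff

@[fun_prop] lemma continuous_coord (i : Fin 3) : Continuous (fun p : R3 => p i) :=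
  (contDiff_coord (n := 0) i).continuous

lemma contDiff_vec3 {F : Type*} [NormedAddCommGroup F] [NormedSpace ℝ F] {n : WithTop ℕ∞}
    {a b c : F → ℝ} (ha : ContDiff ℝ n a) (hb : ContDiff ℝ n b) (hc : ContDiff ℝ n c) :
    ContDiff ℝ n (fun x => vec3 (a x) (b x) (c x)) := by
  rw [contDiff_euclidean]
  intro i
  fin_cases i <;> assumption

lemma continuous_vec3 {F : Type*} [TopologicalSpace F] {a b c : F → ℝ} (ha : Continuous a)
    (hb : Continuous b) (hc : Continuous c) : Continuous (fun x => vec3 (a x) (b x) (c x)) := by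
  refine (PiLp.continuous_toLp 2 _).comp (continuous_pi fun i => ?_)
  fin_cases i <;> assumption

lemma HasFDerivAt.coord {F : Type*} [NormedAddCommGroup F] [NormedSpace ℝ F] {f : F → R3}
    {f' : F →L[ℝ] R3} {x : F} (h : HasFDerivAt f f' x) (i : Fin 3) :
    HasFDerivAt (fun y => f y i) ((EuclideanSpace.proj i : R3 →L[ℝ] ℝ).comp f') x :=
  (EuclideanSpace.proj i : R3 →L[ℝ] ℝ).hasFDerivAt.comp x h

lemma HasDerivAt.coord {f : ℝ → R3} {f' : R3} {x : ℝ} (h : HasDerivAt f f' x) (i : Fin 3) :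
    HasDerivAt (fun y => f y i) (f' i) x := by
  simpa using (HasFDerivAt.coord h.hasFDerivAt i).hasDerivAt

/-- The determinant of three vectors. -/
def det3 (u v w : R3) : ℝ :=
  u 0 * (v 1 * w 2 - v 2 * w 1) + u 1 * (v 2 * w 0 - v 0 * w 2) + u 2 * (v 0 * w 1 - v 1 * w 0)

/-- The cross product. -/
noncomputable def cross3 (u v : R3) : R3 :=
  vec3 (u 1 * v 2 - u 2 * v 1) (u 2 * v 0 - u 0 * v 2) (u 0 * v 1 - u 1 * v 0)

lemma contDiff_cross3 {u v : R3 → R3} (hu : ContDiff ℝ ∞ u) (hv : ContDiff ℝ ∞ v) :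
    ContDiff ℝ ∞ fun p => cross3 (u p) (v p) := by
  have hui : ∀ i, ContDiff ℝ ∞ fun p => u p i := fun i => (contDiff_coord i).comp hu
  have hvi : ∀ i, ContDiff ℝ ∞ fun p => v p i := fun i => (contDiff_coord i).comp hv
  exact contDiff_vec3 (((hui 1).mul (hvi 2)).sub ((hui 2).mul (hvi 1)))
    (((hui 2).mul (hvi 0)).sub ((hui 0).mul (hvi 2)))
    (((hui 0).mul (hvi 1)).sub ((hui 1).mul (hvi 0)))

/-- The coefficient of `a ∧ ω`, where `ω` is the antisymmetrization of `L`. -/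
noncomputable def wedgeCoeff (a : R3 →L[ℝ] ℝ) (L : R3 →L[ℝ] R3 →L[ℝ] ℝ) : ℝ :=
  a (stdVec 0) * (L (stdVec 1) (stdVec 2) - L (stdVec 2) (stdVec 1))
    + a (stdVec 1) * (L (stdVec 2) (stdVec 0) - L (stdVec 0) (stdVec 2))
    + a (stdVec 2) * (L (stdVec 0) (stdVec 1) - L (stdVec 1) (stdVec 0))

/-- A 3-form on 3-space is a multiple of the determinant. This allows `α ∧ dα` to be evaluated on
the frame carried by the flow chart. -/
lemma wedgeCoeff_det (a : R3 →L[ℝ] ℝ) (L : R3 →L[ℝ] R3 →L[ℝ] ℝ) (u v w : R3) :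
    a u * (L v w - L w v) + a v * (L w u - L u w) + a w * (L u v - L v u)
      = det3 u v w * wedgeCoeff a L := by
  have ha : ∀ x : R3, a x = x 0 * a (stdVec 0) + x 1 * a (stdVec 1) + x 2 * a (stdVec 2) := by
    intro x; conv_lhs => rw [eq_sum_stdVec x]
    simp
  have hL : ∀ x y : R3, L x y =
      x 0 * (y 0 * L (stdVec 0) (stdVec 0) + y 1 * L (stdVec 0) (stdVec 1)
        + y 2 * L (stdVec 0) (stdVec 2))
      + x 1 * (y 0 * L (stdVec 1) (stdVec 0) + y 1 * L (stdVec 1) (stdVec 1)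
        + y 2 * L (stdVec 1) (stdVec 2))
      + x 2 * (y 0 * L (stdVec 2) (stdVec 0) + y 1 * L (stdVec 2) (stdVec 1)
        + y 2 * L (stdVec 2) (stdVec 2)) := by
    intro x y; conv_lhs => rw [eq_sum_stdVec x, eq_sum_stdVec y]
    simp
  rw [ha u, ha v, ha w, hL v w, hL w v, hL w u, hL u w, hL u v, hL v u]
  unfold wedgeCoeff det3
  ring

/-- Since `d(gα) = g dα + dg ∧ α`, and the second term dies against `α`, only `g ^ 2` survives. -/
lemma wedgeCoeff_smul (g : ℝ) (dg a : R3 →L[ℝ] ℝ) (L : R3 →L[ℝ] R3 →L[ℝ] ℝ) :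
    wedgeCoeff (g • a) (g • L + dg.smulRight a) = g ^ 2 * wedgeCoeff a L := by
  simp [wedgeCoeff]
  ring

lemma det3_map (D : R3 →L[ℝ] R3) (u v w : R3) :
    det3 (D u) (D v) (D w)
      = det3 u v w * det3 (D (stdVec 0)) (D (stdVec 1)) (D (stdVec 2)) := by
  have hD : ∀ (x : R3) (i : Fin 3),
      D x i = x 0 * D (stdVec 0) i + x 1 * D (stdVec 1) i + x 2 * D (stdVec 2) i := by
    intro x i; conv_lhs => rw [eq_sum_stdVec x]
    simp
  unfold det3
  rw [hD u 0, hD u 1, hD u 2, hD v 0, hD v 1, hD v 2, hD w 0, hD w 1, hD w 2]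
  ring

end LinearAlgebra

/-! ### The exterior derivative in terms of the ordinary derivative -/

section Wedge

lemma dForm_apply {α : R3 → R3 →L[ℝ] ℝ} {s : Set R3} {p : R3}
    (hα : DifferentiableWithinAt ℝ α s p) (hs : UniqueDiffWithinAt ℝ s p) (v w : R3) :
    dForm α s p ![v, w] = fderivWithin ℝ α s p v w - fderivWithin ℝ α s p w v := by
  let T : (R3 →L[ℝ] ℝ) →L[ℝ] (R3 [⋀^Fin 1]→L[ℝ] ℝ) :=
    (ContinuousAlternatingMap.ofSubsingletonLIE (𝕜 := ℝ) (E := R3) (F := ℝ)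
      (0 : Fin 1)).toContinuousLinearEquiv.toContinuousLinearMap
  have h : HasFDerivWithinAt
      (fun q => ContinuousAlternatingMap.ofSubsingleton ℝ R3 ℝ (0 : Fin 1) (α q))
      (T.comp (fderivWithin ℝ α s p)) s p :=
    T.hasFDerivAt.comp_hasFDerivWithinAt p hα.hasFDerivWithinAt
  have happ : ∀ u : R3, fderivWithin ℝ (fun q => α q u) s p =
      (ContinuousLinearMap.apply ℝ ℝ u).comp (fderivWithin ℝ α s p) := fun u =>
    ((ContinuousLinearMap.apply ℝ ℝ u).hasFDerivAt.comp_hasFDerivWithinAt p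
      hα.hasFDerivWithinAt).fderivWithin hs
  unfold dForm
  rw [extDerivWithin_apply h.differentiableWithinAt hs]
  simp [Fin.sum_univ_two, Fin.removeNth_apply, happ]
  ring

lemma wedgeD_eq {α : R3 → R3 →L[ℝ] ℝ} {s : Set R3} {p : R3}
    (hα : DifferentiableWithinAt ℝ α s p) (hs : UniqueDiffWithinAt ℝ s p) :
    wedgeD α s p = wedgeCoeff (α p) (fderivWithin ℝ α s p) := by
  simp only [wedgeD, dForm_apply hα hs, wedgeCoeff]

lemma wedgeD_smul {α β : R3 → R3 →L[ℝ] ℝ} {g : R3 → ℝ} {s : Set R3} {p : R3}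
    (hα : DifferentiableWithinAt ℝ α s p) (hg : DifferentiableWithinAt ℝ g s p)
    (hs : UniqueDiffWithinAt ℝ s p) (hp : p ∈ s) (hβ : β =ᶠ[𝓝[s] p] fun q => g q • α q) :
    wedgeD β s p = g p ^ 2 * wedgeCoeff (α p) (fderivWithin ℝ α s p) := by
  have hgα : HasFDerivWithinAt (fun q => g q • α q) _ s p :=
    hg.hasFDerivWithinAt.smul hα.hasFDerivWithinAt
  have hβ' := hgα.congr_of_eventuallyEq hβ (hβ.self_of_nhdsWithin hp)
  rw [wedgeD_eq hβ'.differentiableWithinAt hs, hβ'.fderivWithin hs, hβ.self_of_nhdsWithin hp,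
    wedgeCoeff_smul]

end Wedge

/-! ### The flow chart of a field that is standard outside a ball -/

section FlowChart

open scoped NNReal

/-- A smooth vector field equal to `∂/∂x` outside the open ball of radius `r`, with its flow. -/
structure IsStdFlow (r : ℝ) (X : R3 → R3) (Θ : ℝ → R3 → R3) : Prop where
  pos : 0 < r
  contDiff : ContDiff ℝ ∞ X
  std : ∀ p, r ≤ ‖p‖ → X p = stdVec 0
  lip : ∃ K : ℝ≥0, LipschitzWith K X
  flow : IsFlow X Θ

/-- The flow chart: `p 0` is time, starting from the plane `x = -r`. -/
noncomputable def flowChart (r : ℝ) (Θ : ℝ → R3 → R3) (p : R3) : R3 :=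
  Θ (p 0 + r) (vec3 (-r) (p 1) (p 2))

lemma le_norm_of_le_abs {r : ℝ} {p : R3} (i : Fin 3) (h : r ≤ |p i|) : r ≤ ‖p‖ :=
  h.trans (abs_coord_le_norm p i)

lemma le_norm_of_sq_le {r : ℝ} {p : R3} (h : r ^ 2 ≤ p 1 ^ 2 + p 2 ^ 2) : r ≤ ‖p‖ := by
  have := sq_norm_eq p
  exact le_of_sq_le_sq (by nlinarith [sq_nonneg (p 0)]) (norm_nonneg _)

/-- The Jacobian determinant of a map. -/
noncomputable def jac (Φ : R3 → R3) (p : R3) : ℝ :=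
  det3 (fderiv ℝ Φ p (stdVec 0)) (fderiv ℝ Φ p (stdVec 1)) (fderiv ℝ Φ p (stdVec 2))

lemma jac_ne_zero_of_leftInverse {Φ : R3 → R3} {p : R3} {G : R3 →L[ℝ] R3}
    (hG : G.comp (fderiv ℝ Φ p) = ContinuousLinearMap.id ℝ R3) : jac Φ p ≠ 0 := by
  intro h0
  have h1 := det3_map (G.comp (fderiv ℝ Φ p)) (stdVec 0) (stdVec 1) (stdVec 2)
  have h2 := det3_map G (fderiv ℝ Φ p (stdVec 0)) (fderiv ℝ Φ p (stdVec 1))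
    (fderiv ℝ Φ p (stdVec 2))
  rw [show det3 (fderiv ℝ Φ p (stdVec 0)) (fderiv ℝ Φ p (stdVec 1))
    (fderiv ℝ Φ p (stdVec 2)) = 0 from h0, zero_mul] at h2
  have h3 : det3 (G.comp (fderiv ℝ Φ p) (stdVec 0)) (G.comp (fderiv ℝ Φ p) (stdVec 1))
    (G.comp (fderiv ℝ Φ p) (stdVec 2)) = 0 := h2
  rw [hG] at h3
  simp [det3] at h3

lemma continuous_fderiv_apply {Φ : R3 → R3} (hΦ : ContDiff ℝ ∞ Φ) (v : R3) :
    Continuous fun p => fderiv ℝ Φ p v :=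
  (hΦ.continuous_fderiv (by simp)).clm_apply continuous_const

lemma continuous_jac {Φ : R3 → R3} (hΦ : ContDiff ℝ ∞ Φ) : Continuous (jac Φ) := by
  have := continuous_fderiv_apply hΦ
  unfold jac det3
  have hc : ∀ (v : R3) (i : Fin 3), Continuous fun p => fderiv ℝ Φ p v i :=
    fun v i => (continuous_coord i).comp (this v)
  fun_prop (disch := assumption)

namespace IsStdFlow

variable {r : ℝ} {X : R3 → R3} {Θ : ℝ → R3 → R3} (h : IsStdFlow r X Θ)
include h

lemma add (s t : ℝ) (p : R3) : Θ (s + t) p = Θ s (Θ t p) :=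
  h.flow.add h.lip.choose_spec s t p

lemma neg_apply (t : ℝ) (p : R3) : Θ (-t) (Θ t p) = p :=
  h.flow.neg_apply h.lip.choose_spec t p

lemma apply_neg (t : ℝ) (p : R3) : Θ t (Θ (-t) p) = p :=
  h.flow.apply_neg h.lip.choose_spec t p

lemma contDiff_flow : ContDiff ℝ ∞ (fun q : ℝ × R3 => Θ q.1 q.2) :=
  h.flow.contDiff h.contDiff h.lip.choose_spec

lemma line {T : ℝ} (hT : 0 ≤ T) {p : R3} (hp : ∀ t ∈ Icc 0 T, r ≤ ‖p + t • stdVec 0‖) :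
    Θ T p = p + T • stdVec 0 := by
  have := h.flow.eq_of_hasDerivAt_of_nonneg h.lip.choose_spec (c := fun t => p + t • stdVec 0) hT
    (fun t ht => by
      rw [h.std _ (hp t ht)]
      simpa using ((hasDerivAt_id t).smul_const (stdVec 0)).const_add p)
  simpa using this.symm

lemma flow_right {p : R3} (hp : r ≤ p 0) {t : ℝ} (ht : 0 ≤ t) : Θ t p = p + t • stdVec 0 :=
  h.line ht fun s hs => le_norm_of_le_abs 0 (by
    simp only [PiLp.add_apply, PiLp.smul_apply, stdVec_apply, if_true, smul_eq_mul, mul_one]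
    exact (by linarith [hs.1] : r ≤ p 0 + s).trans (le_abs_self _))

lemma flow_left {p : R3} (hp : p 0 ≤ -r) {t : ℝ} (ht : 0 ≤ t) :
    Θ (-t) p = p - t • stdVec 0 := by
  have h1 : Θ t (p - t • stdVec 0) = p := by
    rw [h.line ht fun s hs => le_norm_of_le_abs 0 ?_]
    · simp
    · simp only [PiLp.add_apply, PiLp.sub_apply, PiLp.smul_apply, stdVec_apply, if_true,
        smul_eq_mul, mul_one]
      rw [abs_of_nonpos (by linarith [hs.2, h.pos])]
      linarith [hs.2]
  conv_lhs => rw [← h1]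
  rw [h.neg_apply]

lemma flow_out {p : R3} (hp : r ^ 2 ≤ p 1 ^ 2 + p 2 ^ 2) (t : ℝ) :
    Θ t p = p + t • stdVec 0 := by
  have key : ∀ (q : R3), r ^ 2 ≤ q 1 ^ 2 + q 2 ^ 2 → ∀ s : ℝ, 0 ≤ s →
      Θ s q = q + s • stdVec 0 := fun q hq s hs =>
    h.line hs fun u _ => le_norm_of_sq_le (by simpa using hq)
  rcases le_total 0 t with ht | ht
  · exact key p hp t ht
  · have h1 := key (p + t • stdVec 0) (by simpa using hp) (-t) (by linarith)
    have h2 : p + t • stdVec 0 + -t • stdVec 0 = p := by module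
    rw [h2] at h1
    conv_lhs => rw [← h1]
    rw [h.apply_neg]

omit h in
lemma flowChart_vec3_line (p : R3) (t : ℝ) :
    flowChart r Θ (p + t • stdVec 0) = Θ (p 0 + t + r) (vec3 (-r) (p 1) (p 2)) := by
  simp [flowChart]

lemma chart_shift (p : R3) (t : ℝ) :
    flowChart r Θ (p + t • stdVec 0) = Θ t (flowChart r Θ p) := by
  rw [flowChart_vec3_line, flowChart, ← h.add]
  congr 1; ring

lemma chart_left {p : R3} (hp : p 0 ≤ -r) : flowChart r Θ p = p := by
  have := h.flow_left (p := vec3 (-r) (p 1) (p 2)) (by simp) (t := -(p 0 + r)) (by linarith)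
  rw [neg_neg] at this
  rw [flowChart, this]
  apply ext3 <;> simp

lemma chart_out {p : R3} (hp : r ^ 2 ≤ p 1 ^ 2 + p 2 ^ 2) : flowChart r Θ p = p := by
  rw [flowChart, h.flow_out (by simpa using hp)]
  apply ext3 <;> simp

lemma chart_right {p : R3} (hp : r ≤ flowChart r Θ p 0) {t : ℝ} (ht : 0 ≤ t) :
    flowChart r Θ (p + t • stdVec 0) = flowChart r Θ p + t • stdVec 0 := by
  rw [h.chart_shift, h.flow_right hp ht]

lemma chart_contDiff : ContDiff ℝ ∞ (flowChart r Θ) := by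
  refine h.contDiff_flow.comp (ContDiff.prodMk ?_ ?_)
  · fun_prop
  · exact contDiff_vec3 contDiff_const (contDiff_coord 1) (contDiff_coord 2)

/-- To the left of `x = -r` the backward orbit is a straight line. From a point with `x < -r` it
would arrive at its starting plane with `x < -r`, which is absurd. -/
lemma neg_le_chart {p : R3} (hp : -r ≤ p 0) : -r ≤ flowChart r Θ p 0 := by
  by_contra hlt
  push Not at hlt
  have h1 := h.flow_left (p := flowChart r Θ p) hlt.le (t := p 0 + r) (by linarith)
  rw [← h.chart_shift, h.chart_left (by simp)] at h1
  have := congr_arg (fun q : R3 => q 0) h1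
  simp at this
  linarith

/-- Flow both points back until the one with the smaller time is on the plane `x = -r`. The rest of
the other orbit is then straight and also ends on that plane, so the two times agree. -/
lemma chart_injective : Function.Injective (flowChart r Θ) := by
  have key : ∀ p q : R3, p 0 ≤ q 0 → flowChart r Θ p = flowChart r Θ q → p = q := by
    intro p q hpq heq
    have h1 : flowChart r Θ (p + (-(p 0 + r)) • stdVec 0)
        = flowChart r Θ (q + (-(p 0 + r)) • stdVec 0) := by
      rw [h.chart_shift, h.chart_shift, heq]
    rw [h.chart_left (p := p + (-(p 0 + r)) • stdVec 0) (by simp)] at h1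
    have h2 := h.chart_shift (q + (-(p 0 + r)) • stdVec 0) (-(q 0 - p 0))
    rw [← h1, h.flow_left (by simp) (by linarith), h.chart_left (by simp; linarith)] at h2
    have h3 := congr_arg (fun x : R3 => x 0) h2
    simp at h3
    have h4 : q 0 = p 0 := by linarith
    rw [h4] at h2
    simpa using h2.symm
  intro p q heq
  rcases le_total (p 0) (q 0) with hpq | hpq
  · exact key p q hpq heq
  · exact (key q p hpq heq.symm).symm

lemma chart_differentiable : Differentiable ℝ (flowChart r Θ) :=
  h.chart_contDiff.differentiable (by simp)

lemma hasDerivAt_chart_line (p : R3) (t : ℝ) :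
    HasDerivAt (fun t => flowChart r Θ (p + t • stdVec 0))
      (X (flowChart r Θ (p + t • stdVec 0))) t := by
  simp only [h.chart_shift]
  exact h.flow.hasDerivAt _ t

lemma fderiv_chart_zero (p : R3) :
    fderiv ℝ (flowChart r Θ) p (stdVec 0) = X (flowChart r Θ p) := by
  have h1 := h.hasDerivAt_chart_line p 0
  have h2 : HasDerivAt (fun t : ℝ => p + t • stdVec 0) (stdVec 0) 0 := by
    simpa using ((hasDerivAt_id (0 : ℝ)).smul_const (stdVec 0)).const_add p
  have h3 := (h.chart_differentiable (p + (0 : ℝ) • stdVec 0)).hasFDerivAt.comp_hasDerivAt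
    (0 : ℝ) h2
  simp only [zero_smul, add_zero] at h1 h3
  exact h3.unique h1

/-- Near `p` the chart is a translation into the region where it is the identity, followed by the
time-`s` flow map, which the time-`-s` map undoes. -/
lemma exists_leftInverse_fderiv_chart (p : R3) : ∃ G : R3 →L[ℝ] R3,
    G.comp (fderiv ℝ (flowChart r Θ) p) = ContinuousLinearMap.id ℝ R3 := by
  set s := p 0 + r + 1 with hs
  have hev : flowChart r Θ =ᶠ[𝓝 p] fun q => Θ s (q + (-s) • stdVec 0) := by
    have hlt : ∀ᶠ q in 𝓝 p, q 0 < p 0 + 1 :=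
      (continuous_coord 0).continuousAt.eventually_lt continuousAt_const (by simp)
    filter_upwards [hlt] with q hq
    have h1 := h.chart_shift (q + (-s) • stdVec 0) s
    rw [h.chart_left (p := q + (-s) • stdVec 0) (by simp; linarith)] at h1
    rw [← h1]
    congr 1; module
  have hd : ∀ t, Differentiable ℝ (Θ t) := fun t =>
    (h.flow.contDiff_apply h.contDiff h.lip.choose_spec t).differentiable (by simp)
  have hΨ : (fun q => Θ (-s) (flowChart r Θ q)) =ᶠ[𝓝 p] fun q => q + (-s) • stdVec 0 := by
    filter_upwards [hev] with q hq
    rw [hq, h.neg_apply]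
  refine ⟨fderiv ℝ (Θ (-s)) (flowChart r Θ p), ?_⟩
  have h1 := (hd (-s) (flowChart r Θ p)).hasFDerivAt.comp p
    (h.chart_differentiable p).hasFDerivAt
  have h2 : HasFDerivAt (fun q : R3 => q + (-s) • stdVec 0) (ContinuousLinearMap.id ℝ R3) p :=
    (hasFDerivAt_id p).add_const _
  exact h1.unique (h2.congr_of_eventuallyEq hΨ)

/-- The Jacobian never vanishes and is `1` on the far left; the domain is connected. -/
lemma jac_chart_pos (p : R3) : 0 < jac (flowChart r Θ) p := by
  have hne : ∀ q, jac (flowChart r Θ) q ≠ 0 := fun q => by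
    obtain ⟨G, hG⟩ := h.exists_leftInverse_fderiv_chart q
    exact jac_ne_zero_of_leftInverse hG
  set q : R3 := vec3 (-r - 1) 0 0
  have hq : jac (flowChart r Θ) q = 1 := by
    have hev : flowChart r Θ =ᶠ[𝓝 q] id := by
      have hlt : ∀ᶠ x in 𝓝 q, x 0 < -r :=
        (continuous_coord 0).continuousAt.eventually_lt continuousAt_const (by simp [q])
      filter_upwards [hlt] with x hx using h.chart_left hx.le
    rw [jac, hev.fderiv_eq, fderiv_id]
    simp [det3]
  by_contra hneg
  push Not at hneg
  obtain ⟨x, -, hx⟩ := isPreconnected_univ.intermediate_value (mem_univ p) (mem_univ q)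
    (continuous_jac h.chart_contDiff).continuousOn (show (0 : ℝ) ∈ Icc _ _ from
      ⟨hneg, by rw [hq]; exact zero_le_one⟩)
  exact hne x hx

lemma injective_fderiv_chart (p : R3) :
    Function.Injective (fderiv ℝ (flowChart r Θ) p) := by
  obtain ⟨G, hG⟩ := h.exists_leftInverse_fderiv_chart p
  exact Function.LeftInverse.injective (g := G) fun v => congr($hG v)

end IsStdFlow

end FlowChart

/-! ### Exiting and trapped orbits -/

section Transit

/-- The orbit entering at `(y, z) = w` leaves the ball of radius `r` on the right. -/
def Exits (r : ℝ) (Φ : R3 → R3) (w : ℝ × ℝ) : Prop :=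
  ∃ t, r < Φ (vec3 t w.1 w.2) 0

lemma vec3_add_smul (a b c t : ℝ) : vec3 a b c + t • stdVec 0 = vec3 (a + t) b c := by
  apply ext3 <;> simp

lemma vec3_eta (p : R3) : vec3 (p 0) (p 1) (p 2) = p := by
  apply ext3 <;> simp

lemma continuous_vec3_prod : Continuous fun q : ℝ × ℝ × ℝ => vec3 q.1 q.2.1 q.2.2 :=
  continuous_vec3 (by fun_prop) (by fun_prop) (by fun_prop)

namespace IsStdFlow

variable {r : ℝ} {X : R3 → R3} {Θ : ℝ → R3 → R3} (h : IsStdFlow r X Θ)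
include h

lemma chart_continuous : Continuous (flowChart r Θ) := h.chart_contDiff.continuous

lemma exits_of_out {w : ℝ × ℝ} (hw : r ^ 2 ≤ w.1 ^ 2 + w.2 ^ 2) : Exits r (flowChart r Θ) w :=
  ⟨r + 1, by rw [h.chart_out (by simpa using hw)]; simp⟩

lemma isOpen_exits : IsOpen {w | Exits r (flowChart r Θ) w} := by
  simp only [Exits, ofPred_exists]
  refine isOpen_iUnion fun t => isOpen_lt continuous_const ?_
  exact (continuous_coord 0).comp (h.chart_continuous.comp
    (continuous_vec3 continuous_const continuous_fst continuous_snd))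

lemma chart_right_le {y z s t : ℝ} (hs : r ≤ flowChart r Θ (vec3 s y z) 0) (hst : s ≤ t) :
    flowChart r Θ (vec3 t y z) = flowChart r Θ (vec3 s y z) + (t - s) • stdVec 0 := by
  rw [← h.chart_right hs (by linarith), vec3_add_smul]
  congr 2; ring

/-- A trapped orbit stays in the slab `|x| ≤ r`, and it cannot leave the cylinder of radius `r`,
since outside it would run straight to the right. -/
lemma chart_mem_closedBall_of_not_exits {y z : ℝ} (hb : ¬ Exits r (flowChart r Θ) (y, z)) {t : ℝ}
    (ht : -r ≤ t) : flowChart r Θ (vec3 t y z) ∈ closedBall (0 : R3) (2 * r) := by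
  have h1 := h.neg_le_chart (p := vec3 t y z) (by simpa using ht)
  have h2 : flowChart r Θ (vec3 t y z) 0 ≤ r := not_lt.1 fun hlt => hb ⟨t, hlt⟩
  have h3 : flowChart r Θ (vec3 t y z) 1 ^ 2 + flowChart r Θ (vec3 t y z) 2 ^ 2 ≤ r ^ 2 := by
    by_contra hlt
    push Not at hlt
    apply hb
    have h4 := h.chart_shift (vec3 t y z) (2 * r + 1)
    rw [h.flow_out hlt.le, vec3_add_smul] at h4
    refine ⟨t + (2 * r + 1), ?_⟩
    dsimp only
    rw [h4]
    simp
    linarith [h.pos]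
  rw [mem_closedBall_zero_iff]
  have h4 := sq_norm_eq (flowChart r Θ (vec3 t y z))
  exact le_of_sq_le_sq (by nlinarith [h.pos]) (by linarith [h.pos])

/-- Once past `x = r` an orbit never returns, so a time that works for one orbit works for its
neighbours and remains valid later; compactness does the rest. -/
lemma exists_transit_time {W : Set (ℝ × ℝ)} (hW : IsCompact W)
    (hex : ∀ w ∈ W, Exits r (flowChart r Θ) w) :
    ∃ T, ∀ w ∈ W, ∀ t, T ≤ t → r < flowChart r Θ (vec3 t w.1 w.2) 0 := by
  refine hW.induction_on (p := fun W => ∃ T, ∀ w ∈ W, ∀ t, T ≤ t →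
    r < flowChart r Θ (vec3 t w.1 w.2) 0) ⟨0, by simp⟩ ?_ ?_ ?_
  · rintro s t hst ⟨T, hT⟩
    exact ⟨T, fun w hw => hT w (hst hw)⟩
  · rintro s t ⟨T, hT⟩ ⟨S, hS⟩
    refine ⟨max T S, ?_⟩
    rintro w (hw | hw) u hu
    · exact hT w hw u ((le_max_left _ _).trans hu)
    · exact hS w hw u ((le_max_right _ _).trans hu)
  · intro w hw
    obtain ⟨T, hT⟩ := hex w hw
    have hopen : IsOpen {w : ℝ × ℝ | r < flowChart r Θ (vec3 T w.1 w.2) 0} :=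
      isOpen_lt continuous_const ((continuous_coord 0).comp (h.chart_continuous.comp
        (continuous_vec3 continuous_const continuous_fst continuous_snd)))
    refine ⟨_, mem_nhdsWithin_of_mem_nhds (hopen.mem_nhds hT), T, fun v hv t ht => ?_⟩
    have hv' : r < flowChart r Θ (vec3 T v.1 v.2) 0 := hv
    rw [h.chart_right_le hv'.le ht]
    simp; linarith

/-- Flow boxes over closed sets of exiting orbits are closed. -/
lemma isClosed_chart_image {W : Set (ℝ × ℝ)} (hW : IsClosed W)
    (hex : ∀ w ∈ W, Exits r (flowChart r Θ) w) :
    IsClosed (flowChart r Θ '' {p | (p 1, p 2) ∈ W}) := by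
  set Φ := flowChart r Θ
  refine isClosed_of_closure_subset fun q hq => ?_
  set M := ‖q‖ + 1 + r with hM
  have hM0 : 0 ≤ M := by have := norm_nonneg q; linarith [h.pos]
  obtain ⟨T, hT⟩ := h.exists_transit_time
    ((isCompact_Icc (a := ((-M, -M) : ℝ × ℝ)) (b := (M, M))).inter_left hW)
    (fun w hw => hex w hw.1)
  -- Only this compact box can meet the unit ball around `q`: before time `-M` the chart is the
  -- identity, and after the transit time `x` grows at unit speed.
  set K : Set R3 := (fun q : ℝ × ℝ × ℝ => vec3 q.1 q.2.1 q.2.2) ''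
    (Icc (-M) (max T 0 + M) ×ˢ (W ∩ Icc (-M, -M) (M, M))) with hK
  have hKc : IsCompact K := (isCompact_Icc.prod (isCompact_Icc.inter_left hW)).image
    continuous_vec3_prod
  have hsub : Φ '' {p | (p 1, p 2) ∈ W} ∩ ball q 1 ⊆ Φ '' K := by
    rintro _ ⟨⟨p, hp, rfl⟩, hpq⟩
    have hn : ‖Φ p‖ ≤ ‖q‖ + 1 := by
      have := norm_le_norm_add_norm_sub' (Φ p) q
      rw [mem_ball, dist_eq_norm] at hpq
      linarith
    have hpw : |p 1| ≤ M ∧ |p 2| ≤ M := by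
      rcases le_total (r ^ 2) (p 1 ^ 2 + p 2 ^ 2) with hr | hr
      · have h1 : Φ p = p := h.chart_out hr
        rw [h1] at hn
        constructor
        · linarith [abs_coord_le_norm p 1, h.pos]
        · linarith [abs_coord_le_norm p 2, h.pos]
      · have : r ≤ M := by have := norm_nonneg q; linarith
        constructor
        · exact (abs_le_of_sq_le_sq (by nlinarith [sq_nonneg (p 2)]) h.pos.le).trans this
        · exact (abs_le_of_sq_le_sq (by nlinarith [sq_nonneg (p 1)]) h.pos.le).trans this
    have hWp : (p 1, p 2) ∈ W ∩ Icc (-M, -M) (M, M) :=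
      ⟨hp, ⟨(abs_le.1 hpw.1).1, (abs_le.1 hpw.2).1⟩, ⟨(abs_le.1 hpw.1).2, (abs_le.1 hpw.2).2⟩⟩
    have hx := abs_le.1 (abs_coord_le_norm (Φ p) 0)
    refine ⟨p, ⟨(p 0, p 1, p 2), ⟨⟨?_, ?_⟩, hWp⟩, vec3_eta p⟩, rfl⟩
    · by_contra hlt
      push Not at hlt
      have h1 : Φ p = p := h.chart_left (by dsimp only at hlt; have := norm_nonneg q; linarith)
      rw [h1] at hx hn
      dsimp only at hlt; linarith [h.pos]
    · by_contra hlt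
      push Not at hlt
      dsimp only at hlt
      have h1 := hT _ hWp (max T 0) (le_max_left _ _)
      have h2 := h.chart_right_le h1.le (t := p 0) (by linarith)
      rw [vec3_eta] at h2
      have h3 := congr_arg (fun q : R3 => q 0) h2
      simp only [PiLp.add_apply, PiLp.smul_apply, stdVec_apply, if_true, smul_eq_mul,
        mul_one] at h3
      dsimp only at h1
      linarith [h.pos]
  have hq2 : q ∈ closure (Φ '' K) := by
    refine closure_mono hsub ?_
    rw [mem_closure_iff_nhdsWithin_neBot] at hq ⊢
    rwa [nhdsWithin_inter_of_mem' (mem_nhdsWithin_of_mem_nhds (ball_mem_nhds q one_pos))]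
  rw [(hKc.image h.chart_continuous).isClosed.closure_eq] at hq2
  obtain ⟨p, ⟨⟨a, w⟩, ⟨-, hw, -⟩, rfl⟩, rfl⟩ := hq2
  exact ⟨_, by simpa using hw, rfl⟩

end IsStdFlow

end Transit

/-! ### The pulled-back form and flatness above a height -/

section Holonomy

/-- A nonvanishing 1-form with `α ∧ dα` of sign `σ`, equal to `dz` outside the ball of radius `r`
and vanishing on the vector field `X`. -/
structure IsStdForm (r σ : ℝ) (X : R3 → R3) (α : R3 → R3 →L[ℝ] ℝ) : Prop where
  contDiff : ContDiff ℝ ∞ α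
  std : ∀ p, r ≤ ‖p‖ → α p = dz
  ker : ∀ p, α p (X p) = 0
  ne : ∀ p, α p ≠ 0
  sign : σ = 1 ∨ σ = -1
  wedge : ∀ p, 0 ≤ σ * wedgeCoeff (α p) (fderiv ℝ α p)

/-- The coefficients of the pull-back of `α` by `Φ`. -/
noncomputable def pullCoeff (α : R3 → R3 →L[ℝ] ℝ) (Φ : R3 → R3) (v p : R3) : ℝ :=
  α (Φ p) (fderiv ℝ Φ p v)

lemma eq_zero_of_eq_zero_right {f : ℝ → ℝ} (hf : Continuous f) (h0 : ∀ t, 0 < t → f t = 0) :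
    f 0 = 0 := by
  have : closure (Ioi (0 : ℝ)) ⊆ {t | f t = 0} :=
    (isClosed_eq hf continuous_const).closure_subset_iff.2 h0
  rw [closure_Ioi] at this
  exact this self_mem_Ici

section

variable {r σ : ℝ} {X : R3 → R3} {Θ : ℝ → R3 → R3} {α : R3 → R3 →L[ℝ] ℝ}

lemma continuous_pullCoeff {Φ : R3 → R3} (hα : ContDiff ℝ ∞ α) (hΦ : ContDiff ℝ ∞ Φ) (v : R3) :
    Continuous (pullCoeff α Φ v) :=
  (hα.continuous.comp hΦ.continuous).clm_apply (continuous_fderiv_apply hΦ v)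

lemma pullCoeff_of_eventuallyEq {Φ : R3 → R3} {p v : R3} (hΦ : Φ =ᶠ[𝓝 p] id)
    (hα : α p = dz) : pullCoeff α Φ v p = v 2 := by
  rw [pullCoeff, hΦ.fderiv_eq, hΦ.eq_of_nhds, fderiv_id]
  simp [hα]

end

open IsStdFlow

variable {r σ : ℝ} {X : R3 → R3} {Θ : ℝ → R3 → R3} {α : R3 → R3 →L[ℝ] ℝ}
  (h : IsStdFlow r X Θ) (hα : IsStdForm r σ X α)
include h hα

lemma pullCoeff_out {p : R3} (v : R3) (hp : r ^ 2 < p 1 ^ 2 + p 2 ^ 2) :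
    pullCoeff α (flowChart r Θ) v p = v 2 := by
  refine pullCoeff_of_eventuallyEq ?_ (hα.std p (le_norm_of_sq_le hp.le))
  have hlt : ∀ᶠ q : R3 in 𝓝 p, r ^ 2 < q 1 ^ 2 + q 2 ^ 2 :=
    continuousAt_const.eventually_lt (Continuous.continuousAt (by fun_prop)) hp
  filter_upwards [hlt] with q hq using h.chart_out hq.le

lemma pullCoeff_left {p : R3} (v : R3) (hp : p 0 < -r) :
    pullCoeff α (flowChart r Θ) v p = v 2 := by
  refine pullCoeff_of_eventuallyEq ?_ (hα.std p (le_norm_of_le_abs 0 ?_))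
  · have hlt : ∀ᶠ q : R3 in 𝓝 p, q 0 < -r :=
      (continuous_coord 0).continuousAt.eventually_lt continuousAt_const hp
    filter_upwards [hlt] with q hq using h.chart_left hq.le
  · rw [abs_of_neg (by linarith [h.pos])]; linarith

omit h in
lemma form_chart_right {p : R3} (hp : r ≤ flowChart r Θ p 0) : α (flowChart r Θ p) = dz :=
  hα.std _ (le_norm_of_le_abs 0 (hp.trans (le_abs_self _)))

omit hα in
lemma fderiv_chart_shift {p : R3} (hp : r < flowChart r Θ p 0) {t : ℝ} (ht : 0 ≤ t) :
    fderiv ℝ (flowChart r Θ) (p + t • stdVec 0) = fderiv ℝ (flowChart r Θ) p := by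
  have hlt : ∀ᶠ q in 𝓝 p, r < flowChart r Θ q 0 :=
    continuousAt_const.eventually_lt
      ((continuous_coord 0).comp h.chart_continuous).continuousAt hp
  have h1 : (fun q => flowChart r Θ (q + t • stdVec 0)) =ᶠ[𝓝 p]
      fun q => flowChart r Θ q + t • stdVec 0 := by
    filter_upwards [hlt] with q hq using h.chart_right hq.le ht
  have h2 := h1.fderiv_eq (𝕜 := ℝ)
  rw [fderiv_comp_add_right, fderiv_add_const] at h2
  exact h2

lemma pullCoeff_shift {p : R3} (v : R3) (hp : r < flowChart r Θ p 0) {t : ℝ} (ht : 0 ≤ t) :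
    pullCoeff α (flowChart r Θ) v (p + t • stdVec 0) = pullCoeff α (flowChart r Θ) v p := by
  rw [pullCoeff, pullCoeff, fderiv_chart_shift h hp ht, form_chart_right hα hp.le,
    form_chart_right hα]
  rw [h.chart_right hp.le ht]; simp; linarith

/-- Cartan's formula: `α(X) = 0` gives `L_X α = i_X dα`. The terms with second derivatives of the
chart cancel, by their symmetry (`hsymm`, `hmix`) and the derivative of `α(X) = 0` (`hker`). -/
lemma hasDerivAt_pullCoeff (p v : R3) :
    HasDerivAt (fun t : ℝ => pullCoeff α (flowChart r Θ) v (p + t • stdVec 0))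
      (fderiv ℝ α (flowChart r Θ p) (X (flowChart r Θ p)) (fderiv ℝ (flowChart r Θ) p v)
        - fderiv ℝ α (flowChart r Θ p) (fderiv ℝ (flowChart r Θ) p v) (X (flowChart r Θ p)))
      0 := by
  set Φ := flowChart r Θ with hΦ
  have hΦs : ContDiff ℝ ∞ Φ := h.chart_contDiff
  have hΦ0 : HasFDerivAt Φ (fderiv ℝ Φ p) p := (h.chart_differentiable p).hasFDerivAt
  have hαd : HasFDerivAt α (fderiv ℝ α (Φ p)) (Φ p) :=
    (hα.contDiff.differentiable (by simp) _).hasFDerivAt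
  have hXd : HasFDerivAt X (fderiv ℝ X (Φ p)) (Φ p) :=
    (h.contDiff.differentiable (by simp) _).hasFDerivAt
  have hD : HasFDerivAt (fderiv ℝ Φ) (fderiv ℝ (fderiv ℝ Φ) p) p :=
    ((hΦs.fderiv_right (m := ∞) (by simp)).differentiable (by simp) p).hasFDerivAt
  have hsymm : fderiv ℝ (fderiv ℝ Φ) p (stdVec 0) v = fderiv ℝ (fderiv ℝ Φ) p v (stdVec 0) :=
    second_derivative_symmetric (fun q => (h.chart_differentiable q).hasFDerivAt) hD _ _
  have hmix : fderiv ℝ (fderiv ℝ Φ) p v (stdVec 0) = fderiv ℝ X (Φ p) (fderiv ℝ Φ p v) := by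
    have h1 : HasFDerivAt (fun q => fderiv ℝ Φ q (stdVec 0)) _ p :=
      hD.clm_apply (hasFDerivAt_const (stdVec 0) p)
    have h2 : HasFDerivAt (fun q => fderiv ℝ Φ q (stdVec 0))
        ((fderiv ℝ X (Φ p)).comp (fderiv ℝ Φ p)) p := by
      simp only [hΦ, h.fderiv_chart_zero]
      exact hXd.comp p hΦ0
    have h3 := congr($(h1.unique h2) v)
    simpa using h3
  have hker : fderiv ℝ α (Φ p) (fderiv ℝ Φ p v) (X (Φ p))
      + α (Φ p) (fderiv ℝ X (Φ p) (fderiv ℝ Φ p v)) = 0 := by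
    have h1 : HasFDerivAt (fun q => α q (X q)) _ (Φ p) := hαd.clm_apply hXd
    have h2 : HasFDerivAt (fun q => α q (X q)) (0 : R3 →L[ℝ] ℝ) (Φ p) := by
      simp only [hα.ker]
      exact hasFDerivAt_const _ _
    have h3 := congr($(h1.unique h2) (fderiv ℝ Φ p v))
    simp at h3
    linarith
  have hcoef : HasFDerivAt (pullCoeff α Φ v) _ p :=
    (hαd.comp p hΦ0).clm_apply (hD.clm_apply (hasFDerivAt_const v p))
  have hline : HasDerivAt (fun t : ℝ => p + t • stdVec 0) (stdVec 0) 0 := by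
    simpa using ((hasDerivAt_id (0 : ℝ)).smul_const (stdVec 0)).const_add p
  have hp0 : p = p + (0 : ℝ) • stdVec 0 := by simp
  rw [hp0] at hcoef
  have := hcoef.comp_hasDerivAt (0 : ℝ) hline
  refine this.congr_deriv ?_
  rw [← hp0]
  have hX0 : fderiv ℝ Φ p (stdVec 0) = X (Φ p) := h.fderiv_chart_zero p
  simp [hX0, hsymm, hmix]
  linarith

/-- The pulled back coefficients rotate monotonically along the orbits. -/
lemma pullCoeff_wronskian (p : R3) : ∃ a c : ℝ,
    HasDerivAt (fun t : ℝ => pullCoeff α (flowChart r Θ) (stdVec 1) (p + t • stdVec 0)) a 0 ∧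
    HasDerivAt (fun t : ℝ => pullCoeff α (flowChart r Θ) (stdVec 2) (p + t • stdVec 0)) c 0 ∧
    pullCoeff α (flowChart r Θ) (stdVec 2) p * a - pullCoeff α (flowChart r Θ) (stdVec 1) p * c
      = jac (flowChart r Θ) p
        * wedgeCoeff (α (flowChart r Θ p)) (fderiv ℝ α (flowChart r Θ p)) := by
  refine ⟨_, _, hasDerivAt_pullCoeff h hα p (stdVec 1), hasDerivAt_pullCoeff h hα p (stdVec 2), ?_⟩
  have := wedgeCoeff_det (α (flowChart r Θ p)) (fderiv ℝ α (flowChart r Θ p))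
    (X (flowChart r Θ p)) (fderiv ℝ (flowChart r Θ) p (stdVec 1))
    (fderiv ℝ (flowChart r Θ) p (stdVec 2))
  rw [hα.ker] at this
  rw [jac, h.fderiv_chart_zero, ← this]
  simp only [pullCoeff]
  ring

/-- The coefficient on `∂/∂x` is `α(X) = 0`. If the other two vanished as well, `α` would vanish,
since the differential of the chart is onto. -/
lemma pullCoeff_vertical_ne_zero {p : R3} (hp : pullCoeff α (flowChart r Θ) (stdVec 1) p = 0) :
    pullCoeff α (flowChart r Θ) (stdVec 2) p ≠ 0 := by
  intro h2
  apply hα.ne (flowChart r Θ p)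
  ext w
  obtain ⟨v, rfl⟩ := (LinearMap.injective_iff_surjective
    (f := (fderiv ℝ (flowChart r Θ) p).toLinearMap)).1 (h.injective_fderiv_chart p) w
  have h0 : α (flowChart r Θ p) (fderiv ℝ (flowChart r Θ) p (stdVec 0)) = 0 := by
    rw [h.fderiv_chart_zero, hα.ker]
  rw [eq_sum_stdVec v]
  simp only [pullCoeff] at hp h2
  simp [h0, hp, h2]

/-- Along the orbit the coefficient has no zero and it is `1` on the far left. -/
lemma pullCoeff_vertical_pos {p : R3}
    (hp : ∀ t : ℝ, pullCoeff α (flowChart r Θ) (stdVec 1) (p + t • stdVec 0) = 0) :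
    0 < pullCoeff α (flowChart r Θ) (stdVec 2) p := by
  set f : ℝ → ℝ := fun t => pullCoeff α (flowChart r Θ) (stdVec 2) (p + t • stdVec 0) with hf
  have hfc : Continuous f :=
    (continuous_pullCoeff hα.contDiff h.chart_contDiff _).comp (by fun_prop)
  have hne : ∀ t, f t ≠ 0 := fun t => pullCoeff_vertical_ne_zero h hα (hp t)
  have h1 : f (-(p 0) - r - 1) = 1 := by
    simp only [hf]
    rw [pullCoeff_left h hα _ (by simp; linarith)]
    simp
  by_contra hneg
  push Not at hneg
  have h0 : f 0 ≤ 0 := by simpa [hf] using hneg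
  obtain ⟨x, -, hx⟩ := isPreconnected_univ.intermediate_value (mem_univ 0)
    (mem_univ (-(p 0) - r - 1)) hfc.continuousOn (show (0 : ℝ) ∈ Icc _ _ from
      ⟨h0, by rw [h1]; exact zero_le_one⟩)
  exact hne x hx

/-- Slightly below `c` the coefficient `C` is still positive, so `σ A / C` is monotone along orbits
and starts at `0`. At the exit `A` is the `y`-derivative of the height, so `σ` times the height is
monotone in `y`. Its end values agree, so `A` is zero at the exit, and then along the whole orbit.
-/
lemma flat_step {z₀ c : ℝ} (hex : ∀ y z, z₀ < z → Exits r (flowChart r Θ) (y, z)) (hc : z₀ < c)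
    (hA : ∀ p : R3, c < p 2 → pullCoeff α (flowChart r Θ) (stdVec 1) p = 0) :
    ∃ ε > 0, ∀ p : R3, c - ε < p 2 → pullCoeff α (flowChart r Θ) (stdVec 1) p = 0 := by
  set Φ := flowChart r Θ with hΦ
  set A := pullCoeff α Φ (stdVec 1) with hAdef
  set C := pullCoeff α Φ (stdVec 2) with hCdef
  have hAc : Continuous A := continuous_pullCoeff hα.contDiff h.chart_contDiff _
  have hCc : Continuous C := continuous_pullCoeff hα.contDiff h.chart_contDiff _
  have hrpos := h.pos
  have hA' : ∀ p : R3, c ≤ p 2 → A p = 0 := by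
    intro p hp
    have := eq_zero_of_eq_zero_right (f := fun t => A (p + t • stdVec 2))
      (hAc.comp (by fun_prop)) (fun t ht => hA _ (by simp; linarith))
    simpa using this
  have hC' : ∀ p : R3, c ≤ p 2 → 0 < C p := fun p hp =>
    pullCoeff_vertical_pos h hα fun t => hA' _ (by simpa using hp)
  set b := r + 1 with hb
  obtain ⟨T₀, hT₀⟩ := h.exists_transit_time
    (isCompact_Icc (a := ((-b, c - (c - z₀) / 2) : ℝ × ℝ)) (b := (b, c)))
    (fun w hw => hex w.1 w.2 (by have := hw.1.2; dsimp only at this; linarith))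
  set T := max T₀ b with hT
  have hTex : ∀ y z, |y| ≤ b → c - (c - z₀) / 2 ≤ z → z ≤ c → r < Φ (vec3 T y z) 0 :=
    fun y z hy hz hzc => hT₀ (y, z) ⟨⟨(abs_le.1 hy).1, hz⟩, ⟨(abs_le.1 hy).2, hzc⟩⟩ T
      (le_max_left _ _)
  -- On this compact piece of height `c` one has `C > 0`; a thickening gives a uniform range of
  -- heights below `c` with the same property.
  set K : Set R3 := (fun q : ℝ × ℝ × ℝ => vec3 q.1 q.2.1 q.2.2) ''
    (Icc (-b) T ×ˢ Icc (-b) b ×ˢ {c}) with hK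
  have hKc : IsCompact K :=
    (isCompact_Icc.prod (isCompact_Icc.prod isCompact_singleton)).image continuous_vec3_prod
  have hKpos : K ⊆ {p | 0 < C p} := by
    rintro _ ⟨⟨x, y, z⟩, ⟨-, -, hz⟩, rfl⟩
    refine hC' _ ?_
    have hz' : z = c := hz
    simp [hz']
  obtain ⟨δ, hδ, hthick⟩ := hKc.exists_thickening_subset_open
    (isOpen_lt continuous_const hCc) hKpos
  have hCpos : ∀ x y z, x ∈ Icc (-b) T → y ∈ Icc (-b) b → |z - c| < δ → 0 < C (vec3 x y z) := by
    intro x y z hx hy hz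
    refine hthick (mem_thickening_iff.2 ⟨vec3 x y c, ⟨(x, y, c), ⟨hx, hy, rfl⟩, rfl⟩, ?_⟩)
    rw [dist_eq_norm]
    refine lt_of_le_of_lt (le_of_sq_le_sq ?_ (abs_nonneg _)) hz
    rw [sq_norm_eq]
    simp
  refine ⟨min δ ((c - z₀) / 2), lt_min hδ (by linarith), fun p hp => ?_⟩
  have hp1 : c - δ < p 2 := by linarith [min_le_left δ ((c - z₀) / 2)]
  have hp2 : c - (c - z₀) / 2 < p 2 := by linarith [min_le_right δ ((c - z₀) / 2)]
  rcases lt_or_ge c (p 2) with hpc | hpc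
  · exact hA p hpc
  set z := p 2 with hz
  have hzd : |z - c| < δ := by rw [abs_lt]; constructor <;> linarith
  have hbT : -b ≤ T := by have := le_max_right T₀ b; linarith
  have hline : ∀ y t, HasDerivAt (fun s => vec3 s y z) (stdVec 0) t := by
    intro y t
    have h1 : (fun s => vec3 s y z) = fun s : ℝ => vec3 0 y z + s • stdVec 0 := by
      ext1 s; rw [vec3_add_smul, zero_add]
    rw [h1]
    simpa using ((hasDerivAt_id t).smul_const (stdVec 0)).const_add (vec3 0 y z)
  -- the slope `A / C` is monotone along each orbit
  have hslope : ∀ y ∈ Icc (-b) b,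
      MonotoneOn (fun t => σ * (A (vec3 t y z) / C (vec3 t y z))) (Icc (-b) T) := by
    intro y hy
    have hdiff : ∀ t ∈ Icc (-b) T, ∃ d, 0 ≤ d ∧
        HasDerivAt (fun t => σ * (A (vec3 t y z) / C (vec3 t y z))) d t := by
      intro t ht
      obtain ⟨a', c', ha, hc', hw⟩ := pullCoeff_wronskian h hα (vec3 t y z)
      have htr : ∀ f : R3 → ℝ, ∀ d, HasDerivAt (fun s : ℝ => f (vec3 t y z + s • stdVec 0)) d 0 →
          HasDerivAt (fun s => f (vec3 s y z)) d t := by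
        intro f d hd
        have h1 := HasDerivAt.comp_sub_const t t (by simpa using hd)
        refine h1.congr_of_eventuallyEq (Filter.Eventually.of_forall fun s => ?_)
        simp only [vec3_add_smul]
        congr 2; ring
      have hCt := hCpos t y z ht hy hzd
      refine ⟨_, ?_, ((htr _ _ ha).div (htr _ _ hc') hCt.ne').const_mul σ⟩
      have hnum : a' * C (vec3 t y z) - A (vec3 t y z) * c'
          = jac Φ (vec3 t y z) * wedgeCoeff (α (Φ (vec3 t y z))) (fderiv ℝ α (Φ (vec3 t y z))) := by
        rw [← hw]; ring
      rw [show pullCoeff α (flowChart r Θ) (stdVec 2) = C from rfl,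
        show pullCoeff α (flowChart r Θ) (stdVec 1) = A from rfl, hnum, mul_div_assoc',
        mul_left_comm]
      exact div_nonneg (mul_nonneg (h.jac_chart_pos _).le (hα.wedge _)) (sq_nonneg _)
    choose! d hd0 hd using hdiff
    refine monotoneOn_of_deriv_nonneg (convex_Icc _ _)
      (fun t ht => (hd t ht).continuousAt.continuousWithinAt)
      (fun t ht => (hd t (interior_subset ht)).differentiableAt.differentiableWithinAt)
      (fun t ht => ?_)
    rw [(hd t (interior_subset ht)).deriv]
    exact hd0 t (interior_subset ht)
  have hstart : ∀ y, A (vec3 (-b) y z) = 0 := fun y => by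
    have := pullCoeff_left h hα (p := vec3 (-b) y z) (stdVec 1) (by simp [hb])
    simpa using this
  have hAnonneg : ∀ y ∈ Icc (-b) b, ∀ t ∈ Icc (-b) T, 0 ≤ σ * A (vec3 t y z) := by
    intro y hy t ht
    have := hslope y hy ⟨le_rfl, hbT⟩ ht ht.1
    simp only [hstart, zero_div, mul_zero, ← mul_div_assoc] at this
    exact (div_nonneg_iff.1 this).elim (fun h => h.1)
      (fun h => absurd (hCpos t y z ht hy hzd) (not_lt.2 h.2))
  -- the leaf height at the right end
  have hheight : ∀ y ∈ Icc (-b) b,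
      HasDerivAt (fun y => Φ (vec3 T y z) 2) (A (vec3 T y z)) y := by
    intro y hy
    have h1 : HasDerivAt (fun y => vec3 T y z) (stdVec 1) y := by
      have h1 : (fun s => vec3 T s z) = fun s : ℝ => vec3 T 0 z + s • stdVec 1 := by
        ext1 s; apply ext3 <;> simp
      rw [h1]
      simpa using ((hasDerivAt_id y).smul_const (stdVec 1)).const_add (vec3 T 0 z)
    have h2 := ((h.chart_differentiable (vec3 T y z)).hasFDerivAt.comp_hasDerivAt y h1).coord 2
    refine h2.congr_deriv ?_
    simp only [hAdef, pullCoeff]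
    rw [form_chart_right hα (hTex y z (abs_le.2 hy) hp2.le hpc).le]
    rfl
  have hmono : MonotoneOn (fun y => σ * Φ (vec3 T y z) 2) (Icc (-b) b) := by
    refine monotoneOn_of_deriv_nonneg (convex_Icc _ _)
      (fun y hy => ((hheight y hy).const_mul σ).continuousAt.continuousWithinAt)
      (fun y hy => ((hheight y (interior_subset hy)).const_mul
        σ).differentiableAt.differentiableWithinAt) (fun y hy => ?_)
    rw [((hheight y (interior_subset hy)).const_mul σ).deriv]
    exact hAnonneg y (interior_subset hy) T ⟨hbT, le_rfl⟩
  have hσ : σ ≠ 0 := by rcases hα.sign with h | h <;> rw [h] <;> norm_num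
  -- The orbits at `y = ±b` miss the ball, since `b = r + 1`.
  have hend : ∀ y, y ^ 2 = b ^ 2 → Φ (vec3 T y z) 2 = z := fun y hy => by
    rw [hΦ, h.chart_out (by simp [hy, hb]; nlinarith [sq_nonneg z])]; simp
  have hconst : ∀ y ∈ Icc (-b) b, Φ (vec3 T y z) 2 = z := by
    intro y hy
    have hbb : -b ≤ b := by linarith
    have h1 := hmono ⟨le_rfl, hbb⟩ hy hy.1
    have h2 := hmono hy ⟨hbb, le_rfl⟩ hy.2
    dsimp only at h1 h2
    rw [hend (-b) (by ring)] at h1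
    rw [hend b rfl] at h2
    exact mul_left_cancel₀ hσ (le_antisymm h2 h1)
  have hright : ∀ y ∈ Ioo (-b) b, A (vec3 T y z) = 0 := by
    intro y hy
    have h1 := hheight y (Ioo_subset_Icc_self hy)
    have h2 : (fun y => Φ (vec3 T y z) 2) =ᶠ[𝓝 y] fun _ => z := by
      filter_upwards [Icc_mem_nhds hy.1 hy.2] with y' hy' using hconst y' hy'
    exact h1.unique ((hasDerivAt_const y z).congr_of_eventuallyEq h2)
  have hzero : ∀ y ∈ Ioo (-b) b, ∀ t ∈ Icc (-b) T, A (vec3 t y z) = 0 := by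
    intro y hy t ht
    have hy' := Ioo_subset_Icc_self hy
    have h1 := hslope y hy' ⟨le_rfl, hbT⟩ ht ht.1
    have h2 := hslope y hy' ht ⟨hbT, le_rfl⟩ ht.2
    simp only [hstart, hright y hy, zero_div, mul_zero] at h1 h2
    have h3 : σ * (A (vec3 t y z) / C (vec3 t y z)) = 0 := le_antisymm h2 h1
    have hCt := (hCpos t y z ht hy' hzd).ne'
    rw [mul_eq_zero, div_eq_zero_iff] at h3
    tauto
  by_cases hy : p 1 ∈ Ioo (-b) b
  · rcases lt_or_ge (p 0) (-b) with h0 | h0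
    · have := pullCoeff_left h hα (p := p) (stdVec 1) (by linarith)
      simpa using this
    · rcases le_total (p 0) T with h1 | h1
      · rw [← vec3_eta p]; exact hzero _ hy _ ⟨h0, h1⟩
      · have h2 := pullCoeff_shift h hα (stdVec 1)
          (hTex (p 1) z (abs_le.2 (Ioo_subset_Icc_self hy)) hp2.le hpc) (sub_nonneg.2 h1)
        rw [vec3_add_smul, add_sub_cancel, hz, vec3_eta] at h2
        rw [hAdef, hΦ, h2]
        exact hright _ hy
  · have hb2 : b ^ 2 ≤ p 1 ^ 2 := by
      rw [mem_Ioo, not_and_or, not_lt, not_lt] at hy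
      rcases hy with hy | hy <;> nlinarith
    have := pullCoeff_out h hα (p := p) (stdVec 1) (by nlinarith [sq_nonneg (p 2)])
    simpa using this

/-- Wherever all orbits above a height exit, the confoliation is a foliation whose leaves are the
level sets of the last coordinate of the flow chart. -/
lemma flat_of_exits {z₀ : ℝ} (hex : ∀ y z, z₀ < z → Exits r (flowChart r Θ) (y, z)) (p : R3)
    (hp : z₀ < p 2) : pullCoeff α (flowChart r Θ) (stdVec 1) p = 0 := by
  by_contra hne
  -- Continuous induction downwards: if flatness failed at `p`, the infimum of `S` would lie above
  -- `z₀`, and `flat_step` would push it lower.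
  set S : Set ℝ := {c | ∀ q : R3, c < q 2 → pullCoeff α (flowChart r Θ) (stdVec 1) q = 0} with hS
  have hmem : r + 1 ∈ S := by
    intro q hq
    have := pullCoeff_out h hα (p := q) (stdVec 1)
      (by nlinarith [h.pos, sq_nonneg (q 1)])
    simpa using this
  have hlb : ∀ c ∈ S, p 2 ≤ c := fun c hc => by
    by_contra hlt
    push Not at hlt
    exact hne (hc p hlt)
  have hbdd : BddBelow S := ⟨p 2, hlb⟩
  have hle : p 2 ≤ sInf S := le_csInf ⟨_, hmem⟩ hlb
  obtain ⟨ε, hε, hstep⟩ := flat_step h hα hex (hp.trans_le hle) (fun q hq => by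
    obtain ⟨c, hc, hcq⟩ := exists_lt_of_csInf_lt ⟨_, hmem⟩ hq
    exact hc q hcq)
  have := csInf_le hbdd (show sInf S - ε ∈ S from hstep)
  linarith

end Holonomy

/-! ### Local sections of the chart and lifting of curves -/

section LocalInverse

/-- Cramer's rule: replacing one basis vector by `v` in the determinant gives the matching
coordinate of `v`. -/
lemma injective_of_det3_ne_zero {D : R3 →L[ℝ] R3}
    (hD : det3 (D (stdVec 0)) (D (stdVec 1)) (D (stdVec 2)) ≠ 0) : Function.Injective D := by
  rw [injective_iff_map_eq_zero]
  intro v hv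
  have h0 := det3_map D v (stdVec 1) (stdVec 2)
  have h1 := det3_map D (stdVec 0) v (stdVec 2)
  have h2 := det3_map D (stdVec 0) (stdVec 1) v
  rw [hv] at h0 h1 h2
  have e0 : det3 v (stdVec 1) (stdVec 2) = v 0 := by simp [det3]
  have e1 : det3 (stdVec 0) v (stdVec 2) = v 1 := by simp [det3]
  have e2 : det3 (stdVec 0) (stdVec 1) v = v 2 := by simp [det3]
  rw [e0] at h0
  rw [e1] at h1
  rw [e2] at h2
  apply ext3
  · exact (mul_eq_zero.1 (h0.symm.trans (by simp [det3]))).resolve_right hD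
  · exact (mul_eq_zero.1 (h1.symm.trans (by simp [det3]))).resolve_right hD
  · exact (mul_eq_zero.1 (h2.symm.trans (by simp [det3]))).resolve_right hD

/-- The continuous linear automorphism given by an injective endomorphism. -/
noncomputable def equivOfInjective (D : R3 →L[ℝ] R3) (hD : Function.Injective D) : R3 ≃L[ℝ] R3 :=
  (LinearEquiv.ofInjectiveEndo D.toLinearMap hD).toContinuousLinearEquiv

lemma coe_equivOfInjective (D : R3 →L[ℝ] R3) (hD : Function.Injective D) :
    (equivOfInjective D hD : R3 →L[ℝ] R3) = D := by
  ext1 v; rfl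

variable {Φ : R3 → R3}

lemma hasStrictFDerivAt_equiv (hΦ : ContDiff ℝ ∞ Φ) {p : R3}
    (hinj : Function.Injective (fderiv ℝ Φ p)) :
    HasStrictFDerivAt Φ (equivOfInjective _ hinj : R3 →L[ℝ] R3) p := by
  rw [coe_equivOfInjective]
  exact hΦ.contDiffAt.hasStrictFDerivAt (by simp)

lemma map_nhds_eq_of_injective (hΦ : ContDiff ℝ ∞ Φ) {p : R3}
    (hinj : Function.Injective (fderiv ℝ Φ p)) : Filter.map Φ (𝓝 p) = 𝓝 (Φ p) :=
  (hasStrictFDerivAt_equiv hΦ hinj).map_nhds_eq_of_equiv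

lemma isOpenMap_of_injective_fderiv (hΦ : ContDiff ℝ ∞ Φ)
    (hinj : ∀ p, Function.Injective (fderiv ℝ Φ p)) : IsOpenMap Φ :=
  IsOpenMap.of_nhds_le fun p => (map_nhds_eq_of_injective hΦ (hinj p)).ge

lemma exists_local_section (hΦ : ContDiff ℝ ∞ Φ) {p : R3}
    (hinj : Function.Injective (fderiv ℝ Φ p)) :
    ∃ g : R3 → R3, g (Φ p) = p ∧ ContDiffAt ℝ ∞ g (Φ p) ∧ (∀ᶠ x in 𝓝 p, g (Φ x) = x) ∧
      ∀ᶠ q in 𝓝 (Φ p), Φ (g q) = q ∧ DifferentiableAt ℝ g q ∧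
        (fderiv ℝ Φ (g q)).comp (fderiv ℝ g q) = ContinuousLinearMap.id ℝ R3 := by
  have hs := hasStrictFDerivAt_equiv hΦ hinj
  have hne : (∞ : WithTop ℕ∞) ≠ 0 := by simp
  have hsm : ContDiffAt ℝ ∞ (hs.localInverse Φ _ p) (Φ p) :=
    hΦ.contDiffAt.to_localInverse hs.hasFDerivAt hne
  refine ⟨hs.localInverse Φ _ p, hs.localInverse_apply_image, hsm,
    hs.eventually_left_inverse, ?_⟩
  have hdiff : ∀ᶠ q in 𝓝 (Φ p), ContDiffAt ℝ 1 (hs.localInverse Φ _ p) q :=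
    (hsm.of_le (by exact_mod_cast le_top)).eventually (by simp)
  filter_upwards [hs.eventually_right_inverse, hs.eventually_right_inverse.eventually_nhds,
    hdiff] with q hq hq' hd
  have hd' := hd.differentiableAt one_ne_zero
  refine ⟨hq, hd', ?_⟩
  have h1 := (hΦ.differentiable hne (hs.localInverse Φ _ p q)).hasFDerivAt.comp q hd'.hasFDerivAt
  exact h1.unique ((hasFDerivAt_id q).congr_of_eventuallyEq hq')

/-- Integral curves lift locally through local diffeomorphisms. -/
lemma exists_local_lift (hΦ : ContDiff ℝ ∞ Φ) {p : R3}
    (hinj : Function.Injective (fderiv ℝ Φ p)) {Q : R3 → R3} {c : ℝ → R3}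
    (hc : ∀ t, HasDerivAt c (Q (c t)) t) {x : ℝ} (hx : c x = Φ p) :
    ∃ d v : ℝ → R3, d x = p ∧ ∀ᶠ s in 𝓝 x,
      Φ (d s) = c s ∧ HasDerivAt d (v s) s ∧ fderiv ℝ Φ (d s) (v s) = Q (c s) := by
  obtain ⟨g, hg, -, -, hev⟩ := exists_local_section hΦ hinj
  refine ⟨g ∘ c, fun s => fderiv ℝ g (c s) (Q (c s)), by simp [hx, hg], ?_⟩
  have hcx : Filter.Tendsto c (𝓝 x) (𝓝 (Φ p)) := hx ▸ (hc x).continuousAt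
  filter_upwards [hcx.eventually hev] with s hs
  exact ⟨hs.1, hs.2.1.hasFDerivAt.comp_hasDerivAt s (hc s), congr($(hs.2.2) (Q (c s)))⟩

end LocalInverse

lemma eventually_le_of_hasDerivAt_nonneg {f : ℝ → ℝ} {x : ℝ}
    (hf : ∀ᶠ s in 𝓝 x, ∃ d, 0 ≤ d ∧ HasDerivAt f d s) : ∀ᶠ s in 𝓝[>] x, f x ≤ f s := by
  obtain ⟨ε, hε, hball⟩ := Metric.eventually_nhds_iff_ball.1 hf
  filter_upwards [Ioo_mem_nhdsGT (show x < x + ε by linarith)] with s hs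
  have hsub : ∀ u ∈ Icc x s, u ∈ ball x ε := fun u hu => by
    rw [mem_ball, Real.dist_eq, abs_of_nonneg (by linarith [hu.1])]
    linarith [hu.2, hs.2]
  have hmono : MonotoneOn f (Icc x s) := by
    refine monotoneOn_of_deriv_nonneg (convex_Icc _ _) (fun u hu => ?_) (fun u hu => ?_)
      (fun u hu => ?_)
    · obtain ⟨d, -, hd⟩ := hball u (hsub u hu)
      exact hd.continuousAt.continuousWithinAt
    · obtain ⟨d, -, hd⟩ := hball u (hsub u (interior_subset hu))
      exact hd.differentiableAt.differentiableWithinAt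
    · obtain ⟨d, hd0, hd⟩ := hball u (hsub u (interior_subset hu))
      rw [hd.deriv]; exact hd0
  exact hmono ⟨le_rfl, hs.1.le⟩ ⟨hs.1.le, le_rfl⟩ hs.1.le

/-! ### Transverse and tangential flows in chart coordinates -/

section Frame

/-- Vector fields completing `X` to a positive frame in which `α` is the dual of `N`, together with
their flows. -/
structure IsAdaptedFrame (X Y N : R3 → R3) (α : R3 → R3 →L[ℝ] ℝ) (ΘY ΘN : ℝ → R3 → R3) :
    Prop where
  contDiffY : ContDiff ℝ ∞ Y
  contDiffN : ContDiff ℝ ∞ N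
  lipY : ∃ K, LipschitzWith K Y
  lipN : ∃ K, LipschitzWith K N
  flowY : IsFlow Y ΘY
  flowN : IsFlow N ΘN
  kerY : ∀ p, α p (Y p) = 0
  evalN : ∀ p, α p (N p) = 1
  det_pos : ∀ p, 0 < det3 (X p) (Y p) (N p)

variable {r σ : ℝ} {X Y N : R3 → R3} {Θ ΘY ΘN : ℝ → R3 → R3} {α : R3 → R3 →L[ℝ] ℝ}

section

variable (h : IsStdFlow r X Θ)
include h

/-- An integral curve starting in a closed flow box stays there if it does so infinitesimally. -/
lemma curve_mem_chart_image {W : Set (ℝ × ℝ)} (hW : IsClosed W)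
    (hex : ∀ w ∈ W, Exits r (flowChart r Θ) w) {Q : R3 → R3} {c : ℝ → R3}
    (hc : ∀ t, HasDerivAt c (Q (c t)) t) (h0 : c 0 ∈ flowChart r Θ '' {p | (p 1, p 2) ∈ W})
    (hstep : ∀ (x : ℝ) (d v : ℝ → R3), (d x 1, d x 2) ∈ W →
      (∀ᶠ s in 𝓝 x, flowChart r Θ (d s) = c s ∧ HasDerivAt d (v s) s ∧
        fderiv ℝ (flowChart r Θ) (d s) (v s) = Q (c s)) →
      ∀ᶠ s in 𝓝[>] x, (d s 1, d s 2) ∈ W) {t : ℝ} (ht : 0 ≤ t) :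
    c t ∈ flowChart r Θ '' {p | (p 1, p 2) ∈ W} := by
  have hcc : Continuous c := continuous_iff_continuousAt.2 fun t => (hc t).continuousAt
  have hcl : IsClosed (c ⁻¹' (flowChart r Θ '' {p | (p 1, p 2) ∈ W})) :=
    (h.isClosed_chart_image hW hex).preimage hcc
  refine (hcl.inter isClosed_Icc).Icc_subset_of_forall_exists_gt (a := 0) (b := t) h0 ?_
    ⟨ht, le_rfl⟩
  rintro x ⟨⟨p, hp, hpx⟩, -⟩ y hy
  obtain ⟨d, v, hd, hev⟩ := exists_local_lift h.chart_contDiff (h.injective_fderiv_chart p) hc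
    hpx.symm
  have h1 := hstep x d v (by rw [hd]; exact hp) hev
  obtain ⟨s, ⟨hs1, hs2⟩, hs3⟩ := ((h1.and (nhdsWithin_le_nhds hev)).and
    (Ioc_mem_nhdsGT (show x < y from hy))).exists
  exact ⟨s, ⟨d s, hs1, hs2.1⟩, hs3⟩

end

variable (h : IsStdFlow r X Θ) (hα : IsStdForm r σ X α) (hF : IsAdaptedFrame X Y N α ΘY ΘN)
include h hα

lemma form_fderiv_chart (p v : R3) : α (flowChart r Θ p) (fderiv ℝ (flowChart r Θ) p v)
    = v 1 * pullCoeff α (flowChart r Θ) (stdVec 1) p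
      + v 2 * pullCoeff α (flowChart r Θ) (stdVec 2) p := by
  conv_lhs => rw [eq_sum_stdVec v]
  simp [h.fderiv_chart_zero, hα.ker, pullCoeff]

lemma pullCoeff_vertical_pos_of_exits {z₀ : ℝ}
    (hex : ∀ y z, z₀ < z → Exits r (flowChart r Θ) (y, z)) {p : R3} (hp : z₀ < p 2) :
    0 < pullCoeff α (flowChart r Θ) (stdVec 2) p :=
  pullCoeff_vertical_pos h hα fun t => flat_of_exits h hα hex _ (by simpa using hp)

include hF

/-- In the chart `α` is `C dz` with `C > 0`, so `α(N) = 1` makes the height increase. The chart is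
not yet known to be onto; closedness of flow boxes of exiting orbits keeps the curve inside its
image. -/
lemma flowN_mem {z₀ : ℝ} (hex : ∀ y z, z₀ < z → Exits r (flowChart r Θ) (y, z)) {p : R3}
    (hp : z₀ < p 2) {t : ℝ} (ht : 0 ≤ t) :
    ∃ q : R3, p 2 ≤ q 2 ∧ ΘN t (flowChart r Θ p) = flowChart r Θ q := by
  have hW : IsClosed {w : ℝ × ℝ | p 2 ≤ w.2} := isClosed_le continuous_const continuous_snd
  obtain ⟨q, hq, hqt⟩ := curve_mem_chart_image h hW
    (fun w hw => hex w.1 w.2 (hp.trans_le hw)) (Q := N)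
    (c := fun t => ΘN t (flowChart r Θ p)) (hF.flowN.hasDerivAt _)
    ⟨p, by simp, (hF.flowN.zero _).symm⟩ (fun x d v hdx hev => by
      have hdc : ContinuousAt d x := hev.self_of_nhds.2.1.continuousAt
      have hpos : ∀ᶠ s in 𝓝 x, z₀ < d s 2 :=
        continuousAt_const.eventually_lt ((continuous_coord 2).continuousAt.comp hdc)
          (hp.trans_le hdx)
      have := eventually_le_of_hasDerivAt_nonneg (f := fun s => d s 2) (x := x) (by
        filter_upwards [hev, hpos] with s hs hs2
        refine ⟨v s 2, ?_, hs.2.1.coord 2⟩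
        have h1 := form_fderiv_chart h hα (d s) (v s)
        rw [flat_of_exits h hα hex _ hs2, hs.2.2, hs.1, hF.evalN, mul_zero, zero_add] at h1
        by_contra hneg
        nlinarith [pullCoeff_vertical_pos_of_exits h hα hex hs2])
      filter_upwards [this] with s hs using hdx.trans hs) ht
  exact ⟨q, hq, hqt.symm⟩

/-- Since `α` is `C dz` in the chart, `α(Y) = 0` fixes the height, and positivity of the frame `X,
Y, N` makes `y` increase. The sign `ε` treats forward and backward flow together. -/
lemma flowY_mem {z₀ ε : ℝ} (hε : ε = 1 ∨ ε = -1)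
    (hex : ∀ y z, z₀ < z → Exits r (flowChart r Θ) (y, z)) {p : R3}
    (hp : z₀ < p 2) {t : ℝ} (ht : 0 ≤ t) :
    ∃ q : R3, q 2 = p 2 ∧ ε * p 1 ≤ ε * q 1 ∧
      ΘY (ε * t) (flowChart r Θ p) = flowChart r Θ q := by
  have hεε : ε * ε = 1 := by rcases hε with h | h <;> rw [h] <;> norm_num
  have hW : IsClosed {w : ℝ × ℝ | w.2 = p 2 ∧ ε * p 1 ≤ ε * w.1} :=
    (isClosed_eq continuous_snd continuous_const).inter
      (isClosed_le continuous_const (continuous_const.mul continuous_fst))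
  obtain ⟨q, hq, hqt⟩ := curve_mem_chart_image h hW
    (fun w hw => hex w.1 w.2 (by rw [hw.1]; exact hp)) (Q := fun q => ε • Y q)
    (c := fun t => ΘY (ε * t) (flowChart r Θ p)) (fun t => by
      have := (hF.flowY.hasDerivAt (flowChart r Θ p) (ε * t)).scomp t
        ((hasDerivAt_id t).const_mul ε)
      simpa [Function.comp_def] using this)
    ⟨p, by simp, by simp [hF.flowY.zero]⟩ (fun x d v hdx hev => by
      have hdc : ContinuousAt d x := hev.self_of_nhds.2.1.continuousAt
      have hpos : ∀ᶠ s in 𝓝 x, z₀ < d s 2 :=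
        continuousAt_const.eventually_lt ((continuous_coord 2).continuousAt.comp hdc)
          (by rw [show d x 2 = p 2 from hdx.1]; exact hp)
      have hder : ∀ᶠ s in 𝓝 x, HasDerivAt d (v s) s ∧ v s 2 = 0 ∧ 0 ≤ ε * v s 1 := by
        filter_upwards [hev, hpos] with s hs hs2
        have hC := pullCoeff_vertical_pos_of_exits h hα hex hs2
        have hA := flat_of_exits h hα hex _ hs2
        have h1 := form_fderiv_chart h hα (d s) (v s)
        rw [hA, hs.2.2, hs.1, map_smul, hF.kerY, smul_zero, mul_zero, zero_add] at h1
        have hv2 : v s 2 = 0 := (mul_eq_zero.1 h1.symm).resolve_right hC.ne'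
        refine ⟨hs.2.1, hv2, ?_⟩
        obtain ⟨n, hn⟩ := (LinearMap.injective_iff_surjective
          (f := (fderiv ℝ (flowChart r Θ) (d s)).toLinearMap)).1
          (h.injective_fderiv_chart (d s)) (N (flowChart r Θ (d s)))
        have hn' : fderiv ℝ (flowChart r Θ) (d s) n = N (flowChart r Θ (d s)) := hn
        have h2 := form_fderiv_chart h hα (d s) n
        rw [hA, hn', hF.evalN, mul_zero, zero_add] at h2
        have hn2 : 0 < n 2 := by
          by_contra hneg
          nlinarith
        -- The orientation comparison: the frame determinant, up to `ε`, is the Jacobian times `v s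
        -- 1 * n 2`, and both the Jacobian and `n 2` are positive.
        have h3 := det3_map (fderiv ℝ (flowChart r Θ) (d s)) (stdVec 0) (v s) n
        rw [h.fderiv_chart_zero, hn', hs.2.2, ← hs.1] at h3
        have e1 : det3 (X (flowChart r Θ (d s))) (ε • Y (flowChart r Θ (d s)))
            (N (flowChart r Θ (d s))) = ε * det3 (X (flowChart r Θ (d s)))
              (Y (flowChart r Θ (d s))) (N (flowChart r Θ (d s))) := by
          simp only [det3, PiLp.smul_apply, smul_eq_mul]; ring
        have e2 : det3 (stdVec 0) (v s) n = v s 1 * n 2 := by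
          simp [det3, hv2]
        rw [e1, e2] at h3
        have h4 : 0 < ε * v s 1 * (n 2 * jac (flowChart r Θ) (d s)) := by
          have := hF.det_pos (flowChart r Θ (d s))
          calc _ < _ := this
            _ = ε * ε * det3 (X (flowChart r Θ (d s))) (Y (flowChart r Θ (d s)))
              (N (flowChart r Θ (d s))) := by rw [hεε, one_mul]
            _ = _ := by rw [mul_assoc, h3, jac, h.fderiv_chart_zero]; ring
        exact (pos_of_mul_pos_left h4 (mul_pos hn2 (h.jac_chart_pos _)).le).le
      have l1 := eventually_le_of_hasDerivAt_nonneg (f := fun s => ε * d s 1) (x := x) (by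
        filter_upwards [hder] with s hs using ⟨_, hs.2.2, (hs.1.coord 1).const_mul ε⟩)
      have l2 := eventually_le_of_hasDerivAt_nonneg (f := fun s => d s 2) (x := x) (by
        filter_upwards [hder] with s hs using ⟨_, hs.2.1.ge, hs.1.coord 2⟩)
      have l3 := eventually_le_of_hasDerivAt_nonneg (f := fun s => -d s 2) (x := x) (by
        filter_upwards [hder] with s hs using ⟨_, (neg_eq_zero.2 hs.2.1).ge, (hs.1.coord 2).neg⟩)
      filter_upwards [l1, l2, l3] with s h1 h2 h3
      exact ⟨(le_antisymm (neg_le_neg_iff.1 h3) h2).trans hdx.1, hdx.2.trans h1⟩) ht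
  exact ⟨q, hq.1, hq.2, hqt.symm⟩

end Frame

/-! ### No orbit is trapped -/

section NoTrap

variable {r σ : ℝ} {X Y N : R3 → R3} {Θ ΘY ΘN : ℝ → R3 → R3} {α : R3 → R3 →L[ℝ] ℝ}
  (h : IsStdFlow r X Θ) (hα : IsStdForm r σ X α) (hF : IsAdaptedFrame X Y N α ΘY ΘN)

namespace IsAdaptedFrame

include hF in
lemma Y_add (s t : ℝ) (p : R3) : ΘY (s + t) p = ΘY s (ΘY t p) :=
  hF.flowY.add hF.lipY.choose_spec s t p

include hF in
lemma N_add (s t : ℝ) (p : R3) : ΘN (s + t) p = ΘN s (ΘN t p) :=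
  hF.flowN.add hF.lipN.choose_spec s t p

include hF in
lemma contDiff_flowY : ContDiff ℝ ∞ (fun q : ℝ × R3 => ΘY q.1 q.2) :=
  hF.flowY.contDiff hF.contDiffY hF.lipY.choose_spec

include hF in
lemma contDiff_flowN : ContDiff ℝ ∞ (fun q : ℝ × R3 => ΘN q.1 q.2) :=
  hF.flowN.contDiff hF.contDiffN hF.lipN.choose_spec

include hF in
lemma continuous_flowY (t : ℝ) : Continuous (ΘY t) :=
  hF.contDiff_flowY.continuous.comp (by fun_prop : Continuous fun p : R3 => (t, p))

include h hF in
/-- The composed flows of the frame give local coordinates around every point. -/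
lemma eventually_eq_flows (q : R3) {ε : ℝ} (hε : 0 < ε) :
    ∀ᶠ x in 𝓝 q, ∃ a b c : ℝ, b < ε ∧ c < ε ∧ x = Θ a (ΘY b (ΘN c q)) := by
  set E : R3 → R3 := fun v => Θ (v 0) (ΘY (v 1) (ΘN (v 2) q)) with hE
  have hEs : ContDiff ℝ ∞ E := by
    have h1 : ContDiff ℝ ∞ fun v : R3 => ΘN (v 2) q :=
      hF.contDiff_flowN.comp ((contDiff_coord 2).prodMk contDiff_const)
    have h2 : ContDiff ℝ ∞ fun v : R3 => ΘY (v 1) (ΘN (v 2) q) :=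
      hF.contDiff_flowY.comp ((contDiff_coord 1).prodMk h1)
    exact h.contDiff_flow.comp ((contDiff_coord 0).prodMk h2)
  have hE0 : E 0 = q := by simp [hE, h.flow.zero, hF.flowY.zero, hF.flowN.zero]
  have hline : ∀ (i : Fin 3), HasDerivAt (fun t : ℝ => E (t • stdVec i))
      (fderiv ℝ E 0 (stdVec i)) 0 := by
    intro i
    have h1 : HasDerivAt (fun t : ℝ => t • stdVec i) (stdVec i) 0 := by
      simpa using (hasDerivAt_id (0 : ℝ)).smul_const (stdVec i)
    have h2 : HasFDerivAt E (fderiv ℝ E 0) ((0 : ℝ) • stdVec i) := by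
      rw [zero_smul]
      exact (hEs.differentiable (by simp) 0).hasFDerivAt
    exact h2.comp_hasDerivAt (0 : ℝ) h1
  have d0 : fderiv ℝ E 0 (stdVec 0) = X q := by
    refine (hline 0).unique ?_
    have := h.flow.hasDerivAt q 0
    rw [h.flow.zero] at this
    simpa [hE, hF.flowY.zero, hF.flowN.zero] using this
  have d1 : fderiv ℝ E 0 (stdVec 1) = Y q := by
    refine (hline 1).unique ?_
    have := hF.flowY.hasDerivAt q 0
    rw [hF.flowY.zero] at this
    simpa [hE, h.flow.zero, hF.flowN.zero] using this
  have d2 : fderiv ℝ E 0 (stdVec 2) = N q := by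
    refine (hline 2).unique ?_
    have := hF.flowN.hasDerivAt q 0
    rw [hF.flowN.zero] at this
    simpa [hE, h.flow.zero, hF.flowY.zero] using this
  have hinj : Function.Injective (fderiv ℝ E 0) := by
    apply injective_of_det3_ne_zero
    rw [d0, d1, d2]
    exact (hF.det_pos q).ne'
  have hmap := map_nhds_eq_of_injective hEs hinj
  rw [hE0] at hmap
  rw [← hmap, Filter.eventually_map]
  have hsmall : ∀ i : Fin 3, ∀ᶠ v : R3 in 𝓝 0, v i < ε := fun i =>
    (continuous_coord i).continuousAt.eventually_lt continuousAt_const (by simpa using hε)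
  filter_upwards [hsmall 1, hsmall 2] with v h1 h2
  exact ⟨v 0, v 1, v 2, h1, h2, rfl⟩

end IsAdaptedFrame

include h hα hF

/-- No orbit of `X` is trapped: the exceptional set would have a highest element, whose orbit would
accumulate on itself transversally. -/
theorem exits_of_frame (w : ℝ × ℝ) : Exits r (flowChart r Θ) w := by
  set Φ := flowChart r Θ with hΦ
  have hΦc : Continuous Φ := h.chart_continuous
  have hΦi : Function.Injective Φ := h.chart_injective
  by_contra hw
  -- the highest trapped orbit
  set B : Set (ℝ × ℝ) := {w | ¬ Exits r Φ w} with hB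
  have hBcl : IsClosed B := (h.isOpen_exits).isClosed_compl
  have hBsub : B ⊆ Icc (-r, -r) (r, r) := by
    intro v hv
    have hlt : v.1 ^ 2 + v.2 ^ 2 < r ^ 2 := by
      by_contra hle
      exact hv (h.exits_of_out (not_lt.1 hle))
    have h1 := abs_le.1 (abs_le_of_sq_le_sq (by nlinarith [sq_nonneg v.2]) h.pos.le :
      |v.1| ≤ r)
    have h2 := abs_le.1 (abs_le_of_sq_le_sq (by nlinarith [sq_nonneg v.1]) h.pos.le :
      |v.2| ≤ r)
    exact ⟨⟨h1.1, h2.1⟩, ⟨h1.2, h2.2⟩⟩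
  have hBc : IsCompact B := isCompact_Icc.of_isClosed_subset hBcl hBsub
  obtain ⟨m, hmB, hmax⟩ := hBc.exists_isMaxOn ⟨w, hw⟩ continuous_snd.continuousOn
  set z₀ := m.2 with hz₀
  have hB'c : IsCompact (B ∩ {v | v.2 = z₀}) :=
    hBc.inter_right (isClosed_eq continuous_snd continuous_const)
  -- Among the trapped orbits of maximal height, one of maximal `y`: this gives exiting neighbours
  -- both above and on one side.
  obtain ⟨⟨y₀, z'⟩, ⟨hbad', hz'⟩, hmax'⟩ := hB'c.exists_isMaxOn ⟨m, hmB, rfl⟩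
    continuous_fst.continuousOn
  obtain rfl : z' = z₀ := hz'
  have hexU : ∀ y z, z₀ < z → Exits r Φ (y, z) := by
    intro y z hz
    by_contra hne
    exact absurd (hmax (show (y, z) ∈ B from hne)) (not_le.2 hz)
  have hexS : ∀ y, y₀ < y → Exits r Φ (y, z₀) := by
    intro y hy
    by_contra hne
    exact absurd (hmax' (show (y, z₀) ∈ B ∩ {v | v.2 = z₀} from ⟨hne, rfl⟩)) (not_le.2 hy)
  set γ : ℝ → R3 := fun t => Φ (vec3 t y₀ z₀) with hγ
  -- an accumulation point outside the image of the chart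
  obtain ⟨q, -, φ, hφ, hlim⟩ := (isCompact_closedBall (0 : R3) (2 * r)).tendsto_subseq
    (x := fun n : ℕ => γ n) (fun n => h.chart_mem_closedBall_of_not_exits hbad'
      (by have := h.pos; have : (0 : ℝ) ≤ n := n.cast_nonneg; linarith))
  -- If `q` were in the image, a local section would make the times `φ k` converge, yet they tend to
  -- infinity.
  have hq : q ∉ range Φ := by
    rintro ⟨p, rfl⟩
    obtain ⟨g, hg, hgs, -, hev⟩ := exists_local_section h.chart_contDiff
      (h.injective_fderiv_chart p)
    have h1 := (hgs.continuousAt.tendsto.comp hlim)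
    have h2 : ∀ᶠ k in Filter.atTop, g (γ (φ k)) = vec3 (φ k) y₀ z₀ := by
      filter_upwards [hlim.eventually hev] with k hk
      exact hΦi hk.1
    have h3 : Filter.Tendsto (fun k => (φ k : ℝ)) Filter.atTop (𝓝 (g (Φ p) 0)) := by
      have := ((continuous_coord 0).continuousAt.tendsto.comp h1)
      refine this.congr' ?_
      filter_upwards [h2] with k hk
      simp only [Function.comp] at hk ⊢
      rw [hk]; rfl
    exact not_tendsto_nhds_of_tendsto_atTop
      (tendsto_natCast_atTop_atTop.comp hφ.tendsto_atTop) _ h3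
  -- The open region already known to be foliated. It is invariant under the flows of `X` and `Y`
  -- and under the forward flow of `N`.
  set U : Set R3 := Φ '' {p | z₀ < p 2} with hU
  have hUo : IsOpen U := isOpenMap_of_injective_fderiv h.chart_contDiff h.injective_fderiv_chart _
    (isOpen_lt continuous_const (continuous_coord 2))
  have hUX : ∀ t, MapsTo (Θ t) U U := by
    rintro t _ ⟨p, hp, rfl⟩
    exact ⟨p + t • stdVec 0, by simpa using hp, h.chart_shift p t⟩
  have hUY : ∀ t, MapsTo (ΘY t) U U := by
    rintro t _ ⟨p, hp, rfl⟩
    rcases le_total 0 t with ht | ht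
    · obtain ⟨q, hq2, -, hq⟩ := flowY_mem h hα hF (ε := 1) (Or.inl rfl) hexU hp ht
      rw [one_mul] at hq
      exact ⟨q, by rw [mem_ofPred_eq, hq2]; exact hp, hq.symm⟩
    · obtain ⟨q, hq2, -, hq⟩ := flowY_mem h hα hF (ε := -1) (Or.inr rfl) hexU hp
        (neg_nonneg.2 ht)
      rw [neg_one_mul, neg_neg] at hq
      exact ⟨q, by rw [mem_ofPred_eq, hq2]; exact hp, hq.symm⟩
  have hUN : ∀ t, 0 ≤ t → MapsTo (ΘN t) U U := by
    rintro t ht _ ⟨p, hp, rfl⟩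
    obtain ⟨q, hq2, hq⟩ := flowN_mem h hα hF hexU hp ht
    exact ⟨q, lt_of_lt_of_le hp hq2, hq.symm⟩
  have hXc : ∀ t, Continuous (Θ t) := fun t =>
    h.contDiff_flow.continuous.comp (by fun_prop : Continuous fun p : R3 => (t, p))
  have hcX : ∀ t, MapsTo (Θ t) (closure U) (closure U) := fun t => (hUX t).closure (hXc t)
  have hcY : ∀ t, MapsTo (ΘY t) (closure U) (closure U) := fun t =>
    (hUY t).closure (hF.continuous_flowY t)
  have hXinv : ∀ t p, Θ (-t) (Θ t p) = p := h.neg_apply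
  have hYinv : ∀ t p, ΘY (-t) (ΘY t p) = p := hF.flowY.neg_apply hF.lipY.choose_spec
  have hNinv : ∀ t p, ΘN (-t) (ΘN t p) = p := hF.flowN.neg_apply hF.lipN.choose_spec
  -- Write a nearby point of `U` in flow coordinates at `p` with `N`-coordinate `c < t`. Undoing the
  -- `X` and `Y` flows puts `ΘN c p` in `U`, and the forward `N`-flow does the rest.
  have hUNc : ∀ p ∈ closure U, ∀ t, 0 < t → ΘN t p ∈ U := by
    intro p hp t ht
    obtain ⟨x, ⟨a, b, c, -, hc, rfl⟩, hxU⟩ := (mem_closure_iff_frequently.1 hp).and_eventually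
      (hF.eventually_eq_flows h p ht) |>.exists.imp fun _ hx => hx.symm
    have h1 : ΘN c p ∈ U := by
      have := hUY (-b) (hUX (-a) hxU)
      rwa [hXinv, hYinv] at this
    have := hUN (t - c) (by linarith) h1
    rwa [← hF.N_add, sub_add_cancel] at this
  -- points of the frontier of `U` close to each other lie on the same plaque
  have hplaque : ∀ p ∈ closure U, p ∉ U → ∀ a b c,
      Θ a (ΘY b (ΘN c p)) ∈ closure U → Θ a (ΘY b (ΘN c p)) ∉ U → c = 0 := by
    intro p hp hpU a b c hx hxU
    rcases lt_trichotomy c 0 with hc | hc | hc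
    · exfalso
      have h1 : ΘN c p ∈ closure U := by
        have := hcY (-b) (hcX (-a) hx)
        rwa [hXinv, hYinv] at this
      have h2 := hUNc _ h1 (-c) (by linarith)
      rw [hNinv] at h2
      exact hpU h2
    · exact hc
    · exact absurd (hUX a (hUY b (hUNc p hp c hc))) hxU
  -- The sheet of crossing orbits at the critical height, with the trapped orbit `γ` as its edge.
  set S : Set R3 := Φ '' {p | p 2 = z₀ ∧ y₀ < p 1} with hS
  have hSU : ∀ p ∈ S, p ∉ U := by
    rintro _ ⟨p, hp, rfl⟩ ⟨p', hp', heq⟩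
    rw [hΦi heq, mem_ofPred_eq, hp.1] at hp'
    exact lt_irrefl _ hp'
  have hup : ∀ p : R3, p 2 = z₀ → Φ p ∈ closure U := by
    intro p hp
    have h1 : Filter.Tendsto (fun t : ℝ => Φ (p + t • stdVec 2)) (𝓝[>] 0) (𝓝 (Φ p)) := by
      have : Continuous fun t : ℝ => Φ (p + t • stdVec 2) := hΦc.comp (by fun_prop)
      have h2 := this.tendsto 0
      simp only [zero_smul, add_zero] at h2
      exact h2.mono_left nhdsWithin_le_nhds
    refine mem_closure_of_tendsto h1 ?_
    filter_upwards [self_mem_nhdsWithin] with t ht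
    exact ⟨_, by simpa [hp] using ht, rfl⟩
  have hScU : S ⊆ closure U := by
    rintro _ ⟨p, hp, rfl⟩
    exact hup p hp.1
  have hSX : ∀ t, MapsTo (Θ t) S S := by
    rintro t _ ⟨p, hp, rfl⟩
    exact ⟨p + t • stdVec 0, by simpa using hp, h.chart_shift p t⟩
  have hSY : ∀ t, 0 ≤ t → MapsTo (ΘY t) S S := by
    rintro t ht _ ⟨p, hp, rfl⟩
    -- `flowY_mem` applies only above `z₀`, so the `Y`-orbit is obtained as a limit from above
    -- inside this closed box of exiting orbits. Its height stays `z₀` because otherwise backward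
    -- invariance of `U` would put `Φ p` in `U`.
    have hW : IsClosed {w : ℝ × ℝ | z₀ ≤ w.2 ∧ p 1 ≤ w.1} :=
      (isClosed_le continuous_const continuous_snd).inter
        (isClosed_le continuous_const continuous_fst)
    have hWex : ∀ w ∈ {w : ℝ × ℝ | z₀ ≤ w.2 ∧ p 1 ≤ w.1}, Exits r Φ w := by
      rintro ⟨y, z⟩ ⟨hz, hy⟩
      dsimp only at hz hy
      rcases hz.lt_or_eq with hz | hz
      · exact hexU y z hz
      · rw [← hz]; exact hexS y (hp.2.trans_le hy)
    have hcl := h.isClosed_chart_image hW hWex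
    have h1 : Filter.Tendsto (fun u : ℝ => ΘY t (Φ (p + u • stdVec 2))) (𝓝[>] 0)
        (𝓝 (ΘY t (Φ p))) := by
      have : Continuous fun u : ℝ => ΘY t (Φ (p + u • stdVec 2)) :=
        (hF.continuous_flowY t).comp (hΦc.comp (by fun_prop))
      have h2 := this.tendsto 0
      simp only [zero_smul, add_zero] at h2
      exact h2.mono_left nhdsWithin_le_nhds
    obtain ⟨q', ⟨hq2, hq1⟩, hqe⟩ := hcl.mem_of_tendsto h1 (by
      filter_upwards [self_mem_nhdsWithin] with u hu
      have hu' : (0 : ℝ) < u := hu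
      obtain ⟨q', hq2, hq1, hq⟩ := flowY_mem h hα hF (ε := 1) (Or.inl rfl) hexU
        (p := p + u • stdVec 2) (by simp [hp.1]; exact hu') ht
      rw [one_mul] at hq
      refine ⟨q', ⟨?_, ?_⟩, hq.symm⟩
      · simp [hq2, hp.1, hu'.le]
      · simpa using hq1)
    dsimp only at hq1 hq2
    refine ⟨q', ⟨?_, hp.2.trans_le hq1⟩, hqe⟩
    by_contra hne
    have h3 : ΘY t (Φ p) ∈ U := ⟨q', lt_of_le_of_ne hq2 (Ne.symm hne), hqe⟩
    have h4 := hUY (-t) h3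
    rw [hYinv] at h4
    exact hSU _ ⟨p, hp, rfl⟩ h4
  have hSYc : ∀ p ∈ closure S, p ∉ U → ∀ t, 0 < t → ΘY t p ∈ S := by
    intro p hp hpU t ht
    obtain ⟨x, ⟨a, b, c, hb, -, rfl⟩, hxS⟩ := (mem_closure_iff_frequently.1 hp).and_eventually
      (hF.eventually_eq_flows h p ht) |>.exists.imp fun _ hx => hx.symm
    have hc := hplaque p (closure_minimal hScU isClosed_closure hp) hpU a b c (hScU hxS)
      (hSU _ hxS)
    rw [hc, hF.flowN.zero] at hxS
    have h1 : ΘY b p ∈ S := by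
      have := hSX (-a) hxS
      rwa [hXinv] at this
    have := hSY (t - b) (by linarith) h1
    rwa [← hF.Y_add, sub_add_cancel] at this
  -- the contradiction
  have hγS : ∀ t, γ t ∈ closure S := by
    intro t
    have h1 : Filter.Tendsto (fun u : ℝ => Φ (vec3 t (y₀ + u) z₀)) (𝓝[>] 0) (𝓝 (γ t)) := by
      have : Continuous fun u : ℝ => Φ (vec3 t (y₀ + u) z₀) :=
        hΦc.comp (continuous_vec3 (by fun_prop) (by fun_prop) (by fun_prop))
      have h2 := this.tendsto 0
      simp only [add_zero] at h2
      exact h2.mono_left nhdsWithin_le_nhds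
    refine mem_closure_of_tendsto h1 ?_
    filter_upwards [self_mem_nhdsWithin] with u hu
    exact ⟨_, by simpa using hu, rfl⟩
  have hγU : ∀ t, γ t ∉ U := by
    rintro t ⟨p, hp, heq⟩
    rw [hΦi heq] at hp
    exact lt_irrefl z₀ hp
  have hγS' : ∀ t, γ t ∉ S := by
    rintro t ⟨p, hp, heq⟩
    rw [hΦi heq] at hp
    exact lt_irrefl y₀ hp.2
  have hqS : q ∈ closure S := isClosed_closure.mem_of_tendsto hlim
    (Filter.Eventually.of_forall fun k => hγS _)
  have hqU : q ∉ U := fun hqU => hq (image_subset_range _ _ hqU)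
  obtain ⟨k, a, b, c, -, -, hk⟩ := (hlim.eventually
    (hF.eventually_eq_flows h q one_pos)).exists
  simp only [Function.comp] at hk
  -- Both `q` and a point of `γ` near it lie in `closure U` but not in `U`, so their `N`-coordinates
  -- agree; only the `Y`-coordinate `b` is left.
  have hc := hplaque q (closure_minimal hScU isClosed_closure hqS) hqU a b c
    (hk ▸ closure_minimal hScU isClosed_closure (hγS _)) (hk ▸ hγU _)
  rw [hc, hF.flowN.zero] at hk
  have hback : ∀ t, Θ t (γ (φ k)) = γ (φ k + t) := by
    intro t
    simp only [hγ]
    rw [hΦ, ← h.chart_shift, vec3_add_smul]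
  have hYb : ΘY b q = γ (φ k + -a) := by rw [← hback, hk, hXinv]
  -- If `b < 0`, flowing `γ` forward along `Y` puts `q` in `S`; if `b = 0`, then `q` is on `γ`; both
  -- contradict `q ∉ range Φ`. If `b > 0`, flowing `q` forward puts a point of `γ` in `S`.
  rcases lt_trichotomy b 0 with hb | hb | hb
  · have h1 := hSYc _ (hYb ▸ hγS _) (hYb ▸ hγU _) (-b) (by linarith)
    rw [hYinv] at h1
    exact hq (image_subset_range _ _ h1)
  · rw [hb, hF.flowY.zero] at hYb
    exact hq ⟨_, hYb.symm⟩
  · exact hγS' _ (hYb ▸ hSYc q hqS hqU b hb)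

end NoTrap

/-! ### Global diffeomorphisms and monotone shears -/

section Diffeo

/-- `f` is a diffeomorphism of the whole space with inverse `g`. -/
structure IsDiffeoPair (f g : R3 → R3) : Prop where
  contDiff : ContDiff ℝ ∞ f
  contDiff_inv : ContDiff ℝ ∞ g
  left_inv : ∀ p, g (f p) = p
  right_inv : ∀ p, f (g p) = p

namespace IsDiffeoPair

variable {f g f' g' : R3 → R3}

lemma symm (h : IsDiffeoPair f g) : IsDiffeoPair g f :=
  ⟨h.contDiff_inv, h.contDiff, h.right_inv, h.left_inv⟩

lemma comp (h : IsDiffeoPair f g) (h' : IsDiffeoPair f' g') :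
    IsDiffeoPair (f ∘ f') (g' ∘ g) :=
  ⟨h.contDiff.comp h'.contDiff, h'.contDiff_inv.comp h.contDiff_inv,
    fun p => by simp [h.left_inv, h'.left_inv], fun p => by simp [h.right_inv, h'.right_inv]⟩

lemma differentiable (h : IsDiffeoPair f g) : Differentiable ℝ f :=
  h.contDiff.differentiable (by simp)

lemma fderiv_inv_fderiv (h : IsDiffeoPair f g) (p v : R3) :
    fderiv ℝ g (f p) (fderiv ℝ f p v) = v := by
  have h1 := (h.symm.differentiable (f p)).hasFDerivAt.comp p (h.differentiable p).hasFDerivAt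
  have h2 : HasFDerivAt (g ∘ f) (ContinuousLinearMap.id ℝ R3) p :=
    (hasFDerivAt_id p).congr_of_eventuallyEq (Filter.Eventually.of_forall h.left_inv)
  exact congr($(h1.unique h2) v)

end IsDiffeoPair

lemma exists_isDiffeoPair {f : R3 → R3} (hf : ContDiff ℝ ∞ f) (hb : Function.Bijective f)
    (hinj : ∀ p, Function.Injective (fderiv ℝ f p)) : ∃ g, IsDiffeoPair f g := by
  set e := Equiv.ofBijective f hb
  refine ⟨e.symm, hf, ?_, e.symm_apply_apply, e.apply_symm_apply⟩
  rw [contDiff_iff_contDiffAt]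
  intro q
  obtain ⟨p, rfl⟩ := hb.2 q
  obtain ⟨g, -, hg, -, hev⟩ := exists_local_section hf (hinj p)
  refine hg.congr_of_eventuallyEq ?_
  filter_upwards [hev] with x hx
  exact e.symm_apply_eq.2 hx.1.symm

/-- Shears along a coordinate direction which are increasing on each line are diffeomorphisms. -/
lemma exists_isDiffeoPair_shear {g : R3 → ℝ} (hg : ContDiff ℝ ∞ g) (i : Fin 3)
    (hder : ∀ p, ∃ d, HasDerivAt (fun t : ℝ => g (p + t • stdVec i)) d 0 ∧ 0 < 1 + d)
    (hlo : ∀ p, ∃ a : ℝ, a + g (p + a • stdVec i) ≤ 0)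
    (hhi : ∀ p, ∃ a : ℝ, 0 ≤ a + g (p + a • stdVec i)) :
    ∃ k, IsDiffeoPair (fun p => p + g p • stdVec i) k := by
  have hd : ∀ p, 0 < 1 + fderiv ℝ g p (stdVec i) := by
    intro p
    obtain ⟨d, hd, hpos⟩ := hder p
    have h1 : HasDerivAt (fun t : ℝ => p + t • stdVec i) (stdVec i) 0 := by
      simpa using ((hasDerivAt_id (0 : ℝ)).smul_const (stdVec i)).const_add p
    have h2 : HasFDerivAt g (fderiv ℝ g p) (p + (0 : ℝ) • stdVec i) := by
      simpa using (hg.differentiable (by simp) p).hasFDerivAt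
    rwa [(h2.comp_hasDerivAt (0 : ℝ) h1).unique hd]
  have hline : ∀ p (t : ℝ), HasDerivAt (fun t : ℝ => t + g (p + t • stdVec i))
      (1 + fderiv ℝ g (p + t • stdVec i) (stdVec i)) t := by
    intro p t
    have h1 : HasDerivAt (fun t : ℝ => p + t • stdVec i) (stdVec i) t := by
      simpa using ((hasDerivAt_id t).smul_const (stdVec i)).const_add p
    exact (hasDerivAt_id t).add
      ((hg.differentiable (by simp) _).hasFDerivAt.comp_hasDerivAt t h1)
  have hmono : ∀ p, StrictMono fun t : ℝ => t + g (p + t • stdVec i) := fun p =>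
    strictMono_of_deriv_pos fun t => by rw [(hline p t).deriv]; exact hd _
  have hcont : ∀ p, Continuous fun t : ℝ => t + g (p + t • stdVec i) := fun p =>
    continuous_iff_continuousAt.2 fun t => (hline p t).continuousAt
  refine exists_isDiffeoPair (by fun_prop) ⟨fun p q hpq => ?_, fun q => ?_⟩ fun p => ?_
  · dsimp only at hpq
    have h1 : q = p + (g p - g q) • stdVec i := by
      rw [sub_smul, ← add_sub_assoc, hpq, add_sub_cancel_right]
    have h2 : (fun t : ℝ => t + g (p + t • stdVec i)) (g p - g q)
        = (fun t : ℝ => t + g (p + t • stdVec i)) 0 := by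
      dsimp only
      rw [← h1]; simp
    have h3 := (hmono p).injective h2
    rw [h1, h3]; simp
  · obtain ⟨t, ht⟩ := mem_range_of_exists_le_of_exists_ge (hcont q) (hlo q) (hhi q)
    refine ⟨q + t • stdVec i, ?_⟩
    dsimp only at ht ⊢
    rw [add_assoc, ← add_smul, ht]; simp
  · have h1 : HasFDerivAt (fun p => p + g p • stdVec i)
        (ContinuousLinearMap.id ℝ R3 + (fderiv ℝ g p).smulRight (stdVec i)) p :=
      (hasFDerivAt_id p).add ((hg.differentiable (by simp) p).hasFDerivAt.smul_const _)
    rw [h1.fderiv, injective_iff_map_eq_zero]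
    intro v hv
    simp only [add_apply, ContinuousLinearMap.id_apply,
      ContinuousLinearMap.smulRight_apply] at hv
    have h2 : v = (-fderiv ℝ g p v) • stdVec i := by
      rw [neg_smul]; exact eq_neg_of_add_eq_zero_left hv
    have h3 : fderiv ℝ g p v = -fderiv ℝ g p v * fderiv ℝ g p (stdVec i) := by
      conv_lhs => rw [h2]
      simp
    have h4 : fderiv ℝ g p v * (1 + fderiv ℝ g p (stdVec i)) = 0 := by linarith
    rw [h2, (mul_eq_zero.1 h4).resolve_right (hd p).ne']
    simp

/-- Stretching the standard transition over a long interval makes its derivative small; this keeps a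
shear along `x`, cut off in `x`, monotone. -/
lemma exists_slow_transition {ε : ℝ} (hε : 0 < ε) : ∃ (χ : ℝ → ℝ) (ℓ : ℝ), ContDiff ℝ ∞ χ ∧
    (∀ t, 0 ≤ χ t ∧ χ t ≤ 1) ∧ (∀ t ≤ 0, χ t = 0) ∧ (∀ t, ℓ ≤ t → χ t = 1) ∧
    ∀ t, |deriv χ t| ≤ ε := by
  have hs : ContDiff ℝ ∞ Real.smoothTransition := Real.smoothTransition.contDiff
  obtain ⟨M, hM⟩ := isCompact_Icc.exists_bound_of_continuousOn
    (hs.continuous_deriv (by simp)).continuousOn (s := Icc (0 : ℝ) 1)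
  have hM' : ∀ t, |deriv Real.smoothTransition t| ≤ max M 0 := by
    intro t
    rcases lt_or_ge t 0 with ht | ht
    · have : Real.smoothTransition =ᶠ[𝓝 t] fun _ => 0 := by
        filter_upwards [gt_mem_nhds ht] with s hs
          using Real.smoothTransition.zero_of_nonpos hs.le
      rw [this.deriv_eq]; simp
    rcases le_or_gt t 1 with ht1 | ht1
    · exact (hM t ⟨ht, ht1⟩).trans (le_max_left _ _)
    · have : Real.smoothTransition =ᶠ[𝓝 t] fun _ => 1 := by
        filter_upwards [lt_mem_nhds ht1] with s hs
          using Real.smoothTransition.one_of_one_le hs.le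
      rw [this.deriv_eq]; simp
  set ℓ := (max M 0 + 1) / ε with hℓ
  have hℓ0 : 0 < ℓ := by positivity
  refine ⟨fun t => Real.smoothTransition (t / ℓ), ℓ, by fun_prop, fun t =>
    ⟨Real.smoothTransition.nonneg _, Real.smoothTransition.le_one _⟩, fun t ht =>
    Real.smoothTransition.zero_of_nonpos (div_nonpos_of_nonpos_of_nonneg ht hℓ0.le), fun t ht =>
    Real.smoothTransition.one_of_one_le ((one_le_div hℓ0).2 ht), fun t => ?_⟩
  have h1 : HasDerivAt (fun t => Real.smoothTransition (t / ℓ))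
      (deriv Real.smoothTransition (t / ℓ) * (1 / ℓ)) t :=
    (hs.differentiable (by simp) _).hasDerivAt.comp t ((hasDerivAt_id t).div_const ℓ)
  rw [h1.deriv, abs_mul, abs_of_pos (show 0 < 1 / ℓ by positivity), mul_one_div,
    div_le_iff₀ hℓ0]
  refine (hM' _).trans ?_
  rw [hℓ, mul_div_cancel₀ _ hε.ne']
  linarith

end Diffeo

/-! ### Straightening by a diffeomorphism supported in a cylinder -/

section Straighten

variable {r σ : ℝ} {X Y N : R3 → R3} {Θ ΘY ΘN : ℝ → R3 → R3} {α : R3 → R3 →L[ℝ] ℝ}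
  (h : IsStdFlow r X Θ) (hα : IsStdForm r σ X α) (hF : IsAdaptedFrame X Y N α ΘY ΘN)
include h hα hF

lemma pullCoeff_eq_zero (p : R3) : pullCoeff α (flowChart r Θ) (stdVec 1) p = 0 :=
  flat_of_exits h hα (z₀ := p 2 - 1) (fun _ _ _ => exits_of_frame h hα hF _) p (by linarith)

lemma pullCoeff_pos (p : R3) : 0 < pullCoeff α (flowChart r Θ) (stdVec 2) p :=
  pullCoeff_vertical_pos h hα fun _ => pullCoeff_eq_zero h hα hF _

/-- The image is open because the chart is a local diffeomorphism, and closed because it is a flow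
box of exiting orbits. -/
lemma chart_surjective : Function.Surjective (flowChart r Θ) := by
  have hcl := h.isClosed_chart_image (W := univ) isClosed_univ
    (fun w _ => exits_of_frame h hα hF w)
  have hop := isOpenMap_of_injective_fderiv h.chart_contDiff h.injective_fderiv_chart _ isOpen_univ
  have heq : flowChart r Θ '' {p : R3 | (p 1, p 2) ∈ univ} = flowChart r Θ '' univ := by simp
  rw [heq] at hcl
  have := IsClopen.eq_univ ⟨hcl, hop⟩ ⟨_, mem_image_of_mem _ (mem_univ 0)⟩
  rw [image_univ] at this
  exact range_eq_univ.1 this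

/-- A confoliation with an adapted frame is a foliation. -/
lemma wedgeCoeff_eq_zero (q : R3) : wedgeCoeff (α q) (fderiv ℝ α q) = 0 := by
  obtain ⟨p, rfl⟩ := chart_surjective h hα hF q
  obtain ⟨a, c, ha, -, hw⟩ := pullCoeff_wronskian h hα p
  simp only [pullCoeff_eq_zero h hα hF] at ha hw
  rw [ha.unique (hasDerivAt_const (0 : ℝ) (0 : ℝ)), mul_zero, zero_mul, sub_zero] at hw
  exact (mul_eq_zero.1 hw.symm).resolve_left (h.jac_chart_pos p).ne'

lemma exists_right_time : ∃ T, r < T ∧ ∀ y z, r < flowChart r Θ (vec3 T y z) 0 := by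
  obtain ⟨T₀, hT₀⟩ := h.exists_transit_time (isCompact_Icc (a := ((-r, -r) : ℝ × ℝ)) (b := (r, r)))
    (fun w _ => exits_of_frame h hα hF w)
  refine ⟨max T₀ (r + 1), by linarith [le_max_right T₀ (r + 1)], fun y z => ?_⟩
  rcases le_total (r ^ 2) (y ^ 2 + z ^ 2) with hr | hr
  · rw [h.chart_out (by simpa using hr)]
    simp
  · have h1 := abs_le.1 (abs_le_of_sq_le_sq (by nlinarith [sq_nonneg z]) h.pos.le : |y| ≤ r)
    have h2 := abs_le.1 (abs_le_of_sq_le_sq (by nlinarith [sq_nonneg y]) h.pos.le : |z| ≤ r)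
    exact hT₀ (y, z) ⟨⟨h1.1, h2.1⟩, ⟨h1.2, h2.2⟩⟩ _ (le_max_left _ _)

/-- On the exit plane the `y`-derivative of the height is the coefficient `A = 0`, and at `y = r`
the chart is the identity. -/
lemma chart_right_height {T : ℝ} (hT : ∀ y z, r < flowChart r Θ (vec3 T y z) 0) (y z : ℝ) :
    flowChart r Θ (vec3 T y z) 2 = z := by
  have hd : ∀ y, HasDerivAt (fun y => flowChart r Θ (vec3 T y z) 2) 0 y := by
    intro y
    have h1 : HasDerivAt (fun y => vec3 T y z) (stdVec 1) y := by
      have h1 : (fun s => vec3 T s z) = fun s : ℝ => vec3 T 0 z + s • stdVec 1 := by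
        ext1 s; apply ext3 <;> simp
      rw [h1]
      simpa using ((hasDerivAt_id y).smul_const (stdVec 1)).const_add (vec3 T 0 z)
    have h2 := ((h.chart_differentiable (vec3 T y z)).hasFDerivAt.comp_hasDerivAt y h1).coord 2
    refine h2.congr_deriv ?_
    rw [← pullCoeff_eq_zero h hα hF (vec3 T y z), pullCoeff, form_chart_right hα (hT y z).le]
    rfl
  have h1 := is_const_of_deriv_eq_zero (fun y => (hd y).differentiableAt)
    (fun y => (hd y).deriv) y r
  rw [h1, h.chart_out (by simp; positivity)]
  simp

/-- The foliation is straightened by a diffeomorphism supported in a cylinder. -/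
theorem exists_straightening : ∃ F G : R3 → R3, IsDiffeoPair F G ∧
    (∃ L, ∀ q : R3, L ≤ |q 0| ∨ r ^ 2 ≤ q 1 ^ 2 + q 2 ^ 2 → F q = q) ∧
    ∀ q v, fderiv ℝ F q v 2 = 0 ↔ α q v = 0 := by
  set Φ := flowChart r Θ with hΦ
  have hΦs : ContDiff ℝ ∞ Φ := h.chart_contDiff
  obtain ⟨T, hrT, hT⟩ := exists_right_time h hα hF
  set R : R3 → R3 := fun p => Φ (vec3 T (p 1) (p 2)) with hR
  have hRs : ContDiff ℝ ∞ R :=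
    hΦs.comp (contDiff_vec3 contDiff_const (contDiff_coord 1) (contDiff_coord 2))
  set τ : R3 → ℝ := fun p => R p 0 - T with hτ
  set η : R3 → ℝ := fun p => R p 1 - p 1 with hη
  have hτs : ContDiff ℝ ∞ τ := ((contDiff_coord 0).comp hRs).sub contDiff_const
  have hηs : ContDiff ℝ ∞ η := ((contDiff_coord 1).comp hRs).sub (contDiff_coord 1)
  have hRout : ∀ p : R3, r ^ 2 ≤ p 1 ^ 2 + p 2 ^ 2 → R p = vec3 T (p 1) (p 2) := fun p hp =>
    h.chart_out (by simpa using hp)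
  have hτout : ∀ p : R3, r ^ 2 ≤ p 1 ^ 2 + p 2 ^ 2 → τ p = 0 := fun p hp => by
    simp [hτ, hRout p hp]
  have hηout : ∀ p : R3, r ^ 2 ≤ p 1 ^ 2 + p 2 ^ 2 → η p = 0 := fun p hp => by
    simp [hη, hRout p hp]
  have hR2 : ∀ p, R p 2 = p 2 := fun p => chart_right_height h hα hF hT _ _
  have hRline : ∀ p (t : ℝ), R (p + t • stdVec 0) = R p := fun p t => by simp [hR]
  -- bounds
  have hbound : ∀ f : R3 → ℝ, Continuous f → (∀ p (t : ℝ), f (p + t • stdVec 0) = f p) →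
      (∀ p : R3, r ^ 2 ≤ p 1 ^ 2 + p 2 ^ 2 → f p = 0) → ∃ M, 0 ≤ M ∧ ∀ p, |f p| ≤ M := by
    intro f hf hfl hfo
    obtain ⟨M, hM⟩ := (isCompact_closedBall (0 : R3) r).exists_bound_of_continuousOn
      hf.continuousOn
    refine ⟨max M 0, le_max_right _ _, fun p => ?_⟩
    rcases le_total (r ^ 2) (p 1 ^ 2 + p 2 ^ 2) with hr | hr
    · rw [hfo p hr]; simp
    · rw [← hfl p (-(p 0))]
      refine (hM _ ?_).trans (le_max_left _ _)
      rw [mem_closedBall_zero_iff]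
      refine le_of_sq_le_sq ?_ h.pos.le
      rw [sq_norm_eq]
      simpa using hr
  obtain ⟨M, hM0, hM⟩ := hbound τ hτs.continuous (fun p t => by simp [hτ, hRline]) hτout
  obtain ⟨M', hM'0, hM'⟩ := hbound η hηs.continuous (fun p t => by simp [hη, hRline]) hηout
  -- With this bound, `|χ' τ| ≤ M / (2 (M + 1)) < 1`, so the shear along `x` is increasing.
  obtain ⟨χ, ℓ, hχs, hχ01, hχ0, hχ1, hχd⟩ := exists_slow_transition
    (show 0 < 1 / (2 * (M + 1)) by positivity)
  -- the two shears
  set g₁ : R3 → ℝ := fun p => χ (p 0 - T) * τ p with hg₁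
  have hg₁s : ContDiff ℝ ∞ g₁ :=
    (hχs.comp ((contDiff_coord 0).sub contDiff_const)).mul hτs
  have hg₁b : ∀ p, |g₁ p| ≤ M := fun p => by
    rw [hg₁, abs_mul, abs_of_nonneg (hχ01 _).1]
    nlinarith [hM p, abs_nonneg (τ p), hχ01 (p 0 - T)]
  obtain ⟨k₁, hk₁⟩ := exists_isDiffeoPair_shear hg₁s 0 (fun p => by
      have h1 : HasDerivAt (fun t : ℝ => χ (p 0 + t - T)) (deriv χ (p 0 - T)) 0 := by
        have h2 : HasDerivAt χ (deriv χ (p 0 - T)) (p 0 + 0 - T) := by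
          simpa using (hχs.differentiable (by simp) (p 0 - T)).hasDerivAt
        simpa [Function.comp_def] using h2.comp (0 : ℝ) (((hasDerivAt_id (0 : ℝ)).const_add (p 0)).sub_const T)
      refine ⟨deriv χ (p 0 - T) * τ p, ?_, ?_⟩
      · have := h1.mul_const (τ p)
        refine this.congr_of_eventuallyEq (Filter.Eventually.of_forall fun t => ?_)
        simp [hg₁, hτ, hRline]
      · have h2 : |deriv χ (p 0 - T) * τ p| ≤ 1 / (2 * (M + 1)) * M := by
          rw [abs_mul]
          exact mul_le_mul (hχd _) (hM p) (abs_nonneg _) (by positivity)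
        have h3 : 1 / (2 * (M + 1)) * M < 1 := by
          rw [one_div_mul_eq_div, div_lt_one (by positivity)]; linarith
        linarith [(abs_le.1 h2).1])
    (fun p => ⟨-M, by linarith [(abs_le.1 (hg₁b (p + (-M) • stdVec 0))).2]⟩)
    (fun p => ⟨M, by linarith [(abs_le.1 (hg₁b (p + M • stdVec 0))).1]⟩)
  set g₂ : R3 → ℝ := fun p => χ (p 0 - T) * η p with hg₂
  have hg₂s : ContDiff ℝ ∞ g₂ :=
    (hχs.comp ((contDiff_coord 0).sub contDiff_const)).mul hηs
  have hg₂b : ∀ p, |g₂ p| ≤ M' := fun p => by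
    rw [hg₂, abs_mul, abs_of_nonneg (hχ01 _).1]
    nlinarith [hM' p, abs_nonneg (η p), hχ01 (p 0 - T)]
  -- At the exit `X = ∂/∂x` and `A = 0`, so the Jacobian is the product of `C` and the
  -- `y`-derivative of the second coordinate. Both the Jacobian and `C` are positive, hence so is
  -- that derivative.
  have hηd : ∀ p, 0 < 1 + fderiv ℝ η p (stdVec 1) := by
    intro p
    set P := vec3 T (p 1) (p 2) with hP
    have hRd : ∀ i : Fin 3, i ≠ 0 → fderiv ℝ R p (stdVec i) = fderiv ℝ Φ P (stdVec i) := by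
      intro i hi
      have h1 : HasDerivAt (fun t : ℝ => p + t • stdVec i) (stdVec i) 0 := by
        simpa using ((hasDerivAt_id (0 : ℝ)).smul_const (stdVec i)).const_add p
      have h2 : HasDerivAt (fun t : ℝ => P + t • stdVec i) (stdVec i) 0 := by
        simpa using ((hasDerivAt_id (0 : ℝ)).smul_const (stdVec i)).const_add P
      have h3 : HasFDerivAt R (fderiv ℝ R p) (p + (0 : ℝ) • stdVec i) := by
        simpa using (hRs.differentiable (by simp) p).hasFDerivAt
      have h4 : HasFDerivAt Φ (fderiv ℝ Φ P) (P + (0 : ℝ) • stdVec i) := by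
        simpa using (h.chart_differentiable P).hasFDerivAt
      have h5 := h4.comp_hasDerivAt (0 : ℝ) h2
      refine (h3.comp_hasDerivAt (0 : ℝ) h1).unique (h5.congr_of_eventuallyEq
        (Filter.Eventually.of_forall fun t => ?_))
      simp only [hR, hP, Function.comp]
      congr 1
      apply ext3 <;> simp [hi.symm]
    have hjac := h.jac_chart_pos P
    have hα' : α (Φ P) = dz := form_chart_right hα (hT _ _).le
    have hC := pullCoeff_pos h hα hF P
    have hA := pullCoeff_eq_zero h hα hF P
    rw [pullCoeff, hα', dz_apply] at hC hA
    rw [jac, h.fderiv_chart_zero, h.std _ (le_norm_of_le_abs 0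
      ((hT _ _).le.trans (le_abs_self _)))] at hjac
    simp only [det3, stdVec_apply] at hjac
    rw [hA] at hjac
    simp at hjac
    have h1 : 0 < fderiv ℝ Φ P (stdVec 1) 1 := by
      by_contra hneg
      nlinarith
    have h2 : fderiv ℝ η p (stdVec 1) = fderiv ℝ Φ P (stdVec 1) 1 - 1 := by
      have h3 := ((hRs.differentiable (by simp) p).hasFDerivAt.coord 1).sub
        (HasFDerivAt.coord (hasFDerivAt_id p) 1)
      rw [show fderiv ℝ η p = _ from h3.fderiv]
      simp [hRd 1 (by decide)]
    rw [h2]; linarith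
  obtain ⟨k₂, hk₂⟩ := exists_isDiffeoPair_shear hg₂s 1 (fun p => by
      have h1 : HasDerivAt (fun t : ℝ => p + t • stdVec 1) (stdVec 1) 0 := by
        simpa using ((hasDerivAt_id (0 : ℝ)).smul_const (stdVec 1)).const_add p
      have h2 : HasFDerivAt η (fderiv ℝ η p) (p + (0 : ℝ) • stdVec 1) := by
        simpa using (hηs.differentiable (by simp) p).hasFDerivAt
      refine ⟨χ (p 0 - T) * fderiv ℝ η p (stdVec 1), ?_, ?_⟩
      · have := (h2.comp_hasDerivAt (0 : ℝ) h1).const_mul (χ (p 0 - T))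
        refine this.congr_of_eventuallyEq (Filter.Eventually.of_forall fun t => ?_)
        simp [hg₂]
      · have h3 := hχ01 (p 0 - T)
        rcases h3.1.eq_or_lt with h4 | h4
        · rw [← h4]; simp
        · have h5 := mul_pos h4 (hηd p)
          linarith)
    (fun p => ⟨-M', by linarith [(abs_le.1 (hg₂b (p + (-M') • stdVec 1))).2]⟩)
    (fun p => ⟨M', by linarith [(abs_le.1 (hg₂b (p + M' • stdVec 1))).1]⟩)
  obtain ⟨Ψ, hΨ⟩ := exists_isDiffeoPair hΦs ⟨h.chart_injective, chart_surjective h hα hF⟩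
    h.injective_fderiv_chart
  set H₁ : R3 → R3 := fun p => p + g₁ p • stdVec 0 with hH₁
  set H₂ : R3 → R3 := fun p => p + g₂ p • stdVec 1 with hH₂
  have hH := hk₂.comp hk₁
  set H : R3 → R3 := H₂ ∘ H₁ with hHdef
  have hHleft : ∀ p : R3, p 0 ≤ T → H p = p := by
    intro p hp
    have h1 : g₁ p = 0 := by simp [hg₁, hχ0 _ (sub_nonpos.2 hp)]
    have h2 : g₂ p = 0 := by simp [hg₂, hχ0 _ (sub_nonpos.2 hp)]
    simp [hHdef, hH₁, hH₂, h1, h2]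
  have hHout : ∀ p : R3, r ^ 2 ≤ p 1 ^ 2 + p 2 ^ 2 → H p = p := by
    intro p hp
    have h1 : g₁ p = 0 := by simp [hg₁, hτout p hp]
    have h2 : g₂ p = 0 := by simp [hg₂, hηout p hp]
    simp [hHdef, hH₁, hH₂, h1, h2]
  have hHz : ∀ p, H p 2 = p 2 := fun p => by simp [hHdef, hH₁, hH₂]
  -- The first shear moves `x` by at most `M`; the extra `M` keeps the cutoff of the second shear
  -- equal to `1`.
  set L₁ := max T (T + ℓ + M) with hL₁
  have hHright : ∀ p : R3, L₁ ≤ p 0 → H p = Φ p := by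
    intro p hp
    have hp1 : T ≤ p 0 := (le_max_left _ _).trans hp
    have hp2 : T + ℓ + M ≤ p 0 := (le_max_right _ _).trans hp
    have h1 : g₁ p = τ p := by
      simp only [hg₁]; rw [hχ1 _ (by linarith), one_mul]
    have h2 : H₁ p = p + τ p • stdVec 0 := by simp only [hH₁, h1]
    have h3 : g₂ (H₁ p) = η p := by
      rw [h2]
      simp only [hg₂, hη, hRline]
      rw [hχ1]
      · simp
      · simp; linarith [(abs_le.1 (hM p)).1]
    have h4 := h.chart_right_le (hT (p 1) (p 2)).le hp1
    rw [vec3_eta] at h4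
    rw [← hΦ] at h4
    rw [h4]
    have h5 : H p = p + τ p • stdVec 0 + η p • stdVec 1 := by
      simp only [hHdef, Function.comp, hH₂]
      rw [h3, h2]
    rw [h5]
    have h6 := hR2 p
    apply ext3 <;> simp [hτ, hη, hR] at h6 ⊢
    · ring
    · exact h6.symm
  -- `H` interpolates between the identity on the left and `Φ` on the right, so `H ∘ Φ⁻¹` is the
  -- identity at both ends. It still straightens, since `H` preserves the height.
  refine ⟨H ∘ Ψ, _, hH.comp hΨ.symm, ⟨max (L₁ + M + 1) r, ?_⟩, ?_⟩
  · have hfix : ∀ q, Φ q = q → H q = q → (H ∘ Ψ) q = q := fun q h1 h2 => by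
      have : Ψ q = q := by conv_lhs => rw [← h1]
                           exact hΨ.left_inv q
      simp [this, h2]
    intro q hq
    by_cases hout : r ^ 2 ≤ q 1 ^ 2 + q 2 ^ 2
    · exact hfix q (h.chart_out hout) (hHout q hout)
    have hq := hq.resolve_right hout
    rcases le_total 0 (q 0) with hq0 | hq0
    · rw [abs_of_nonneg hq0] at hq
      obtain ⟨p, rfl⟩ := chart_surjective h hα hF q
      have h1 : (H ∘ Ψ) (Φ p) = H p := by simp [hΨ.left_inv]
      rw [← hΦ, h1]
      refine hHright p ?_
      by_contra hlt
      push Not at hlt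
      have h2 := h.chart_right (p := p) ((le_max_right _ _).trans hq) (t := L₁ - p 0)
        (by linarith)
      have h3 := h.chart_right_le (hT (p 1) (p 2)).le (t := L₁) (le_max_left _ _)
      have h4 : p + (L₁ - p 0) • stdVec 0 = vec3 L₁ (p 1) (p 2) := by
        apply ext3 <;> simp
      rw [h4, h3] at h2
      have h5 := congr_arg (fun x : R3 => x 0) h2
      simp only [PiLp.add_apply, PiLp.smul_apply, stdVec_apply, if_true, smul_eq_mul,
        mul_one] at h5
      have h6 := (abs_le.1 (hM p)).2
      simp only [hτ, hR, hΦ] at h6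
      have h7 := (le_max_left (L₁ + M + 1) r).trans hq
      linarith
    · rw [abs_of_nonpos hq0] at hq
      have h1 : q 0 ≤ -r := by linarith [(le_max_right (L₁ + M + 1) r).trans hq]
      exact hfix q (h.chart_left h1) (hHleft q (by linarith [h.pos]))
  · intro q v
    obtain ⟨p, rfl⟩ := chart_surjective h hα hF q
    obtain ⟨w, rfl⟩ := (LinearMap.injective_iff_surjective
      (f := (fderiv ℝ Φ p).toLinearMap)).1 (h.injective_fderiv_chart p) v
    have h1 : fderiv ℝ (H ∘ Ψ) (Φ p) (fderiv ℝ Φ p w) = fderiv ℝ H p w := by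
      have h2 := ((hH.comp hΨ.symm).differentiable (Φ p)).hasFDerivAt.comp p
        (h.chart_differentiable p).hasFDerivAt
      have h3 : HasFDerivAt ((H ∘ Ψ) ∘ Φ) (fderiv ℝ H p) p :=
        (hH.differentiable p).hasFDerivAt.congr_of_eventuallyEq
          (Filter.Eventually.of_forall fun x => by simp [hΨ.left_inv])
      exact congr($(h2.unique h3) w)
    have h2 : fderiv ℝ H p w 2 = w 2 := by
      have h3 : HasFDerivAt (fun x => H x 2) _ p := (hH.differentiable p).hasFDerivAt.coord 2
      have h4 : HasFDerivAt (fun x : R3 => H x 2) _ p :=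
        (HasFDerivAt.coord (hasFDerivAt_id p) 2).congr_of_eventuallyEq
          (Filter.Eventually.of_forall hHz)
      exact congr($(h3.unique h4) w)
    have h3 := form_fderiv_chart h hα p w
    rw [pullCoeff_eq_zero h hα hF, mul_zero, zero_add] at h3
    have h4 : fderiv ℝ (H ∘ Ψ) (flowChart r Θ p) ((fderiv ℝ Φ p).toLinearMap w) 2 = w 2 := by
      rw [← h2, ← h1]; rfl
    have h5 : α (flowChart r Θ p) ((fderiv ℝ Φ p).toLinearMap w)
        = w 2 * pullCoeff α (flowChart r Θ) (stdVec 2) p := h3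
    rw [h4, h5, mul_eq_zero, or_iff_left (pullCoeff_pos h hα hF p).ne']

end Straighten

/-! ### Parallel transport along lines in the plane field -/

section Transport

open scoped NNReal

lemma exists_lipschitz_bound {E : Type} [NormedAddCommGroup E] [NormedSpace ℝ E] {V : E → E} {c : E}
    (hV : ContDiff ℝ ∞ V) (hc : HasCompactSupport fun x => V x - c) :
    (∃ K : ℝ≥0, LipschitzWith K V) ∧ ∃ L : ℝ≥0, ∀ x, ‖V x‖ ≤ L := by
  have hs : ContDiff ℝ ∞ fun x => V x - c := hV.sub contDiff_const
  obtain ⟨K, hK⟩ := hs.lipschitzWith_of_hasCompactSupport hc (by simp)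
  obtain ⟨M, hM⟩ := hc.exists_bound_of_continuous hs.continuous
  refine ⟨⟨K, LipschitzWith.of_dist_le_mul fun x y => ?_⟩, Real.toNNReal (M + ‖c‖), fun x => ?_⟩
  · simpa [dist_eq_norm] using hK.dist_le_mul x y
  · refine le_trans ?_ (Real.le_coe_toNNReal _)
    calc ‖V x‖ = ‖(V x - c) + c‖ := by simp
      _ ≤ M + ‖c‖ := (norm_add_le _ _).trans (by gcongr; exact hM x)

lemma exists_lipschitz_bound_of_const {r : ℝ} {V : R3 → R3} {c : R3} (hV : ContDiff ℝ ∞ V)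
    (hc : ∀ p, r ≤ ‖p‖ → V p = c) :
    (∃ K : ℝ≥0, LipschitzWith K V) ∧ ∃ L : ℝ≥0, ∀ x, ‖V x‖ ≤ L := by
  refine exists_lipschitz_bound (c := c) hV
    (HasCompactSupport.intro (isCompact_closedBall (0 : R3) r) fun x hx => ?_)
  rw [mem_closedBall_zero_iff, not_le] at hx
  simp [hc x hx.le]

lemma exists_flow_of_const {r : ℝ} {V : R3 → R3} {c : R3} (hV : ContDiff ℝ ∞ V)
    (hc : ∀ p, r ≤ ‖p‖ → V p = c) : ∃ Θ, IsFlow V Θ := by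
  obtain ⟨⟨K, hK⟩, L, hL⟩ := exists_lipschitz_bound_of_const hV hc
  exact exists_isFlow hK hL

lemma eq_of_hasDerivAt_zero {f : ℝ → ℝ} (hf : ∀ t, HasDerivAt f 0 t) (s t : ℝ) : f s = f t :=
  is_const_of_deriv_eq_zero (fun t => (hf t).differentiableAt) (fun t => (hf t).deriv) s t

lemma fderiv_eq_zero_of_const {r : ℝ} {N : R3 → R3} {c : R3}
    (hc : ∀ p, r ≤ ‖p‖ → N p = c) {p : R3} (hp : r < ‖p‖) : fderiv ℝ N p = 0 := by
  have : N =ᶠ[𝓝 p] fun _ => c := by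
    filter_upwards [continuous_norm.continuousAt.eventually (lt_mem_nhds hp)] with q hq
      using hc q hq.le
  rw [this.fderiv_eq]; simp

/-- Parallel transport of `∂/∂x` along the lines parallel to the `x`-axis in the orthogonal plane
field of `N`. -/
lemma exists_transport {r₀ r : ℝ} (hr : 0 < r) (hr₀ : r₀ ≤ r) {N : R3 → R3} (hN : ContDiff ℝ ∞ N)
    (hN1 : ∀ p, ‖N p‖ = 1) (hNo : ∀ p, r₀ ≤ ‖p‖ → N p = stdVec 2) :
    ∃ X : R3 → R3, ContDiff ℝ ∞ X ∧ (∀ p, ‖X p‖ = 1) ∧ (∀ p, inner ℝ (X p) (N p) = 0) ∧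
      (∀ p, p 0 = -r → X p = stdVec 0) ∧
      ∀ p (t : ℝ), 0 ≤ t → (∀ s ∈ Icc 0 t, r₀ < ‖p + s • stdVec 0‖) → X (p + t • stdVec 0) = X p := by
  set N' : R3 → R3 := fun p => fderiv ℝ N p (stdVec 0) with hN'
  have hN's : ContDiff ℝ ∞ N' := (hN.fderiv_right (m := ∞) (by simp)).clm_apply contDiff_const
  let χ : ContDiffBump (0 : R3) := ⟨2, 3, by norm_num, by norm_num⟩
  -- Without the cutoff this is the infinitesimal rotation carrying `N` along, so it preserves
  -- length and orthogonality to `N`. The cutoff `χ` makes the field standard outside a compact set,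
  -- and it is `1` on the unit vectors that occur.
  set W : R3 × R3 → R3 := fun q =>
    χ q.2 • (inner ℝ q.2 (N q.1) • N' q.1 - inner ℝ (N' q.1) q.2 • N q.1) with hW
  have hWs : ContDiff ℝ ∞ W := by
    have h1 : ContDiff ℝ ∞ fun q : R3 × R3 => N q.1 := hN.comp contDiff_fst
    have h2 : ContDiff ℝ ∞ fun q : R3 × R3 => N' q.1 := hN's.comp contDiff_fst
    have h3 : ContDiff ℝ ∞ fun q : R3 × R3 => χ q.2 := χ.contDiff.comp contDiff_snd
    exact h3.smul (((contDiff_snd.inner ℝ h1).smul h2).sub ((h2.inner ℝ contDiff_snd).smul h1))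
  set V : R3 × R3 → R3 × R3 := fun q => (stdVec 0, W q) with hV
  have hVs : ContDiff ℝ ∞ V := contDiff_const.prodMk hWs
  have hVc : HasCompactSupport fun q => V q - (stdVec 0, 0) := by
    refine HasCompactSupport.intro ((isCompact_closedBall (0 : R3) r₀).prod
      (isCompact_closedBall (0 : R3) 3)) fun q hq => ?_
    have : W q = 0 := by
      rw [mem_prod, not_and_or, mem_closedBall_zero_iff, not_le, mem_closedBall_zero_iff,
        not_le] at hq
      rcases hq with hq | hq
      · simp [hW, hN', fderiv_eq_zero_of_const hNo hq]
      · have : χ q.2 = 0 := χ.zero_of_le_dist (by simpa using hq.le)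
        simp [hW, this]
    simp [hV, this]
  obtain ⟨⟨K, hK⟩, L, hL⟩ := exists_lipschitz_bound hVs hVc
  obtain ⟨Θ, hΘ⟩ := exists_isFlow hK hL
  have hfst' : ∀ q t, HasDerivAt (fun t => (Θ t q).1) (stdVec 0) t := fun q t =>
    (ContinuousLinearMap.fst ℝ R3 R3).hasFDerivAt.comp_hasDerivAt t (hΘ.hasDerivAt q t)
  have hfst : ∀ q t, (Θ t q).1 = q.1 + t • stdVec 0 := by
    intro q t
    have h1 : ∀ t, HasDerivAt (fun t => (Θ t q).1 - t • stdVec 0) (0 : R3) t := fun t => by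
      simpa using (hfst' q t).fun_sub ((hasDerivAt_id t).smul_const (stdVec 0))
    have h3 := is_const_of_deriv_eq_zero (fun t => (h1 t).differentiableAt)
      (fun t => (h1 t).deriv) t 0
    simp only [hΘ.zero, zero_smul, sub_zero] at h3
    rw [← h3]; simp
  have hsnd : ∀ q t, HasDerivAt (fun t => (Θ t q).2) (W (Θ t q)) t := fun q t =>
    (ContinuousLinearMap.snd ℝ R3 R3).hasFDerivAt.comp_hasDerivAt t (hΘ.hasDerivAt q t)
  have hNN' : ∀ p, inner ℝ (N p) (N' p) = 0 := by
    intro p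
    have h1 : HasDerivAt (fun t : ℝ => p + t • stdVec 0) (stdVec 0) 0 := by
      simpa using ((hasDerivAt_id (0 : ℝ)).smul_const (stdVec 0)).const_add p
    have h2 : HasFDerivAt N (fderiv ℝ N p) (p + (0 : ℝ) • stdVec 0) := by
      simpa using (hN.differentiable (by simp) p).hasFDerivAt
    have h3 := h2.comp_hasDerivAt (0 : ℝ) h1
    have h4 := h3.inner ℝ h3
    have h5 : HasDerivAt (fun t : ℝ => inner ℝ ((N ∘ fun t : ℝ => p + t • stdVec 0) t)
        ((N ∘ fun t : ℝ => p + t • stdVec 0) t)) (0 : ℝ) 0 := by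
      refine (hasDerivAt_const (0 : ℝ) (1 : ℝ)).congr_of_eventuallyEq
        (Filter.Eventually.of_forall fun t => ?_)
      simp [hN1]
    have h6 := h4.unique h5
    simp only [Function.comp, zero_smul, add_zero] at h6
    rw [real_inner_comm (N p)] at h6
    simp only [hN']
    linarith
  have hNline : ∀ q t, HasDerivAt (fun t => N (Θ t q).1) (N' (Θ t q).1) t := by
    intro q t
    exact (hN.differentiable (by simp) _).hasFDerivAt.comp_hasDerivAt t (hfst' q t)
  set b : R3 → R3 × R3 := fun p => (vec3 (-r) (p 1) (p 2), stdVec 0) with hb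
  have hnorm : ∀ p t, ‖(Θ t (b p)).2‖ = 1 := by
    intro p t
    have h1 : ∀ t, HasDerivAt (fun t => inner ℝ (Θ t (b p)).2 (Θ t (b p)).2) (0 : ℝ) t := by
      intro t
      refine ((hsnd (b p) t).inner ℝ (hsnd (b p) t)).congr_deriv ?_
      simp only [hW, inner_smul_left, inner_smul_right, inner_sub_left, inner_sub_right]
      rw [real_inner_comm (N (Θ t (b p)).1) (Θ t (b p)).2,
        real_inner_comm (N' (Θ t (b p)).1) (Θ t (b p)).2]
      simp [mul_comm]
    have h2 := eq_of_hasDerivAt_zero h1 t 0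
    rw [hΘ.zero, real_inner_self_eq_norm_sq, real_inner_self_eq_norm_sq] at h2
    have h3 : ‖(b p).2‖ = 1 := by simp [hb, stdVec]
    rw [h3] at h2
    nlinarith [norm_nonneg (Θ t (b p)).2]
  have hχ : ∀ p t, χ (Θ t (b p)).2 = 1 := fun p t =>
    χ.one_of_mem_closedBall (by rw [mem_closedBall_zero_iff, hnorm]; norm_num)
  have horth : ∀ p t, inner ℝ (Θ t (b p)).2 (N (Θ t (b p)).1) = 0 := by
    intro p t
    have h1 : ∀ t, HasDerivAt (fun t => inner ℝ (Θ t (b p)).2 (N (Θ t (b p)).1)) (0 : ℝ) t := by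
      intro t
      refine ((hsnd (b p) t).inner ℝ (hNline (b p) t)).congr_deriv ?_
      simp only [hW, hχ, one_smul, inner_smul_left, inner_sub_left]
      rw [real_inner_comm (N (Θ t (b p)).1) (N' (Θ t (b p)).1), hNN', real_inner_self_eq_norm_sq,
        hN1, real_inner_comm (N' (Θ t (b p)).1) (Θ t (b p)).2]
      simp
    rw [eq_of_hasDerivAt_zero h1 t 0, hΘ.zero, hNo _ (le_norm_of_le_abs 0 (by
      simpa [hb, abs_of_pos hr] using hr₀))]
    simp [hb, inner_eq]
  refine ⟨fun p => (Θ (p 0 + r) (b p)).2, ?_, fun p => hnorm p _, fun p => ?_, fun p hp => ?_,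
    fun p t ht hs => ?_⟩
  · have hbs : ContDiff ℝ ∞ b :=
      (contDiff_vec3 contDiff_const (contDiff_coord 1) (contDiff_coord 2)).prodMk contDiff_const
    exact contDiff_snd.comp ((hΘ.contDiff hVs hK).comp
      (((contDiff_coord 0).add contDiff_const).prodMk hbs))
  · have h1 := horth p (p 0 + r)
    rw [hfst] at h1
    have h2 : (b p).1 + (p 0 + r) • stdVec 0 = p := by apply ext3 <;> simp [hb]
    rwa [h2] at h1
  · simp [hp, hΘ.zero, hb]
  · have h1 : b (p + t • stdVec 0) = b p := by simp [hb]
    have h2 : (p + t • stdVec 0) 0 + r = t + (p 0 + r) := by simp; ring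
    dsimp only
    rw [h1, h2, hΘ.add hK]
    set S := Θ (p 0 + r) (b p) with hS
    have hS1 : S.1 = p := by
      rw [hS, hfst]; apply ext3 <;> simp [hb]
    have h3 := hΘ.eq_of_hasDerivAt_of_nonneg hK (c := fun s => (p + s • stdVec 0, S.2)) ht
      (fun s hs' => by
        have h4 : W (p + s • stdVec 0, S.2) = 0 := by
          simp [hW, hN', fderiv_eq_zero_of_const hNo (hs s hs')]
        simp only [hV, h4]
        refine HasDerivAt.prodMk ?_ (hasDerivAt_const _ _)
        simpa using ((hasDerivAt_id s).smul_const (stdVec 0)).const_add p)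
    simp only [zero_smul, add_zero] at h3
    have h4 : (p, S.2) = S := by rw [← hS1]
    rw [h4] at h3
    rw [← h3]

end Transport

/-! ### Lifting a circle-valued map to an angle -/

section Angle

lemma hasDerivAt_add_smul (p v : R3) (t : ℝ) : HasDerivAt (fun t : ℝ => p + t • v) v t := by
  simpa using ((hasDerivAt_id t).smul_const v).const_add p

/-- The complement of the cylinder is connected: at most three half-spaces disjoint from the
cylinder lead from `p` to `q`, in the direction of `p`, then up or down, then towards negative `y`.
-/
lemma eq_of_fderiv_eq_zero_outside_cylinder {r : ℝ} (hr : 0 < r) {θ : R3 → ℝ} (hθ : Differentiable ℝ θ)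
    (hd : ∀ p : R3, r ^ 2 < p 1 ^ 2 + p 2 ^ 2 → fderiv ℝ θ p = 0) {p q : R3}
    (hp : r ^ 2 < p 1 ^ 2 + p 2 ^ 2) (hq : q 1 < -r) : θ p = θ q := by
  have key : ∀ a b : ℝ, a ^ 2 + b ^ 2 = 1 → ∀ x y : R3, r < a * x 1 + b * x 2 →
      r < a * y 1 + b * y 2 → θ x = θ y := by
    intro a b hab x y hx hy
    set S : Set R3 := {w | r < a * w 1 + b * w 2} with hS
    have hconv : Convex ℝ S := by
      intro u hu v hv s t hs ht hst
      simp only [hS, mem_ofPred_eq, PiLp.add_apply, PiLp.smul_apply, smul_eq_mul] at hu hv ⊢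
      have : a * (s * u 1 + t * v 1) + b * (s * u 2 + t * v 2)
          = s * (a * u 1 + b * u 2) + t * (a * v 1 + b * v 2) := by ring
      rw [this]
      rcases hs.eq_or_lt with h0 | h0
      · rw [← h0] at hst ⊢
        have : t = 1 := by linarith
        rw [this]; linarith
      · have h1 := mul_lt_mul_of_pos_left hu h0
        have h2 := mul_le_mul_of_nonneg_left hv.le ht
        have h3 : r = s * r + t * r := by rw [← add_mul, hst, one_mul]
        linarith
    have hopen : IsOpen S := isOpen_lt continuous_const (by fun_prop)
    refine hopen.is_const_of_fderiv_eq_zero hconv.isPreconnected hθ.differentiableOn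
      (fun w hw => hd w ?_) hx hy
    simp only [hS, mem_ofPred_eq] at hw
    have h1 : r ^ 2 < (a * w 1 + b * w 2) ^ 2 := by
      exact pow_lt_pow_left₀ hw hr.le (by norm_num)
    have h2 : (a * w 1 + b * w 2) ^ 2 + (a * w 2 - b * w 1) ^ 2
        = (a ^ 2 + b ^ 2) * (w 1 ^ 2 + w 2 ^ 2) := by ring
    rw [hab, one_mul] at h2
    nlinarith [sq_nonneg (a * w 2 - b * w 1)]
  set R := r + 1 with hR
  set ρ := Real.sqrt (p 1 ^ 2 + p 2 ^ 2) with hρ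
  have hρ2 : ρ ^ 2 = p 1 ^ 2 + p 2 ^ 2 := Real.sq_sqrt (by positivity)
  have hρ0 : r < ρ := Real.lt_sqrt_of_sq_lt hp
  have hρp : 0 < ρ := hr.trans hρ0
  set a := p 1 / ρ with ha
  set b := p 2 / ρ with hb
  have hab : a ^ 2 + b ^ 2 = 1 := by
    rw [ha, hb, div_pow, div_pow, ← add_div, ← hρ2, div_self (by positivity)]
  have hpab : r < a * p 1 + b * p 2 := by
    have : a * p 1 + b * p 2 = ρ := by
      rw [ha, hb]; field_simp; linarith
    rwa [this]
  have hmain : ∀ ε : ℝ, ε ^ 2 = 1 → 0 ≤ ε * b → θ p = θ q := by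
    intro ε hε hb
    have h1 := key a b hab p (vec3 0 (R * a) (R * b + ε * R)) hpab (by
      simp only [vec3_one, vec3_two]
      have : a * (R * a) + b * (R * b + ε * R) = R * (a ^ 2 + b ^ 2) + R * (ε * b) := by ring
      rw [this, hab]
      nlinarith)
    have h2 := key 0 ε (by simpa using hε) (vec3 0 (R * a) (R * b + ε * R)) (vec3 0 (-R) (ε * R))
      (by
        simp only [vec3_one, vec3_two]
        have : 0 * (R * a) + ε * (R * b + ε * R) = R * (ε * b) + ε ^ 2 * R := by ring
        rw [this, hε]
        nlinarith)
      (by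
        simp only [vec3_one, vec3_two]
        have : 0 * (-R) + ε * (ε * R) = ε ^ 2 * R := by ring
        rw [this, hε]; linarith)
    have h3 := key (-1) 0 (by norm_num) (vec3 0 (-R) (ε * R)) q (by simp [hR]) (by linarith)
    rw [h1, h2, h3]
  rcases le_total 0 b with h0 | h0
  · exact hmain 1 (by norm_num) (by simpa using h0)
  · exact hmain (-1) (by norm_num) (by linarith)

/-- A smooth map from the `yz`-plane to the circle which is trivial outside a disc lifts to a smooth
angle function. -/
lemma exists_angle {r : ℝ} (hr : 0 < r) {c s : R3 → ℝ} (hc : ContDiff ℝ ∞ c) (hs : ContDiff ℝ ∞ s)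
    (hcl : ∀ p : R3, c (vec3 0 (p 1) (p 2)) = c p) (hsl : ∀ p : R3, s (vec3 0 (p 1) (p 2)) = s p)
    (hcs : ∀ p, c p ^ 2 + s p ^ 2 = 1)
    (hout : ∀ p : R3, r ^ 2 ≤ p 1 ^ 2 + p 2 ^ 2 → c p = 1 ∧ s p = 0) :
    ∃ θ : R3 → ℝ, ContDiff ℝ ∞ θ ∧ (∀ p, Real.cos (θ p) = c p) ∧ (∀ p, Real.sin (θ p) = s p) ∧
      ∀ p : R3, r ^ 2 < p 1 ^ 2 + p 2 ^ 2 → θ p = 0 := by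
  -- The angular speed in the `y`-direction. The angle is its integral in `y`, realized as a
  -- coordinate of the flow of `(κ, 1, 0)` so that smoothness comes from the flow theorem.
  set κ : R3 → ℝ := fun p => c p * fderiv ℝ s p (stdVec 1) - s p * fderiv ℝ c p (stdVec 1) with hκ
  have hκs : ContDiff ℝ ∞ κ :=
    (hc.mul ((hs.fderiv_right (m := ∞) (by simp)).clm_apply contDiff_const)).sub
      (hs.mul ((hc.fderiv_right (m := ∞) (by simp)).clm_apply contDiff_const))
  have hκout : ∀ p : R3, r ^ 2 < p 1 ^ 2 + p 2 ^ 2 → κ p = 0 := by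
    intro p hp
    have hev : ∀ᶠ q : R3 in 𝓝 p, r ^ 2 < q 1 ^ 2 + q 2 ^ 2 :=
      (show Continuous fun q : R3 => q 1 ^ 2 + q 2 ^ 2 by fun_prop).continuousAt.eventually
        (lt_mem_nhds hp)
    have h1 : s =ᶠ[𝓝 p] fun _ => 0 := hev.mono fun q hq => (hout q hq.le).2
    simp [hκ, h1.fderiv_eq, (hout p hp.le).2]
  let χ : ContDiffBump (0 : R3) := ⟨r, r + 1, hr, by linarith⟩
  set U' : R3 → R3 := fun p => vec3 (χ p * κ p) 1 0 with hU'
  have hU's : ContDiff ℝ ∞ U' := contDiff_vec3 (χ.contDiff.mul hκs) contDiff_const contDiff_const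
  obtain ⟨⟨K, hK⟩, L, hL⟩ := exists_lipschitz_bound_of_const (r := r + 1) (c := vec3 0 1 0) hU's
    fun p hp => by
      have : χ p = 0 := χ.zero_of_le_dist (by simpa using hp)
      simp [hU', this]
  set π : R3 → R3 := fun p => vec3 0 (p 1) (p 2) with hπ
  have hπs : ContDiff ℝ ∞ π := contDiff_vec3 contDiff_const (contDiff_coord 1) (contDiff_coord 2)
  have hπL : LipschitzWith 1 π := LipschitzWith.of_dist_le_mul fun p q => by
    rw [dist_eq_norm, dist_eq_norm, NNReal.coe_one, one_mul]
    refine le_of_sq_le_sq ?_ (norm_nonneg _)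
    rw [sq_norm_eq, sq_norm_eq]
    simp [hπ]
    positivity
  obtain ⟨Θ, hΘ⟩ := exists_isFlow (V := U' ∘ π) (hK.comp hπL) (fun p => hL (π p))
  have hΘs := hΘ.contDiff (hU's.comp hπs) (hK.comp hπL)
  set θ : R3 → ℝ := fun p => Θ (p 1 + (r + 1)) (vec3 0 (-(r + 1)) (p 2)) 0 with hθ
  have hθs : ContDiff ℝ ∞ θ := (contDiff_coord 0).comp (hΘs.comp
    (((contDiff_coord 1).add contDiff_const).prodMk
      (contDiff_vec3 contDiff_const contDiff_const (contDiff_coord 2))))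
  have hχκ : ∀ y z : ℝ, χ (vec3 0 y z) * κ (vec3 0 y z) = κ (vec3 0 y z) := by
    intro y z
    rcases le_or_gt (y ^ 2 + z ^ 2) (r ^ 2) with h1 | h1
    · rw [χ.one_of_mem_closedBall, one_mul]
      rw [mem_closedBall_zero_iff]
      refine le_of_sq_le_sq ?_ hr.le
      rw [sq_norm_eq]; simpa using h1
    · rw [hκout _ (by simpa using h1), mul_zero]
  have hcoord : ∀ q t, Θ t q 1 = q 1 + t ∧ Θ t q 2 = q 2 := by
    intro q t
    constructor
    · have h1 : ∀ t, HasDerivAt (fun t => Θ t q 1 - t) 0 t := fun t => by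
        simpa [hU'] using ((hΘ.hasDerivAt q t).coord 1).fun_sub (hasDerivAt_id' t)
      have h2 := eq_of_hasDerivAt_zero h1 t 0
      rw [hΘ.zero] at h2
      linarith
    · have h1 : ∀ t, HasDerivAt (fun t => Θ t q 2) 0 t := fun t => by
        simpa [hU'] using (hΘ.hasDerivAt q t).coord 2
      have h2 := eq_of_hasDerivAt_zero h1 t 0
      rwa [hΘ.zero] at h2
  have hf : ∀ z t, HasDerivAt (fun t => θ (vec3 0 t z)) (κ (vec3 0 t z)) t := by
    intro z t
    have h1 := ((hΘ.hasDerivAt (vec3 0 (-(r + 1)) z) (t + (r + 1))).coord 0).comp t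
      ((hasDerivAt_id t).add_const (r + 1))
    refine h1.congr_deriv ?_
    obtain ⟨h2, h3⟩ := hcoord (vec3 0 (-(r + 1)) z) (t + (r + 1))
    have h4 : -(r + 1) + (t + (r + 1)) = t := by ring
    simp only [hU', hπ, Function.comp, h2, h3, vec3_zero, vec3_one, vec3_two, h4, hχκ, mul_one]
  have hline : ∀ g : R3 → ℝ, ContDiff ℝ ∞ g → ∀ z t, HasDerivAt (fun t => g (vec3 0 t z))
      (fderiv ℝ g (vec3 0 t z) (stdVec 1)) t := by
    intro g hg z t
    have h1 : HasDerivAt (fun t => vec3 0 t z) (stdVec 1) t := by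
      have h1 : (fun t => vec3 0 t z) = fun t : ℝ => vec3 0 0 z + t • stdVec 1 := by
        ext1 s; apply ext3 <;> simp
      rw [h1]
      exact hasDerivAt_add_smul _ _ _
    exact (hg.differentiable (by simp) _).hasFDerivAt.comp_hasDerivAt t h1
  have hlift : ∀ p, c p = Real.cos (θ p) ∧ s p = Real.sin (θ p) := by
    intro p
    set z := p 2 with hz
    have hstart : c (vec3 0 (-(r + 1)) z) = 1 ∧ s (vec3 0 (-(r + 1)) z) = 0 :=
      hout _ (by simp; nlinarith [sq_nonneg z])
    have hθ0 : θ (vec3 0 (-(r + 1)) z) = 0 := by simp [hθ, hΘ.zero]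
    have hrel : ∀ t, fderiv ℝ c (vec3 0 t z) (stdVec 1) = -s (vec3 0 t z) * κ (vec3 0 t z) ∧
        fderiv ℝ s (vec3 0 t z) (stdVec 1) = c (vec3 0 t z) * κ (vec3 0 t z) := by
      intro t
      have h1 : HasDerivAt (fun t => c (vec3 0 t z) ^ 2 + s (vec3 0 t z) ^ 2) 0 t := by
        simp only [hcs]; exact hasDerivAt_const _ _
      have h2 := (((hline c hc z t).fun_pow 2).fun_add ((hline s hs z t).fun_pow 2)).unique h1
      have h3 := hcs (vec3 0 t z)
      simp only [hκ]
      simp at h2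
      generalize c (vec3 0 t z) = C at *
      generalize s (vec3 0 t z) = S at *
      generalize fderiv ℝ c (vec3 0 t z) (stdVec 1) = dC at *
      generalize fderiv ℝ s (vec3 0 t z) (stdVec 1) = dS at *
      constructor
      · linear_combination (C / 2) * h2 - dC * h3
      · linear_combination (S / 2) * h2 - dS * h3
    have h1 : ∀ t, HasDerivAt (fun t => c (vec3 0 t z) * Real.cos (θ (vec3 0 t z))
        + s (vec3 0 t z) * Real.sin (θ (vec3 0 t z))) 0 t := fun t => by
      refine (((hline c hc z t).fun_mul (hf z t).cos).fun_add
        ((hline s hs z t).fun_mul (hf z t).sin)).congr_deriv ?_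
      rw [(hrel t).1, (hrel t).2]; ring
    have h2 : ∀ t, HasDerivAt (fun t => s (vec3 0 t z) * Real.cos (θ (vec3 0 t z))
        - c (vec3 0 t z) * Real.sin (θ (vec3 0 t z))) 0 t := fun t => by
      refine (((hline s hs z t).fun_mul (hf z t).cos).fun_sub
        ((hline c hc z t).fun_mul (hf z t).sin)).congr_deriv ?_
      rw [(hrel t).1, (hrel t).2]; ring
    have h3 := eq_of_hasDerivAt_zero h1 (p 1) (-(r + 1))
    have h4 := eq_of_hasDerivAt_zero h2 (p 1) (-(r + 1))
    have h5 : θ (vec3 0 (p 1) z) = θ p := by simp [hθ, hz]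
    have h7 : c (vec3 0 (p 1) z) = c p := hcl p
    have h8 : s (vec3 0 (p 1) z) = s p := hsl p
    simp only [hstart.1, hstart.2, hθ0, h5, h7, h8] at h3 h4
    simp only [Real.cos_zero, Real.sin_zero, mul_one, mul_zero, add_zero, sub_zero] at h3 h4
    have h6 := Real.sin_sq_add_cos_sq (θ p)
    constructor
    · linear_combination Real.cos (θ p) * h3 - Real.sin (θ p) * h4 - c p * h6
    · linear_combination Real.sin (θ p) * h3 + Real.cos (θ p) * h4 - s p * h6
  refine ⟨θ, hθs, fun p => (hlift p).1.symm, fun p => (hlift p).2.symm, fun p hp => ?_⟩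
  have hdiff : Differentiable ℝ θ := hθs.differentiable (by simp)
  -- Outside the disc `sin θ = 0` and `cos θ = 1`, so differentiating the sine kills `dθ`.
  have hd : ∀ p : R3, r ^ 2 < p 1 ^ 2 + p 2 ^ 2 → fderiv ℝ θ p = 0 := by
    intro p hp
    have hev : ∀ᶠ q : R3 in 𝓝 p, r ^ 2 < q 1 ^ 2 + q 2 ^ 2 :=
      (show Continuous fun q : R3 => q 1 ^ 2 + q 2 ^ 2 by fun_prop).continuousAt.eventually
        (lt_mem_nhds hp)
    have h1 := (hdiff p).hasFDerivAt.sin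
    have h2 : HasFDerivAt (fun q => Real.sin (θ q)) (0 : R3 →L[ℝ] ℝ) p :=
      (hasFDerivAt_const (0 : ℝ) p).congr_of_eventuallyEq
        (hev.mono fun q hq => by dsimp only; rw [← (hlift q).2, (hout q hq.le).2])
    have h3 := h1.unique h2
    rwa [← (hlift p).1, (hout p hp.le).1, one_smul] at h3
  rw [eq_of_fderiv_eq_zero_outside_cylinder hr hdiff hd hp (q := vec3 0 (-(r + 1)) 0) (by simp)]
  simp [hθ, hΘ.zero]

end Angle

/-! ### A tangent field that is standard outside a ball, and its frame -/

section FrameConstruction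

variable {r₀ r : ℝ} {N : R3 → R3}

lemma lt_norm_add_smul {p : R3} {a t : ℝ} (hp : a < ‖p‖) (ht : 0 ≤ t * (t + 2 * p 0)) :
    a < ‖p + t • stdVec 0‖ := by
  refine hp.trans_le (le_of_sq_le_sq ?_ (norm_nonneg _))
  rw [sq_norm_eq, sq_norm_eq]
  simp
  nlinarith

/-- A smooth map from 3-space to the unit sphere which is constant outside a ball admits a smooth unit
orthogonal field which is constant outside a slightly larger ball. -/
theorem exists_orthogonal_field (h0 : 0 < r₀) (hr : r₀ < r) (hN : ContDiff ℝ ∞ N)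
    (hN1 : ∀ p, ‖N p‖ = 1) (hNo : ∀ p, r₀ ≤ ‖p‖ → N p = stdVec 2) :
    ∃ X : R3 → R3, ContDiff ℝ ∞ X ∧ (∀ p, ‖X p‖ = 1) ∧ (∀ p, inner ℝ (N p) (X p) = 0) ∧
      ∀ p, r ≤ ‖p‖ → X p = stdVec 0 := by
  have hr0 : 0 < r := h0.trans hr
  obtain ⟨X, hX, hX1, hXN, hXl, hXt⟩ := exists_transport hr0 hr.le hN hN1 hNo
  have hright : ∀ p : R3, 0 ≤ p 0 → r₀ < ‖p‖ → ∀ t : ℝ, 0 ≤ t → X (p + t • stdVec 0) = X p :=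
    fun p hp0 hp t ht => hXt p t ht fun s hs => lt_norm_add_smul hp
      (mul_nonneg hs.1 (by linarith [hs.1]))
  have hleft : ∀ p : R3, p 0 ≤ 0 → r₀ < ‖p‖ → X p = stdVec 0 := by
    intro p hp0 hp
    rcases le_total (-r) (p 0) with h1 | h1
    · have h2 := hXt (p + (-r - p 0) • stdVec 0) (r + p 0) (by linarith) fun s hs => by
        rw [add_assoc, ← add_smul]
        exact lt_norm_add_smul hp (mul_nonneg_of_nonpos_of_nonpos (by linarith [hs.2])
          (by linarith [hs.1, hs.2]))
      have h3 : p + (-r - p 0) • stdVec 0 + (r + p 0) • stdVec 0 = p := by module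
      rw [h3] at h2
      rw [h2]
      exact hXl _ (by simp)
    · rw [← hXt p (-r - p 0) (by linarith) fun s hs => ?_]
      · exact hXl _ (by simp)
      · refine hr.trans_le (le_norm_of_le_abs 0 ?_)
        simp only [PiLp.add_apply, PiLp.smul_apply, stdVec_apply, if_true, smul_eq_mul, mul_one]
        rw [abs_of_nonpos (by linarith [hs.2])]
        linarith [hs.2]
  have hshift : ∀ p : R3, 0 ≤ p 0 → r₀ < ‖p‖ → X (vec3 r (p 1) (p 2)) = X p := by
    intro p hp0 hp
    have h1 := hright p hp0 hp r hr0.le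
    have h2 := hright (vec3 r (p 1) (p 2)) hr0.le
      (hr.trans_le (le_norm_of_le_abs 0 (by simp [abs_of_pos hr0]))) (p 0) hp0
    rw [← h1, ← h2]
    congr 1
    apply ext3 <;> simp [add_comm]
  have hoside : ∀ p : R3, r₀ ^ 2 < p 1 ^ 2 + p 2 ^ 2 → X p = stdVec 0 := by
    have hlt : ∀ p : R3, r₀ ^ 2 < p 1 ^ 2 + p 2 ^ 2 → r₀ < ‖p‖ := fun p hp => by
      refine lt_of_pow_lt_pow_left₀ 2 (norm_nonneg _) ?_
      rw [sq_norm_eq]; nlinarith [sq_nonneg (p 0)]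
    intro p hp
    rcases le_total (p 0) 0 with h1 | h1
    · exact hleft p h1 (hlt p hp)
    · have h2 := hright (vec3 0 (p 1) (p 2)) le_rfl (hlt _ (by simpa using hp)) (p 0) h1
      rw [hleft (vec3 0 (p 1) (p 2)) le_rfl (hlt _ (by simpa using hp)), vec3_add_smul, zero_add,
        vec3_eta] at h2
      exact h2
  obtain ⟨r₁, hr01, hr1⟩ := exists_between hr
  -- Transport leaves `X = ∂/∂x` except in the shadow of the ball on the right. There it is
  -- horizontal, of unit length and independent of `x`, hence a circle-valued map of the `yz`-plane,
  -- trivial outside a disc.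
  set R : R3 → R3 := fun p => X (vec3 r (p 1) (p 2)) with hR
  have hRs : ContDiff ℝ ∞ R :=
    hX.comp (contDiff_vec3 contDiff_const (contDiff_coord 1) (contDiff_coord 2))
  have hR2 : ∀ p, R p 2 = 0 := by
    intro p
    have h1 := hXN (vec3 r (p 1) (p 2))
    rw [hNo _ (hr.le.trans (le_norm_of_le_abs 0 (by simp [abs_of_pos hr0]))), inner_eq] at h1
    simpa using h1
  have hRout : ∀ p : R3, r₁ ^ 2 ≤ p 1 ^ 2 + p 2 ^ 2 → R p = stdVec 0 := fun p hp =>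
    hoside _ (by simpa using (pow_lt_pow_left₀ hr01 h0.le two_ne_zero).trans_le hp)
  obtain ⟨θ, hθ, hcos, hsin, hθ0⟩ := exists_angle (h0.trans hr01)
    (c := fun p => R p 0) (s := fun p => R p 1) ((contDiff_coord 0).comp hRs)
    ((contDiff_coord 1).comp hRs) (fun p => by simp [hR]) (fun p => by simp [hR])
    (fun p => by
      have h1 := sq_norm_eq (R p)
      rw [hR2, hR, hX1] at h1
      simp only [hR]
      linarith)
    (fun p hp => by simp [hRout p hp])
  -- A point outside the ball of radius `r` and within the cylinder of radius `r₁` has `|x| ≥ δ`. So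
  -- turning `X` about `N` by an angle ramping from `0` to `-θ` over `0 ≤ x ≤ δ` corrects it
  -- everywhere outside that ball.
  set δ := Real.sqrt (r ^ 2 - r₁ ^ 2) with hδ
  have hδ2 : δ ^ 2 = r ^ 2 - r₁ ^ 2 := Real.sq_sqrt (by nlinarith)
  have hδ0 : 0 < δ := Real.sqrt_pos.2 (by nlinarith)
  set χ : R3 → ℝ := fun p => Real.smoothTransition (p 0 / δ) * θ p with hχ
  have hχs : ContDiff ℝ ∞ χ :=
    (Real.smoothTransition.contDiff.comp ((contDiff_coord 0).div_const δ)).mul hθ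
  refine ⟨fun p => Real.cos (χ p) • X p - Real.sin (χ p) • cross3 (N p) (X p), ?_, fun p => ?_,
    fun p => ?_, fun p hp => ?_⟩
  · refine ((Real.contDiff_cos.comp hχs).smul hX).sub ((Real.contDiff_sin.comp hχs).smul
      (contDiff_cross3 hN hX))
  · have h1 := sq_norm_eq (N p)
    have h2 := sq_norm_eq (X p)
    have h3 := hXN p
    have h4 := Real.sin_sq_add_cos_sq (χ p)
    rw [hN1] at h1
    rw [hX1] at h2
    rw [inner_eq] at h3
    have h5 : ‖Real.cos (χ p) • X p - Real.sin (χ p) • cross3 (N p) (X p)‖ ^ 2 = 1 := by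
      rw [sq_norm_eq]
      simp only [PiLp.sub_apply, PiLp.smul_apply, smul_eq_mul, cross3, vec3_zero, vec3_one,
        vec3_two]
      linear_combination -Real.cos (χ p) ^ 2 * h2 - Real.sin (χ p) ^ 2 * (
        (X p 0 ^ 2 + X p 1 ^ 2 + X p 2 ^ 2) * h1 + h2
        + (X p 0 * N p 0 + X p 1 * N p 1 + X p 2 * N p 2) * h3) + h4
    nlinarith [norm_nonneg (Real.cos (χ p) • X p - Real.sin (χ p) • cross3 (N p) (X p))]
  · have h3 := hXN p
    rw [inner_eq] at h3 ⊢
    simp only [PiLp.sub_apply, PiLp.smul_apply, smul_eq_mul, cross3, vec3_zero, vec3_one,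
      vec3_two]
    linear_combination Real.cos (χ p) * h3
  · have hp0 : r₀ < ‖p‖ := hr.trans_le hp
    dsimp only
    by_cases hout : r₁ ^ 2 < p 1 ^ 2 + p 2 ^ 2
    · have h1 : χ p = 0 := by simp [hχ, hθ0 p hout]
      rw [h1, hoside p ((pow_lt_pow_left₀ hr01 h0.le two_ne_zero).trans hout)]
      simp
    have hx : δ ^ 2 ≤ p 0 ^ 2 := by
      have h1 := sq_norm_eq p
      have h2 : r ^ 2 ≤ ‖p‖ ^ 2 := pow_le_pow_left₀ hr0.le hp 2
      linarith
    rcases le_total 0 (p 0) with h1 | h1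
    · have h2 : χ p = θ p := by
        simp only [hχ]
        rw [Real.smoothTransition.one_of_one_le, one_mul]
        rw [one_le_div hδ0]
        exact le_of_sq_le_sq hx h1
      have h3 : X p = R p := (hshift p h1 hp0).symm
      have h4 := Real.sin_sq_add_cos_sq (θ p)
      rw [h2, h3, hNo p hp0.le]
      apply ext3
      · simp [cross3, ← hcos, ← hsin, hR2]
        linarith
      · simp [cross3, ← hcos, ← hsin, hR2]
        ring
      · simp [cross3, hR2]
    · have h2 : χ p = 0 := by
        simp only [hχ]
        rw [Real.smoothTransition.zero_of_nonpos (div_nonpos_of_nonpos_of_nonneg h1 hδ0.le),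
          zero_mul]
      rw [h2, hleft p h1 hp0]
      simp

lemma innerSL_stdVec_two : innerSL ℝ (stdVec 2) = dz := by
  ext v; simp [inner_eq]

/-- A unit normal which is constant outside a ball belongs to an adapted frame. -/
theorem exists_frame {σ : ℝ} (h0 : 0 < r₀) (hr : r₀ < r) (hN : ContDiff ℝ ∞ N)
    (hN1 : ∀ p, ‖N p‖ = 1) (hNo : ∀ p, r₀ ≤ ‖p‖ → N p = stdVec 2) (hσ : σ = 1 ∨ σ = -1)
    (hw : ∀ p, 0 ≤ σ * wedgeCoeff (innerSL ℝ (N p)) (fderiv ℝ (fun q => innerSL ℝ (N q)) p)) :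
    ∃ X Y Θ ΘY ΘN, IsStdFlow r X Θ ∧ IsStdForm r σ X (fun p => innerSL ℝ (N p)) ∧
      IsAdaptedFrame X Y N (fun p => innerSL ℝ (N p)) ΘY ΘN := by
  obtain ⟨X, hX, hX1, hNX, hXo⟩ := exists_orthogonal_field h0 hr hN hN1 hNo
  set Y : R3 → R3 := fun p => cross3 (N p) (X p) with hY
  have hYs : ContDiff ℝ ∞ Y := contDiff_cross3 hN hX
  have hYo : ∀ p, r ≤ ‖p‖ → Y p = cross3 (stdVec 2) (stdVec 0) := fun p hp => by
    simp only [hY, hXo p hp, hNo p (hr.le.trans hp)]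
  obtain ⟨Θ, hΘ⟩ := exists_flow_of_const hX hXo
  obtain ⟨ΘY, hΘY⟩ := exists_flow_of_const hYs hYo
  obtain ⟨ΘN, hΘN⟩ := exists_flow_of_const hN hNo
  refine ⟨X, Y, Θ, ΘY, ΘN, ⟨h0.trans hr, hX, hXo, (exists_lipschitz_bound_of_const hX hXo).1, hΘ⟩,
    ⟨(innerSL ℝ).contDiff.comp hN, fun p hp => ?_, fun p => ?_, fun p hp => ?_, hσ, hw⟩,
    ⟨hYs, hN, (exists_lipschitz_bound_of_const hYs hYo).1, (exists_lipschitz_bound_of_const hN hNo).1,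
      hΘY, hΘN, fun p => ?_, fun p => ?_, fun p => ?_⟩⟩
  · rw [hNo p (hr.le.trans hp), innerSL_stdVec_two]
  · rw [innerSL_apply_apply, hNX]
  · have h1 : innerSL ℝ (N p) (N p) = 0 := by rw [hp]; rfl
    rw [innerSL_apply_apply, real_inner_self_eq_norm_sq, hN1] at h1
    norm_num at h1
  · rw [innerSL_apply_apply, inner_eq]
    simp only [hY, cross3, vec3_zero, vec3_one, vec3_two]
    ring
  · rw [innerSL_apply_apply, real_inner_self_eq_norm_sq, hN1]
    norm_num
  · have h1 := sq_norm_eq (N p)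
    have h2 := sq_norm_eq (X p)
    have h3 := hNX p
    rw [hN1] at h1
    rw [hX1] at h2
    rw [inner_eq] at h3
    have h4 : det3 (X p) (Y p) (N p) = 1 := by
      simp only [det3, hY, cross3, vec3_zero, vec3_one, vec3_two]
      linear_combination -(X p 0 ^ 2 + X p 1 ^ 2 + X p 2 ^ 2) * h1 - h2
        - (X p 0 * N p 0 + X p 1 * N p 1 + X p 2 * N p 2) * h3
    rw [h4]; norm_num

end FrameConstruction

/-! ### Passing from the confoliation to a global unit normal -/

section Reduction

lemma uniqueDiffOn_ball3 : UniqueDiffOn ℝ ball3 :=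
  uniqueDiffOn_convex (convex_closedBall 0 1)
    ⟨0, ball_subset_interior_closedBall (mem_ball_self one_pos)⟩

lemma mem_ball3 {p : R3} : p ∈ ball3 ↔ ‖p‖ ≤ 1 := mem_closedBall_zero_iff

lemma eq_smul_of_ker_eq {β : R3 →L[ℝ] ℝ} {n : R3} (hn : ‖n‖ = 1)
    (h : LinearMap.ker (innerSL ℝ n).toLinearMap ≤ LinearMap.ker β.toLinearMap) :
    β = β n • innerSL ℝ n := by
  ext v
  have h1 : v - inner ℝ n v • n ∈ LinearMap.ker (innerSL ℝ n).toLinearMap := by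
    simp [inner_sub_right, inner_smul_right, hn]
  have h2 : β (v - inner ℝ n v • n) = 0 := h h1
  rw [map_sub, map_smul, sub_eq_zero, smul_eq_mul] at h2
  simp [h2, mul_comm]

/-- A form with the same kernel is `β(N)` times the metric dual of `N`. The factor enters squared,
so neither the sign nor the vanishing found for the normal depends on the defining form. -/
lemma wedgeD_of_ker_eq {N : R3 → R3} (hN : ContDiff ℝ ∞ N) (hN1 : ∀ p, ‖N p‖ = 1)
    {β : R3 → R3 →L[ℝ] ℝ} {U : Set R3} {p : R3} (hU : IsOpen U) (hpU : p ∈ U) (hp : p ∈ ball3)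
    (hβ : ContDiffOn ℝ ∞ β (U ∩ ball3))
    (hker : ∀ q ∈ U ∩ ball3, LinearMap.ker (β q).toLinearMap
      = LinearMap.ker (innerSL ℝ (N q)).toLinearMap) :
    wedgeD β ball3 p = (β p (N p)) ^ 2
      * wedgeCoeff (innerSL ℝ (N p)) (fderiv ℝ (fun q => innerSL ℝ (N q)) p) := by
  have hα : DifferentiableAt ℝ (fun q => innerSL ℝ (N q)) p :=
    (((innerSL ℝ).contDiff.comp hN).differentiable (by simp)) p
  have hmem : U ∩ ball3 ∈ 𝓝[ball3] p :=
    Filter.inter_mem (mem_nhdsWithin_of_mem_nhds (hU.mem_nhds hpU)) self_mem_nhdsWithin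
  have hβd : DifferentiableWithinAt ℝ β ball3 p :=
    ((hβ.differentiableOn (by simp)) p ⟨hpU, hp⟩).mono_of_mem_nhdsWithin hmem
  have h1 := wedgeD_smul (β := β) (g := fun q => β q (N q)) hα.differentiableWithinAt
    (hβd.clm_apply (hN.differentiable (by simp) p).differentiableWithinAt)
    (uniqueDiffOn_ball3 p hp) hp
    (Filter.mem_of_superset hmem fun q hq => eq_smul_of_ker_eq (hN1 q) (hker q hq).ge)
  rw [h1, hα.fderivWithin (uniqueDiffOn_ball3 p hp)]

lemma IsPlaneFieldOn.ne_top {ξ : SubspaceField} {s : Set R3} (h : IsPlaneFieldOn ξ s) {p : R3}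
    (hp : p ∈ s) : ξ p ≠ ⊤ := by
  classical
  obtain ⟨U, v, w, -, hpU, -, -, hξ⟩ := h p hp
  intro htop
  have h1 := (hξ p ⟨hpU, hp⟩).2
  rw [htop] at h1
  have h2 := finrank_span_finset_le_card (R := ℝ) ({v p, w p} : Finset R3)
  rw [Finset.coe_insert, Finset.coe_singleton, Set.finrank, ← h1, finrank_top,
    finrank_euclideanSpace_fin] at h2
  exact absurd (h2.trans Finset.card_le_two) (by norm_num)

lemma IsConfoliationOn.exists_form {ξ : SubspaceField} {s : Set R3} (h : IsConfoliationOn ξ s) :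
    IsPlaneFieldOn ξ s ∧ ∃ (σ : ℝ) (α : R3 → R3 →L[ℝ] ℝ), (σ = 1 ∨ σ = -1) ∧ DefinesOn α ξ s ∧
      ∀ p ∈ s, 0 ≤ σ * wedgeD α s p := by
  rcases h with ⟨hξ, α, hα, hw⟩ | ⟨hξ, α, hα, hw⟩
  · exact ⟨hξ, 1, α, Or.inl rfl, hα, fun p hp => by simpa using hw p hp⟩
  · exact ⟨hξ, -1, α, Or.inr rfl, hα, fun p hp => by simpa using hw p hp⟩

lemma IsStandardNearBoundary.exists_shell {ξ : SubspaceField} (h : IsStandardNearBoundary ξ) :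
    ∃ r : ℝ, 0 < r ∧ r < 1 ∧ ∀ p, r ≤ ‖p‖ → ‖p‖ ≤ 1 → ξ p = LinearMap.ker dz.toLinearMap := by
  obtain ⟨U, hU, hsU, hξ⟩ := h
  have hK : IsCompact (ball3 \ U) := (isCompact_closedBall 0 1).diff hU
  have key : ∃ r : ℝ, 0 < r ∧ r < 1 ∧ ∀ p, r ≤ ‖p‖ → p ∈ ball3 → p ∈ U := by
    rcases (ball3 \ U).eq_empty_or_nonempty with he | hne
    · exact ⟨1 / 2, by norm_num, by norm_num, fun p _ hp => sdiff_eq_empty.1 he hp⟩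
    · obtain ⟨x, hx, hmax⟩ := hK.exists_isMaxOn hne continuous_norm.continuousOn
      have hx1 : ‖x‖ < 1 := lt_of_le_of_ne (mem_ball3.1 hx.1) fun h1 =>
        hx.2 (hsU (mem_sphere_zero_iff_norm.2 h1))
      refine ⟨(‖x‖ + 1) / 2, by positivity, by linarith, fun p hp hpb => ?_⟩
      by_contra hpU
      have := hmax ⟨hpb, hpU⟩
      simp only [mem_ofPred_eq] at this
      linarith
  obtain ⟨r, hr0, hr1, hr⟩ := key
  exact ⟨r, hr0, hr1, fun p hp hp1 =>
    hξ p ⟨hr p hp (mem_ball3.2 hp1), mem_ball3.2 hp1⟩⟩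

lemma isPreconnected_shell {r : ℝ} (hr : 0 < r) : IsPreconnected {p : R3 | r ≤ ‖p‖ ∧ ‖p‖ ≤ 1} := by
  have h1 : IsPreconnected (sphere (0 : R3) 1) := isPreconnected_sphere (by
    rw [← Module.finrank_eq_rank, finrank_euclideanSpace_fin]; norm_num) 0 1
  have h2 := (isPreconnected_Icc (a := r) (b := 1)).prod h1
  have h3 := h2.image (fun q : ℝ × R3 => q.1 • q.2) (by fun_prop)
  convert h3 using 1
  ext p
  constructor
  · rintro ⟨hp, hp1⟩
    have hp0 : ‖p‖ ≠ 0 := (hr.trans_le hp).ne'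
    refine ⟨(‖p‖, ‖p‖⁻¹ • p), ⟨⟨hp, hp1⟩, ?_⟩, ?_⟩
    · rw [mem_sphere_zero_iff_norm, norm_smul, norm_inv, norm_norm, inv_mul_cancel₀ hp0]
    · exact smul_inv_smul₀ hp0 p
  · rintro ⟨⟨t, x⟩, ⟨ht, hx⟩, rfl⟩
    rw [mem_sphere_zero_iff_norm] at hx
    have ht0 : 0 < t := hr.trans_le ht.1
    simp only [mem_ofPred_eq, norm_smul, hx, mul_one, Real.norm_eq_abs, abs_of_pos ht0]
    exact ht

/-- A confoliation of the ball which is standard near the boundary has a unit normal extending to the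
whole space as `∂/∂z`. -/
theorem exists_unit_normal {ξ : SubspaceField} (hconf : IsConfoliationOn ξ ball3)
    (hstd : IsStandardNearBoundary ξ) :
    ∃ (r σ : ℝ) (N : R3 → R3), 0 < r ∧ r < 1 ∧ ContDiff ℝ ∞ N ∧ (∀ p, ‖N p‖ = 1) ∧
      (∀ p, r ≤ ‖p‖ → N p = stdVec 2) ∧ (σ = 1 ∨ σ = -1) ∧
      (∀ p, 0 ≤ σ * wedgeCoeff (innerSL ℝ (N p)) (fderiv ℝ (fun q => innerSL ℝ (N q)) p)) ∧
      ∀ p ∈ ball3, ξ p = LinearMap.ker (innerSL ℝ (N p)).toLinearMap := by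
  obtain ⟨hξ, σ, α, hσ, ⟨hα, hker⟩, hw⟩ := hconf.exists_form
  obtain ⟨r, hr0, hr1, hr⟩ := hstd.exists_shell
  have hshell : ∀ p, r ≤ ‖p‖ → ‖p‖ ≤ 1 →
      α p (stdVec 0) = 0 ∧ α p (stdVec 1) = 0 ∧ α p (stdVec 2) ≠ 0 := by
    intro p hp hp1
    have h1 : ∀ v, α p v = 0 ↔ v 2 = 0 := by
      intro v
      have h2 : v ∈ LinearMap.ker (α p).toLinearMap ↔ v ∈ LinearMap.ker dz.toLinearMap := by
        rw [← hker p (mem_ball3.2 hp1), hr p hp hp1]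
      simpa using h2
    refine ⟨(h1 _).2 (by simp), (h1 _).2 (by simp), fun h2 => ?_⟩
    have := (h1 _).1 h2
    simp at this
  -- On the connected shell `α` is a nonvanishing multiple of `dz`, so its sign `ε` is constant;
  -- multiplying by `ε` coorients the normal upwards.
  obtain ⟨ε, hε, hεpos⟩ : ∃ ε : ℝ, ε ^ 2 = 1 ∧
      ∀ p, r ≤ ‖p‖ → ‖p‖ ≤ 1 → 0 < ε * α p (stdVec 2) := by
    have hcont : ContinuousOn (fun p => α p (stdVec 2)) {p : R3 | r ≤ ‖p‖ ∧ ‖p‖ ≤ 1} :=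
      (hα.continuousOn.mono fun p hp => mem_ball3.2 hp.2).clm_apply continuousOn_const
    have hpre := (isPreconnected_shell hr0).image _ hcont
    have hne : (0 : ℝ) ∉ (fun p => α p (stdVec 2)) '' {p : R3 | r ≤ ‖p‖ ∧ ‖p‖ ≤ 1} := by
      rintro ⟨p, hp, h0⟩
      exact (hshell p hp.1 hp.2).2.2 h0
    by_cases hpos : ∀ p, r ≤ ‖p‖ → ‖p‖ ≤ 1 → 0 < α p (stdVec 2)
    · exact ⟨1, by norm_num, fun p hp hp1 => by simpa using hpos p hp hp1⟩
    · push Not at hpos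
      obtain ⟨x, hx, hx1, hx0⟩ := hpos
      refine ⟨-1, by norm_num, fun p hp hp1 => ?_⟩
      by_contra hneg
      exact hne (hpre.ordConnected.out (mem_image_of_mem _ ⟨hx, hx1⟩)
        (mem_image_of_mem _ ⟨hp, hp1⟩) ⟨hx0, by linarith⟩)
  have hε1 : |ε| = 1 :=
    (pow_eq_one_iff_of_nonneg (abs_nonneg ε) two_ne_zero).1 (by rw [sq_abs, hε])
  have hε0 : ε ≠ 0 := by rintro rfl; norm_num at hε
  set n : R3 → R3 := fun p => vec3 (α p (stdVec 0)) (α p (stdVec 1)) (α p (stdVec 2)) with hn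
  have hnα : ∀ p, innerSL ℝ (n p) = α p := by
    intro p; ext v
    rw [innerSL_apply_apply, inner_eq]
    conv_rhs => rw [eq_sum_stdVec v]
    simp [hn]; ring
  have hn0 : ∀ p ∈ ball3, n p ≠ 0 := by
    intro p hp h0
    refine hξ.ne_top hp ?_
    rw [hker p hp, ← hnα, h0, map_zero]
    exact LinearMap.ker_zero
  have hns : ∀ p, ‖p‖ < 1 → ContDiffAt ℝ ∞ n p := by
    intro p hp
    have h1 : ContDiffAt ℝ ∞ α p := hα.contDiffAt
      (Filter.mem_of_superset (isOpen_ball.mem_nhds (mem_ball_zero_iff.2 hp)) ball_subset_closedBall)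
    rw [contDiffAt_euclidean]
    intro i
    fin_cases i <;> exact h1.clm_apply contDiffAt_const
  classical
  set N : R3 → R3 := fun p => if ‖p‖ < 1 then (ε * ‖n p‖⁻¹) • n p else stdVec 2 with hN
  have hNin : ∀ p, ‖p‖ < 1 → N p = (ε * ‖n p‖⁻¹) • n p := fun p hp => by simp [hN, hp]
  have hNo : ∀ p, r ≤ ‖p‖ → N p = stdVec 2 := by
    intro p hp
    by_cases hp1 : ‖p‖ < 1
    · obtain ⟨h1, h2, h3⟩ := hshell p hp hp1.le
      have h4 : n p = α p (stdVec 2) • stdVec 2 := by apply ext3 <;> simp [hn, h1, h2]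
      have h5 : ‖n p‖ = ε * α p (stdVec 2) := by
        have h6 : ‖stdVec 2‖ = 1 := by simp [stdVec]
        rw [h4, norm_smul, h6, mul_one, Real.norm_eq_abs, ← abs_of_pos (hεpos p hp hp1.le),
          abs_mul, hε1, one_mul]
      rw [hNin p hp1, h5, h4, smul_smul]
      have h6 : ε * (ε * α p (stdVec 2))⁻¹ * α p (stdVec 2) = 1 := by
        have h7 := (hεpos p hp hp1.le).ne'
        rw [mul_right_comm, mul_inv_cancel₀ h7]
      rw [h6, one_smul]
    · simp [hN, hp1]
  have hNs : ContDiff ℝ ∞ N := by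
    rw [contDiff_iff_contDiffAt]
    intro p
    rcases lt_or_ge ‖p‖ 1 with hp | hp
    · have h1 : ContDiffAt ℝ ∞ (fun p => (ε * ‖n p‖⁻¹) • n p) p := by
        have h2 := hn0 p (mem_ball3.2 hp.le)
        exact (contDiffAt_const.mul (((hns p hp).norm ℝ h2).inv (norm_ne_zero_iff.2 h2))).smul
          (hns p hp)
      refine h1.congr_of_eventuallyEq ?_
      filter_upwards [continuous_norm.continuousAt.eventually (gt_mem_nhds hp)] with q hq
        using hNin q hq
    · refine (contDiffAt_const (c := stdVec 2)).congr_of_eventuallyEq ?_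
      filter_upwards [continuous_norm.continuousAt.eventually (lt_mem_nhds (hr1.trans_le hp))]
        with q hq using hNo q hq.le
  have hN1 : ∀ p, ‖N p‖ = 1 := by
    intro p
    by_cases hp : ‖p‖ < 1
    · have h2 := norm_ne_zero_iff.2 (hn0 p (mem_ball3.2 hp.le))
      rw [hNin p hp, norm_smul, Real.norm_eq_abs, abs_mul, hε1, abs_inv, abs_norm, one_mul,
        inv_mul_cancel₀ h2]
    · simp [hN, hp, stdVec]
  have hNker : ∀ p ∈ ball3, ξ p = LinearMap.ker (innerSL ℝ (N p)).toLinearMap := by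
    intro p hp
    by_cases hp1 : ‖p‖ < 1
    · have h2 := norm_ne_zero_iff.2 (hn0 p hp)
      ext v
      rw [hker p hp, ← hnα, hNin p hp1]
      simp [hε0, h2]
    · rw [hr p (hr1.le.trans (not_lt.1 hp1)) (mem_ball3.1 hp), hNo p (hr1.le.trans (not_lt.1 hp1)),
        innerSL_stdVec_two]
  refine ⟨r, σ, N, hr0, hr1, hNs, hN1, hNo, hσ, fun p => ?_, hNker⟩
  rcases lt_or_ge 1 ‖p‖ with hp | hp
  · have h1 : (fun q => innerSL ℝ (N q)) =ᶠ[𝓝 p] fun _ => innerSL ℝ (stdVec 2) := by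
      filter_upwards [continuous_norm.continuousAt.eventually (lt_mem_nhds (hr1.trans hp))]
        with q hq using by rw [hNo q hq.le]
    rw [h1.fderiv_eq]
    simp [wedgeCoeff]
  · have hpb := mem_ball3.2 hp
    have h1 := hw p hpb
    rw [wedgeD_of_ker_eq hNs hN1 isOpen_univ (mem_univ p) hpb (by simpa using hα)
      (fun q hq => by rw [← hker q hq.2, hNker q hq.2])] at h1
    have h2 : α p (N p) ≠ 0 := by
      intro h0
      have h3 : N p ∈ LinearMap.ker (innerSL ℝ (N p)).toLinearMap := by
        rw [← hNker p hpb, hker p hpb]; exact h0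
      have h4 : inner ℝ (N p) (N p) = (0 : ℝ) := h3
      rw [real_inner_self_eq_norm_sq, hN1] at h4
      norm_num at h4
    rw [mul_left_comm] at h1
    exact nonneg_of_mul_nonneg_right h1 (by positivity)

end Reduction

/-! ### Compressing the support into the ball -/

section Compression

/-- A diffeomorphism stretching the `x`-axis, which is the identity on the ball of radius `r` and is
linear with a large factor outside the ball of radius `r'`. -/
lemma exists_stretch {r r' M : ℝ} (hr : 0 < r) (hr' : r < r') (hM : 1 ≤ M) :
    ∃ k k' : R3 → R3, IsDiffeoPair k k' ∧ (∀ p, ‖p‖ ≤ r → k p = p) ∧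
      (∀ p, k p 1 = p 1 ∧ k p 2 = p 2) ∧ (∀ p, ‖p‖ ≤ ‖k p‖) ∧ ∀ p, r' ≤ ‖p‖ → k p 0 = M * p 0 := by
  set D := r' ^ 2 - r ^ 2 with hD
  have hD0 : 0 < D := sub_pos.2 (pow_lt_pow_left₀ hr' hr.le two_ne_zero)
  set μ : R3 → ℝ := fun p => (M - 1) * Real.smoothTransition ((‖p‖ ^ 2 - r ^ 2) / D) with hμ
  have hμs : ContDiff ℝ ∞ μ := contDiff_const.mul (Real.smoothTransition.contDiff.comp
    (((contDiff_norm_sq ℝ).sub contDiff_const).div_const D))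
  have hμ0 : ∀ p, 0 ≤ μ p := fun p => mul_nonneg (by linarith) (Real.smoothTransition.nonneg _)
  have hμr : ∀ p, ‖p‖ ≤ r → μ p = 0 := fun p hp => by
    simp only [hμ]
    rw [Real.smoothTransition.zero_of_nonpos, mul_zero]
    exact div_nonpos_of_nonpos_of_nonneg
      (sub_nonpos.2 (pow_le_pow_left₀ (norm_nonneg p) hp 2)) hD0.le
  have hμr' : ∀ p, r' ≤ ‖p‖ → μ p = M - 1 := fun p hp => by
    simp only [hμ]
    rw [Real.smoothTransition.one_of_one_le, mul_one]
    rw [one_le_div hD0]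
    exact sub_le_sub_right (pow_le_pow_left₀ (hr.trans hr').le hp 2) _
  -- The factor `1 + μ` is nondecreasing in the radius, so `x * ∂μ/∂x ≥ 0` and the map is increasing
  -- in `x`.
  obtain ⟨k', hk⟩ := exists_isDiffeoPair_shear (g := fun p => μ p * p 0)
    (hμs.mul (contDiff_coord 0)) 0 (fun p => by
      have h1 : ∀ t : ℝ, ‖p + t • stdVec 0‖ ^ 2 = (p 0 + t) ^ 2 + (p 1 ^ 2 + p 2 ^ 2) := fun t => by
        rw [sq_norm_eq]; simp; ring
      set u : ℝ → ℝ := fun t => ((p 0 + t) ^ 2 + (p 1 ^ 2 + p 2 ^ 2) - r ^ 2) / D with hu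
      have h2 : HasDerivAt u (2 * p 0 / D) 0 := by
        have h3 := (((((hasDerivAt_id (0 : ℝ)).const_add (p 0)).fun_pow 2).add_const
          (p 1 ^ 2 + p 2 ^ 2)).sub_const (r ^ 2)).div_const D
        simpa using h3
      set d := deriv Real.smoothTransition (u 0) with hd
      have hd0 : 0 ≤ d := Real.smoothTransition.monotone.deriv_nonneg
      have h3 : HasDerivAt (fun t => Real.smoothTransition (u t)) (d * (2 * p 0 / D)) 0 :=
        ((Real.smoothTransition.contDiff (n := 1)).differentiable (by simp) _).hasDerivAt.comp
          (0 : ℝ) h2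
      have h4 := (h3.const_mul (M - 1)).fun_mul ((hasDerivAt_id' (0 : ℝ)).const_add (p 0))
      refine ⟨_, h4.congr_of_eventuallyEq (Filter.Eventually.of_forall fun t => ?_), ?_⟩
      · simp only [hμ, h1]
        simp [hu]
      · have h5 := Real.smoothTransition.nonneg (u 0)
        have h6 : (M - 1) * (d * (2 * p 0 / D)) * (p 0 + 0)
            = (M - 1) * d * (2 * p 0 ^ 2 / D) := by ring
        rw [h6]
        have h7 : 0 ≤ M - 1 := by linarith
        positivity)
    (fun p => ⟨-|p 0|, by
      simp
      nlinarith [hμ0 (p + -(|p 0| • stdVec 0)), neg_abs_le (p 0), le_abs_self (p 0), abs_nonneg (p 0)]⟩)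
    (fun p => ⟨|p 0|, by
      simp
      nlinarith [hμ0 (p + |p 0| • stdVec 0), neg_abs_le (p 0), abs_nonneg (p 0)]⟩)
  refine ⟨_, k', hk, fun p hp => by simp [hμr p hp], fun p => by simp, fun p => ?_, fun p hp => ?_⟩
  · refine le_of_sq_le_sq ?_ (norm_nonneg _)
    rw [sq_norm_eq, sq_norm_eq]
    simp
    have h1 : p 0 + μ p * p 0 = (1 + μ p) * p 0 := by ring
    rw [h1, mul_pow]
    nlinarith [hμ0 p, sq_nonneg (p 0), mul_nonneg (hμ0 p) (sq_nonneg (p 0)),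
      mul_nonneg (mul_nonneg (hμ0 p) (hμ0 p)) (sq_nonneg (p 0))]
  · simp [hμr' p hp]; ring

/-- A diffeomorphism supported in a cylinder can be compressed into a ball, without changing the
pull-back of `ker dz` in case that is standard outside a smaller ball. -/
lemma exists_compression {r r' L : ℝ} {F G : R3 → R3} {α : R3 → R3 →L[ℝ] ℝ} (hr : 0 < r)
    (hr' : r < r') (hα : ∀ p, r ≤ ‖p‖ → α p = dz) (hF : IsDiffeoPair F G)
    (hL : ∀ q : R3, L ≤ |q 0| ∨ r ^ 2 ≤ q 1 ^ 2 + q 2 ^ 2 → F q = q)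
    (hFα : ∀ q v, fderiv ℝ F q v 2 = 0 ↔ α q v = 0) :
    ∃ φ ψ : R3 → R3, IsDiffeoPair φ ψ ∧ (∀ p, r' ≤ ‖p‖ → φ p = p) ∧
      ∀ p v, fderiv ℝ φ p v 2 = 0 ↔ α p v = 0 := by
  set δ := Real.sqrt (r' ^ 2 - r ^ 2) with hδ
  have hD0 : 0 < r' ^ 2 - r ^ 2 := sub_pos.2 (pow_lt_pow_left₀ hr' hr.le two_ne_zero)
  have hδ0 : 0 < δ := Real.sqrt_pos.2 hD0
  have hδ2 : δ ^ 2 = r' ^ 2 - r ^ 2 := Real.sq_sqrt hD0.le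
  -- Outside the ball of radius `r'` but inside the cylinder one has `|x| ≥ δ`; the factor `L / δ`
  -- carries such points to `|x| ≥ L`, where `F` is the identity.
  obtain ⟨k, k', hk, hkr, hk12, hkn, hkM⟩ := exists_stretch hr hr' (le_max_left 1 (L / δ))
  have hφ := hk.symm.comp (hF.comp hk)
  refine ⟨_, _, hφ, fun p hp => ?_, fun p v => ?_⟩
  · have h1 : F (k p) = k p := by
      refine hL _ ?_
      rw [(hk12 p).1, (hk12 p).2, hkM p hp]
      by_cases hout : r ^ 2 ≤ p 1 ^ 2 + p 2 ^ 2
      · exact Or.inr hout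
      · left
        have h2 : δ ≤ |p 0| := by
          refine le_of_sq_le_sq ?_ (abs_nonneg _)
          have h3 := sq_norm_eq p
          have h4 := pow_le_pow_left₀ (hr.trans hr').le hp 2
          rw [sq_abs]; linarith
        rw [abs_mul, abs_of_nonneg (zero_le_one.trans (le_max_left _ _))]
        calc L = L / δ * δ := (div_mul_cancel₀ _ hδ0.ne').symm
          _ ≤ max 1 (L / δ) * |p 0| := by
            refine mul_le_mul (le_max_right _ _) h2 hδ0.le
              (zero_le_one.trans (le_max_left _ _))
    simp [h1, hk.left_inv]
  · have hk'2 : ∀ q, k' q 2 = q 2 := fun q => by rw [← (hk12 (k' q)).2, hk.right_inv]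
    have h1 : fderiv ℝ (k' ∘ F ∘ k) p v 2 = fderiv ℝ F (k p) (fderiv ℝ k p v) 2 := by
      have h2 := (hφ.differentiable p).hasFDerivAt.coord 2
      have h3 := ((hF.differentiable (k p)).hasFDerivAt.comp p
        (hk.differentiable p).hasFDerivAt).coord 2
      have h4 := h3.congr_of_eventuallyEq (f₁ := fun q => (k' ∘ F ∘ k) q 2)
        (Filter.Eventually.of_forall fun q => hk'2 _)
      exact congr($(h2.unique h4) v)
    rw [h1, hFα]
    -- Inside the small ball `k` is the identity. Outside, `α` is `dz` at both `p` and `k p`,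
    -- because `k` does not decrease norms, and `k` preserves `z`.
    rcases lt_or_ge ‖p‖ r with hp | hp
    · have h2 : HasFDerivAt k (ContinuousLinearMap.id ℝ R3) p := by
        refine (hasFDerivAt_id p).congr_of_eventuallyEq ?_
        filter_upwards [continuous_norm.continuousAt.eventually (gt_mem_nhds hp)] with q hq
          using hkr q hq.le
      rw [h2.fderiv, hkr p hp.le]
      rfl
    · have h2 := (hk.differentiable p).hasFDerivAt.coord 2
      have h3 := (HasFDerivAt.coord (hasFDerivAt_id p) 2).congr_of_eventuallyEq
        (f₁ := fun q => k q 2) (Filter.Eventually.of_forall fun q => (hk12 q).2)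
      have h4 : fderiv ℝ k p v 2 = v 2 := congr($(h2.unique h3) v)
      rw [hα p hp, hα _ (hp.trans (hkn p)), dz_apply, dz_apply, h4]

/-- An image outside the ball would itself be fixed, so by injectivity it would equal the original
point. -/
lemma IsDiffeoPair.mapsTo_ball3 {φ ψ : R3 → R3} (h : IsDiffeoPair φ ψ) {r : ℝ} (hr : r ≤ 1)
    (hφ : ∀ p, r ≤ ‖p‖ → φ p = p) : MapsTo φ ball3 ball3 := by
  intro p hp
  by_contra hout
  rw [mem_ball3, not_le] at hout
  have h1 := hφ _ (hr.trans hout.le)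
  have h2 : φ p = p := by
    have := congr_arg ψ h1
    rwa [h.left_inv, h.left_inv] at this
  rw [h2] at hout
  exact hout.not_ge (mem_ball3.1 hp)

lemma IsDiffeoPair.isDiffeoOf_ball3 {φ ψ : R3 → R3} (h : IsDiffeoPair φ ψ) {r : ℝ} (hr : r ≤ 1)
    (hφ : ∀ p, r ≤ ‖p‖ → φ p = p) : IsDiffeoOf φ ball3 :=
  ⟨h.contDiff.contDiffOn, h.mapsTo_ball3 hr hφ, ψ, h.contDiff_inv.contDiffOn,
    h.symm.mapsTo_ball3 hr fun p hp => by
      conv_lhs => rw [← hφ p hp]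
      exact h.left_inv p,
    fun p _ => h.left_inv p, fun p _ => h.right_inv p⟩

end Compression

/-! ### Conclusion -/

theorem mainTheorem8 (ξ : SubspaceField) (hconf : IsConfoliationOn ξ ball3)
    (hstd : IsStandardNearBoundary ξ) :
    IsFoliationOn ξ ball3 ∧ AreDiffeomorphicOn ξ stdField ball3 ∧
      ∀ p ∈ ball3, ¬ IsContactAt ξ ball3 p := by
  obtain ⟨r₀, σ, N, h0, h1, hN, hN1, hNo, hσ, hw, hξ⟩ := exists_unit_normal hconf hstd
  -- Nested radii `r₀ < r < r' < 1`: the normal is standard from `r₀` on, the tangent field from `r`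
  -- on, and the final diffeomorphism is the identity from `r'` on.
  obtain ⟨r, hr0, hr⟩ := exists_between h1
  obtain ⟨r', hr', hr'1⟩ := exists_between hr
  obtain ⟨X, Y, Θ, ΘY, ΘN, hX, hα, hF⟩ := exists_frame h0 hr0 hN hN1 hNo hσ hw
  have hzero := wedgeCoeff_eq_zero hX hα hF
  have hint : ∀ (U : Set R3) (β : R3 → R3 →L[ℝ] ℝ) (p : R3), IsOpen U → p ∈ U → p ∈ ball3 →
      DefinesOn β ξ (U ∩ ball3) → wedgeD β ball3 p = 0 := by
    intro U β p hU hpU hp hβ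
    rw [wedgeD_of_ker_eq hN hN1 hU hpU hp hβ.1 fun q hq => by rw [← hβ.2 q hq, hξ q hq.2],
      hzero, mul_zero]
  obtain ⟨hpf, -, β, -, hβ, -⟩ := hconf.exists_form
  refine ⟨⟨hpf, β, hβ, fun p hp => hint univ β p isOpen_univ (mem_univ p) hp
    (by rwa [univ_inter])⟩, ?_, fun p hp ⟨U, γ, hU, hpU, hγ, hne⟩ => hne (hint U γ p hU hpU hp hγ)⟩
  obtain ⟨F, G, hFG, ⟨L, hL⟩, hFα⟩ := exists_straightening hX hα hF
  obtain ⟨φ, ψ, hφ, hφo, hφα⟩ := exists_compression hX.pos hr' hα.std hFG hL hFα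
  refine ⟨φ, hφ.isDiffeoOf_ball3 hr'1.le hφo, fun p hp => ?_⟩
  rw [(hφ.differentiable p).fderivWithin (uniqueDiffOn_ball3 p hp), hξ p hp]
  ext w
  rw [Submodule.mem_map]
  constructor
  · rintro ⟨v, hv, rfl⟩
    exact (hφα p v).2 hv
  · intro hw
    refine ⟨fderiv ℝ ψ (φ p) w, (hφα p _).1 ?_, ?_⟩
    · have h2 := hφ.symm.fderiv_inv_fderiv (φ p) w
      rw [hφ.left_inv] at h2
      rw [h2]; exact hw
    · have h2 := hφ.symm.fderiv_inv_fderiv (φ p) w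
      rwa [hφ.left_inv] at h2
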